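/- **Setup.** Let $m,n\ge 0$ be integers with $n$ even and $N=m+n>2$; put $s=\lfloor N/2\rfloor$ and $i'=N+1-i$. Let $V$ be the superspace of dimension $m|n$ over $\mathbb{C}(q^{1/2})$ with homogeneous basis $v_1,\dots,v_N$, $n$ of them odd, $\overline{i}=|v_i|\in\mathbb{Z}/2$, $\overline{i}=\overline{i'}$, and let $\vartheta_i=\pm1$ satisfy $\vartheta_i=1$ for $\overline{i}=\bar0$ and $\vartheta_i=-\vartheta_{i'}$ for $\overline{i}=\bar1$. Put $(\varepsilon_i,\varepsilon_j)=(-1)^{\overline{i}}(\delta_{ij}-\delta_{ij'})$ for $1\le i,j\le N$. Let $X_{ij}=E_{ij}-(-1)^{\overline{i}(\overline{i}+\overline{j})}\vartheta_i\vartheta_jE_{j'i'}$. The quantum supergroup $U_q(\mathfrak{osp}(V))$ with generators $e_i,f_i,q^{\pm h_i/2}$ ($1\le i\le s$) acts on $V$ as follows: $e_i=X_{i,i+1}$, $f_i=(-1)^{\overline{i}}X_{i+1,i}$, $h_i=(-1)^{\overline{i}}X_{ii}-(-1)^{\overline{i+1}}X_{i+1,i+1}$, except that for $i=s$ and $m$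 even one takes $e_s=X_{s-1,s+1}$, $f_s=(-1)^{\overline{s-1}}X_{s+1,s-1}$, $h_s=(-1)^{\overline{s-1}}X_{s-1,s-1}-(-1)^{\overline{s+1}}X_{s+1,s+1}$ if $\overline{s}=\bar0$, and $e_s=E_{s,s+1}$, $f_s=-(q+q^{-1})E_{s+1,s}$, $h_s=-2X_{ss}$ if $\overline{s}=\bar1$. It acts on $V\otimes V$ through $\Delta(x)=q^{h_i/2}\otimes x+x\otimes q^{-h_i/2}$ for $x=e_i,f_i$ and $\Delta(q^{\pm h_i/2})=q^{\pm h_i/2}\otimes q^{\pm h_i/2}$, with the sign rule $(x\otimes y)(v\otimes w)=(-1)^{|y||v|}xv\otimes yw$. **Vectors.** Let $w_1=v_1\otimes v_1$, $w_2=v_1\otimes v_2-(-1)^{\overline1(\overline1+\overline2)}q^{(-1)^{\overline1}}v_2\otimes v_1$ and $w_3=\sum_{i=1}^Nc_i\,v_i\otimes v_{i'}$, where $c_1=1$, and with $r_{ab}=q^{(-1)^{\overline a}/2+(-1)^{\overline b}/2}\vartheta_a\vartheta_b$ one has $c_{a+1}=r_{a,a+1}c_a$ and $c_{a'}=(-1)^{\overline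 a+\overline{a+1}}r_{a,a+1}c_{(a+1)'}$ for $1\le a<s$, together with: $c_{s+1}=q^{(-1)^{\overline s}/2}\vartheta_s\vartheta_{s+1}c_s$ and $c_{s+2}=(-1)^{\overline s+\overline{s+1}}q^{(-1)^{\overline s}/2}\vartheta_s\vartheta_{s+1}c_{s+1}$ for odd $m$; $c_{s+1}=r_{s-1,s+1}c_{s-1}$ for even $m$, $\overline s=\bar0$; $c_{s+1}=-q^{-2}c_s$ for even $m$, $\overline s=\bar1$. **Subspaces.** For a sign $\sigma=\pm$ and $1\le i\le j\le N$ (with $(i,j)\ne(s+1,s+1)$ if $N$ is odd) let $$u^\sigma_{ij}=v_i\otimes v_j+\sigma(-1)^{\overline1+\overline i\,\overline j}q^{-\sigma(-1)^{\overline1}}q^{-(\varepsilon_i,\varepsilon_j)}v_j\otimes v_i\qquad(j\ne i').$$ Put $\{i\}^\sigma_{\pm}=v_i\otimes v_{i'}+\sigma(-1)^{\overline1+\overline i}q^{-\sigma(-1)^{\overline1}}q^{\pm(\varepsilon_i,\varepsilon_i)}v_{i'}\otimes v_i$ and $z^\sigma_{i,k}=\{i\}^\sigma_--(-1)^{\overline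 i+\overline k}q^{-(\varepsilon_i,\varepsilon_i)/2-(\varepsilon_k,\varepsilon_k)/2}\vartheta_i\vartheta_k\{k\}^\sigma_+$. Let $u^\sigma_{ii'}=z^\sigma_{i,i+1}$, except that for $m$ even and $i=s$ one has $u^\sigma_{ss'}=z^\sigma_{s-1,s'}$ if $\overline s=\bar0$ and $u^\sigma_{ss'}=\{s\}^\sigma_-$ if $\overline s=\bar1$. Let $W^\sigma$ be the span of all $u^\sigma_{ij}$ with $i<j$ and of the $u^\sigma_{ii}$ ($i\neq i'$) with $\overline i=\overline1$ for $\sigma=+$, resp. $\overline i\ne\overline1$ for $\sigma=-$; but for $m$ even and $\overline s=\bar1$ the vector $u^\sigma_{ss'}$ is included only if $\overline s=\overline1$ for $\sigma=+$, resp. only if $\overline s\ne\overline1$ for $\sigma=-$. Let $W_3=\mathrm{Span}(w_3)$. **Statement.** 1. $w_1,w_2,w_3$ are highest weight vectors of weights $2\varepsilon_1$, $\varepsilon_1+\varepsilon_2$, $0$. The subspaces $W^+,W^-,W_3$ are subrepresentations of $V\otimes V$, and $W^+\cap W^-=0$. 2. If $n\ne m$, then $V\otimes V=W^+\oplus W^-\oplus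 W_3$. 3. If $n=m$, then $W_3\subset W^+$ when $\overline1=\bar0$ and $W_3\subset W^-$ when $\overline1=\bar1$; the subspace $W^+\oplus W^-$ has codimension $1$ in $V\otimes V$; and $V\otimes V$ is not semisimple. 4. In all cases $v_1\otimes v_{1'}$ and $v_{1'}\otimes v_1$ do not lie in $W^+\oplus W^-$, while $$v_1\otimes v_{1'}-(-1)^{\overline1}q^{(-1)^{\overline1}}q^{n-m+1}\,v_{1'}\otimes v_1\in W^+\oplus W^-.$$ 5. $W^+$ is generated by $w_1$, except when $m=n=2$ and $\overline2=\bar1$. $W^-$ is generated by $w_2$, except when $(m,n)=(4,0)$, or when $m=n=2$ and $\overline2=\bar0$. $W_3$ is generated by $w_3$. 6. If $n\ne m$, then $W^+$, $W^-$ and $W_3$ are irreducible, except that $W^-$ is not asserted to be irreducible when $(m,n)=(4,0)$. -/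

import Mathlib

open scoped TensorProduct

noncomputable section

namespace Osp

/-- The ground field `ℂ(q^{1/2})`; the indeterminate of `RatFunc ℂ` is `q^{1/2}`. -/
abbrev K : Type := RatFunc ℂ

/-- `qh k = q^{k/2}`. -/
def qh (k : ℤ) : K := (RatFunc.X : K) ^ k

/-- The sign `(-1)^x` of a parity `x ∈ ℤ/2`. -/
def sgn (x : ZMod 2) : ℤ := if x = 0 then 1 else -1

/-- The combinatorial data of a superspace `V` of dimension `m|n`, with homogeneous basis
`v_1, …, v_N`, `N = m + n`, and of the orthosymplectic form: the parities `par i` of the basis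
vectors and the signs `theta i = ±1`. Only the values at `1 ≤ i ≤ N` matter.
The involution is `i' = N + 1 - i`. -/
structure Data (m n : ℕ) where
  par : ℕ → ZMod 2
  theta : ℕ → ℤˣ
  par_symm : ∀ i, 1 ≤ i → i ≤ m + n → par (m + n + 1 - i) = par i
  card_odd : ((Finset.Icc 1 (m + n)).filter (fun i => par i = 1)).card = n
  theta_even : ∀ i, 1 ≤ i → i ≤ m + n → par i = 0 → theta i = 1
  theta_odd : ∀ i, 1 ≤ i → i ≤ m + n → par i = 1 → theta i = - theta (m + n + 1 - i)

namespace Data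

variable {m n : ℕ} (D : Data m n)

/-- `s = ⌊N/2⌋`. -/
def s (_ : Data m n) : ℕ := (m + n) / 2

/-- The involution `i ↦ i' = N + 1 - i`. -/
def bar (_ : Data m n) (i : ℕ) : ℕ := m + n + 1 - i

/-- The pairing `(ε_i, ε_j)` for `1 ≤ i, j ≤ N`: it is `δ_{ij} (-1)^{par i}` for `i, j ≤ s`, with
`ε_{i'} = -ε_i` (so that `ε_{s+1} = 0` for odd `N`). -/
def eps (i j : ℕ) : ℤ :=
  sgn (D.par i) * ((if i = j then 1 else 0) - (if i = D.bar j then 1 else 0))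

/-- The underlying space of `V`. -/
abbrev V (_ : Data m n) : Type := Fin (m + n) → K

/-- `V ⊗ V`. -/
def VV : Type := D.V ⊗[K] D.V

instance : AddCommGroup D.VV := inferInstanceAs (AddCommGroup (D.V ⊗[K] D.V))

instance : Module K D.VV := inferInstanceAs (Module K (D.V ⊗[K] D.V))

/-- The identification of `VV` with the tensor product, as a linear equivalence. -/
def equivTensor : (D.V ⊗[K] D.V) ≃ₗ[K] D.VV := LinearEquiv.refl K (D.V ⊗[K] D.V)

/-- The pure tensor `x ⊗ y`. -/
def tmul (x y : D.V) : D.VV := D.equivTensor (x ⊗ₜ[K] y)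

/-- The basis vector `v_k` of `V`, `1 ≤ k ≤ N`. -/
def v (k : ℕ) : D.V := fun j => if (j : ℕ) + 1 = k then 1 else 0

abbrev Mat (_ : Data m n) : Type := Matrix (Fin (m + n)) (Fin (m + n)) K

/-- The elementary matrix `E_{ab}`, `1 ≤ a, b ≤ N`. -/
def E (a b : ℕ) : D.Mat :=
  Matrix.of fun i j => if (i : ℕ) + 1 = a ∧ (j : ℕ) + 1 = b then 1 else 0

/-- `X_{ij} = E_{ij} - (-1)^{i(i+j)} θ_i θ_j E_{j'i'}` (parities in the exponent). -/
def X (i j : ℕ) : D.Mat :=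
  D.E i j - ((sgn (D.par i * (D.par i + D.par j)) * D.theta i * D.theta j : ℤ) : K) •
    D.E (D.bar j) (D.bar i)

/-- The `a`-th diagonal entry of `X_{ii} = E_{ii} - E_{i'i'}`, i.e. `ε_a(X_{ii})`. -/
def xdiag (i a : ℕ) : ℤ := (if a = i then 1 else 0) - (if a = D.bar i then 1 else 0)

/-- The matrix of `e_i` on `V`, `1 ≤ i ≤ s`. The last node `i = s` depends on the case: `m` odd;
`m` even and `v_s` even; `m` even and `v_s` odd. -/
def eMat (i : ℕ) : D.Mat :=
  if i = D.s ∧ Even m then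
    if D.par D.s = 0 then D.X (D.s - 1) (D.s + 1) else D.E D.s (D.s + 1)
  else D.X i (i + 1)

/-- The matrix of `f_i` on `V`, with the correction factor `κ_s = (q + q⁻¹)/2` included when `m` is
even and `v_s` is odd. -/
def fMat (i : ℕ) : D.Mat :=
  if i = D.s ∧ Even m then
    if D.par D.s = 0 then
      (sgn (D.par (D.s - 1)) : K) • D.X (D.s + 1) (D.s - 1)
    else ((qh 2 + qh (-2)) / 2) • ((-2 : K) • D.E (D.s + 1) D.s)
  else (sgn (D.par i) : K) • D.X (i + 1) i

/-- The `a`-th diagonal entry `ε_a(h_i)` of the diagonal matrix `h_i`. -/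
def h (i a : ℕ) : ℤ :=
  if i = D.s ∧ Even m then
    if D.par D.s = 0 then
      sgn (D.par (D.s - 1)) * D.xdiag (D.s - 1) a - sgn (D.par (D.s + 1)) * D.xdiag (D.s + 1) a
    else -2 * D.xdiag D.s a
  else sgn (D.par i) * D.xdiag i a - sgn (D.par (i + 1)) * D.xdiag (i + 1) a

/-- The parity of `e_i` and `f_i`. -/
def genPar (i : ℕ) : ZMod 2 :=
  if i = D.s ∧ Even m then
    if D.par D.s = 0 then D.par (D.s - 1) + D.par (D.s + 1) else 0
  else D.par i + D.par (i + 1)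

/-- The matrix of `q^{c h_i / 2}` on `V`. -/
def kMat (i : ℕ) (c : ℤ) : D.Mat := Matrix.diagonal fun a => qh (c * D.h i ((a : ℕ) + 1))

/-- The diagonal matrix `v_a ↦ (-1)^{p |v_a|} v_a`. -/
def signMat (p : ZMod 2) : D.Mat :=
  Matrix.diagonal fun a => (sgn (p * D.par ((a : ℕ) + 1)) : K)

/-- The action of `x ⊗ y` on `V ⊗ V`, for `y` homogeneous of parity `p`:
`v ⊗ w ↦ (-1)^{p |v|} x v ⊗ y w` for homogeneous `v`. -/
def superTensor (p : ZMod 2) (x y : D.Mat) : Module.End K D.VV :=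
  D.equivTensor.conj
    (TensorProduct.map (Matrix.toLin' (x * D.signMat p)) (Matrix.toLin' y))

theorem superTensor_tmul (p : ZMod 2) (x y : D.Mat) (a b : D.V) :
    D.superTensor p x y (D.tmul a b) =
      D.tmul (Matrix.toLin' (x * D.signMat p) a) (Matrix.toLin' y b) := by
  simp [superTensor, tmul, LinearEquiv.conj_apply]

/-- `e_i` on `V ⊗ V`, through `Δ(e_i) = q^{h_i/2} ⊗ e_i + e_i ⊗ q^{-h_i/2}`. -/
def eOp (i : ℕ) : Module.End K D.VV :=
  D.superTensor (D.genPar i) (D.kMat i 1) (D.eMat i) + D.superTensor 0 (D.eMat i) (D.kMat i (-1))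

/-- `f_i` on `V ⊗ V`, through `Δ(f_i) = q^{h_i/2} ⊗ f_i + f_i ⊗ q^{-h_i/2}`. -/
def fOp (i : ℕ) : Module.End K D.VV :=
  D.superTensor (D.genPar i) (D.kMat i 1) (D.fMat i) + D.superTensor 0 (D.fMat i) (D.kMat i (-1))

/-- `q^{c h_i/2}` on `V ⊗ V`, for `c = ±1`, through `Δ(q^{±h_i/2}) = q^{±h_i/2} ⊗ q^{±h_i/2}`. -/
def kOp (i : ℕ) (c : ℤ) : Module.End K D.VV := D.superTensor 0 (D.kMat i c) (D.kMat i c)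

/-- The operators by which the generators `e_i, f_i, q^{±h_i/2}`, `1 ≤ i ≤ s`, of the quantum
supergroup `U_q(osp(V))` act on `V ⊗ V`. -/
def generators : Set (Module.End K D.VV) :=
  {x | ∃ i, 1 ≤ i ∧ i ≤ D.s ∧ (x = D.eOp i ∨ x = D.fOp i ∨ x = D.kOp i 1 ∨ x = D.kOp i (-1))}

/-- The algebra of operators on `V ⊗ V` by which `U_q(osp(V))` acts. Since the action of
`U_q(osp(V))` factors through this quotient, subrepresentations, generated submodules,
irreducibility and semisimplicity over `U_q(osp(V))` are those over this algebra. -/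
def U : Subalgebra K (Module.End K D.VV) := Algebra.adjoin K D.generators

/-- Any algebra with generators acting by the above operators has image `D.U` in `End (V ⊗ V)`,
whatever the relations between its generators. -/
theorem range_eq_U {A : Type*} [Ring A] [Algebra K A] (S : Set A)
    (hS : Algebra.adjoin K S = ⊤) (ρ : A →ₐ[K] Module.End K D.VV)
    (hρ : ρ '' S = D.generators) : ρ.range = D.U := by
  rw [U, ← hρ, ← AlgHom.map_adjoin, hS, Algebra.map_top]

/-- `w` is a highest weight vector of weight `μ`, where `μ i` stands for `μ(h_i)`. -/
def IsHighestWeight (w : D.VV) (μ : ℕ → ℤ) : Prop :=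
  w ≠ 0 ∧ ∀ i, 1 ≤ i → i ≤ D.s → D.eOp i w = 0 ∧ D.kOp i 1 w = qh (μ i) • w

/-- `w_1 = v_1 ⊗ v_1`. -/
def w₁ : D.VV := D.tmul (D.v 1) (D.v 1)

/-- `w_2 = v_1 ⊗ v_2 - (-1)^{|v_1|(|v_1|+|v_2|)} q^{(-1)^{|v_1|}} v_2 ⊗ v_1`. -/
def w₂ : D.VV :=
  D.tmul (D.v 1) (D.v 2) -
    ((sgn (D.par 1 * (D.par 1 + D.par 2)) : K) * qh (2 * sgn (D.par 1))) •
      (D.tmul (D.v 2) (D.v 1))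

/-- The coefficients `c_i`, `1 ≤ i ≤ N`, of `w_3` (with `c_1 = 1`), in increasing order of `i`; the
last branch is the relation between `c_{a'}` and `c_{(a+1)'}` for `1 ≤ a < s`, as
`a' = (a+1)' + 1`. -/
def c : ℕ → K
  | 0 => 0
  | 1 => 1
  | k + 2 =>
    if k + 2 ≤ D.s then
      (qh (sgn (D.par (k + 1)) + sgn (D.par (k + 2))) *
        ((D.theta (k + 1) * D.theta (k + 2) : ℤ) : K)) * c (k + 1)
    else if k + 2 = D.s + 1 then
      if Even m then
        if D.par D.s = 0 then
          (qh (sgn (D.par D.s) + sgn (D.par (D.s - 1))) *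
            ((D.theta (D.s - 1) * D.theta (D.s + 1) : ℤ) : K)) * c k
        else -(qh (4 * sgn (D.par D.s)) * c (k + 1))
      else
        (qh (sgn (D.par D.s)) * ((D.theta D.s * D.theta (D.s + 1) : ℤ) : K)) * c (k + 1)
    else if k + 2 = D.s + 2 ∧ ¬ Even m then
      (qh (sgn (D.par D.s)) * ((sgn (D.par D.s + D.par (D.s + 1)) *
        D.theta D.s * D.theta (D.s + 1) : ℤ) : K)) * c (k + 1)
    else
      let a := D.bar (k + 2)
      (qh (sgn (D.par a) + sgn (D.par (a + 1))) *
        ((sgn (D.par a + D.par (a + 1)) * D.theta a * D.theta (a + 1) : ℤ) : K)) * c (k + 1)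

/-- `w_3 = ∑ c_i v_i ⊗ v_{i'}`. -/
def w₃ : D.VV := ∑ i ∈ Finset.Icc 1 (m + n), D.c i • (D.tmul (D.v i) (D.v (D.bar i)))

/-- `v_i ⊗ v_{i'} + σ (-1)^{|v_1|+|v_i|} q^{-σ (-1)^{|v_1|}} q^{r (ε_i, ε_i)} v_{i'} ⊗ v_i`,
for `σ = ±1` and `r = ±1`. -/
def brace (σ : ℤˣ) (r : ℤ) (i : ℕ) : D.VV :=
  D.tmul (D.v i) (D.v (D.bar i)) +
    (((σ * sgn (D.par 1 + D.par i) : ℤ) : K) * qh (-2 * σ * sgn (D.par 1)) *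
      qh (2 * r * D.eps i i)) • (D.tmul (D.v (D.bar i)) (D.v i))

/-- `{…}_i - (-1)^{|v_i|+|v_k|} q^{-(ε_i,ε_i)/2} q^{-(ε_k,ε_k)/2} θ_i θ_k {…}_k`. -/
def uZero (σ : ℤˣ) (i k : ℕ) : D.VV :=
  D.brace σ (-1) i -
    (((sgn (D.par i + D.par k) * D.theta i * D.theta k : ℤ) : K) *
      qh (-D.eps i i) * qh (-D.eps k k)) • D.brace σ 1 k

/-- The vectors `u^σ_{ij}` for `1 ≤ i ≤ j ≤ N`, `(i,j) ≠ (s+1,s+1)` if `N` is odd; here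
`σ = 1` gives `u^+` and `σ = -1` gives `u^-`. -/
def u (σ : ℤˣ) (i j : ℕ) : D.VV :=
  if j ≠ D.bar i then
    D.tmul (D.v i) (D.v j) +
      (((σ * sgn (D.par 1) * sgn (D.par i * D.par j) : ℤ) : K) * qh (-2 * σ * sgn (D.par 1)) *
        qh (-2 * D.eps i j)) • (D.tmul (D.v j) (D.v i))
  else if i = D.s ∧ Even m then
    if D.par D.s = 0 then D.uZero σ (D.s - 1) (D.bar D.s) else D.brace σ (-1) D.s
  else D.uZero σ i (i + 1)

/-- The pairs `(i,j)` for which `u^σ_{ij}` is among the spanning vectors of `W^σ`: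
* `i < j`, where for `m` even and `v_s` odd the pair `(s,s')` is included in `W^+` only if
  `|v_s| = |v_1|` and in `W^-` only if `|v_s| ≠ |v_1|`;
* `i = j`, not the middle index for odd `N`, where `|v_i| = |v_1|` for `W^+` and `|v_i| ≠ |v_1|`
  for `W^-`. -/
def Admissible (σ : ℤˣ) (i j : ℕ) : Prop :=
  1 ≤ i ∧ j ≤ m + n ∧
    ((i < j ∧ (Even m → D.par D.s = 1 → i = D.s → j = D.bar D.s →
        (σ = 1 ↔ D.par D.s = D.par 1))) ∨
     (i = j ∧ i ≠ D.bar i ∧ (σ = 1 ↔ D.par i = D.par 1)))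

/-- The subspace `W^+` (for `σ = 1`) or `W^-` (for `σ = -1`) of `V ⊗ V`. -/
def W (σ : ℤˣ) : Submodule K D.VV :=
  Submodule.span K {x | ∃ i j, D.Admissible σ i j ∧ x = D.u σ i j}

end Data

end Osp

end

noncomputable section

/-! ### Powers of q^{1/2} and signs -/

namespace Osp

/-! With α = τq^{-τ} and τ = σ(-1)^{|v_1|}, the two spaces `W σ` belong to one family `Wa α`, taken
at α = q⁻¹ and α = -q, the two roots of α² + (q - q⁻¹)α = 1 (`W_eq`). The conditions on the indices
of the spanning vectors are absorbed by the factor `fac`, which vanishes exactly at the excluded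
ones. A raising operator sends each spanning vector to a multiple of a spanning vector
(`Node.nodeE_mem`, `Long.longE_mem`). The map `psi`, v_j ⊗ v_k ↦ ± v_{k'} ⊗ v_{j'}, exchanges
raising and lowering operators up to nonzero scalars and preserves `Wa α`, so the lowering operators
need no computation of their own on W.

Call a vector singular if all raising operators kill it. Its coordinates at v_l ⊗ v_{l'} obey a
first-order recursion which the coefficients of w_3 also solve, so its weight zero part is a
multiple of w_3 (`Singular.pi0_eq`). A vector in both spaces has only coordinates of weight zero,
because two different values of α relate the others; applying the same to its images shows that it
is singular, hence a multiple of w_3. The outermost coordinates show that w_3 is not in `Wa (-q)`,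
so the sum is direct (`disjoint_Wa`).

The functional φ with φ(v_j ⊗ v_{j'}) = (-1)^{|v_j|} c_j kills both spaces, and these together with
v_1 ⊗ v_{1'} span everything; hence ker φ = W^+ ⊕ W^- (`ker_phi`), and membership in this sum is a
value of φ. The dichotomy between n ≠ m and n = m is the value at w_3: a telescoping sum gives (q -
q⁻¹)φ(w_3) = q^{-(-1)^{|v_1|}}(q^{m-n} - 1)(1 + q^{m-n-2}) (`phi_w₃_eq`), which vanishes only for n
= m. If n ≠ m, then w_3 spans a complement of ker φ. If n = m, then w_3 is in ker φ, in fact in `Wa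
(q⁻¹)`; a complement of ker φ would contain a singular vector outside ker φ, but φ of a singular
vector is a multiple of φ(w_3) = 0.

Outside `Exceptional`, all of W is reached from its lowest weight vector by raising, through
descending induction on the sum of the two indices (`IsRaisingStable.Wa_le`); `psi` turns this into
generation by the highest weight vector. A nonzero subrepresentation of W contains a singular
vector, which is a combination of the highest weight vector and w_3. Since φ vanishes on W, the w_3
term drops out for n ≠ m, and irreducibility follows. -/

theorem qh_ne_zero (k : ℤ) : qh k ≠ 0 := zpow_ne_zero _ RatFunc.X_ne_zero

theorem qh_zero : qh 0 = 1 := zpow_zero _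

theorem qh_add (a b : ℤ) : qh (a + b) = qh a * qh b := zpow_add₀ RatFunc.X_ne_zero _ _

theorem qh_neg (a : ℤ) : qh (-a) = (qh a)⁻¹ := zpow_neg _ _

theorem qh_eq_one_iff (k : ℤ) : qh k = 1 ↔ k = 0 := by
  have key : ∀ n : ℕ, qh n = 1 → n = 0 := by
    intro n h
    rw [qh, zpow_natCast, ← RatFunc.algebraMap_X, ← map_pow,
      ← map_one (algebraMap (Polynomial ℂ) (RatFunc ℂ))] at h
    have h2 := RatFunc.algebraMap_injective ℂ h
    have := congrArg Polynomial.natDegree h2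
    simpa using this
  constructor
  · intro h
    obtain ⟨n, rfl | rfl⟩ := k.eq_nat_or_neg
    · simpa using key n h
    · rw [qh_neg, inv_eq_one] at h
      simpa using key n h
  · rintro rfl; exact qh_zero

theorem qh_ne_neg_one (k : ℤ) : qh k ≠ -1 := by
  intro h
  have h2 : qh (k + k) = 1 := by rw [qh_add, h]; ring
  rw [qh_eq_one_iff] at h2
  have : k = 0 := by omega
  subst this
  rw [qh_zero] at h
  norm_num at h

theorem qh_injective : Function.Injective qh := by
  intro a b h
  have : qh (a - b) = 1 := by
    rw [sub_eq_add_neg, qh_add, qh_neg, h, mul_inv_cancel₀ (qh_ne_zero _)]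
  rw [qh_eq_one_iff] at this
  omega

/-- As q^{1/2} is transcendental, no power of it equals -1. Most coefficients that have to be
nonzero below are sums of two such powers. -/
theorem qh_add_qh_ne_zero (a b : ℤ) : qh a + qh b ≠ 0 := by
  intro h
  apply qh_ne_neg_one (a - b)
  rw [sub_eq_add_neg, qh_add, qh_neg, eq_neg_of_add_eq_zero_left h, neg_mul,
    mul_inv_cancel₀ (qh_ne_zero _)]

theorem sgn_add (x y : ZMod 2) : sgn (x + y) = sgn x * sgn y := by
  revert x y; decide

theorem sgn_mul_self (x : ZMod 2) : sgn x * sgn x = 1 := by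
  revert x; decide

theorem sgn_cases (x : ZMod 2) : (x = 0 ∧ sgn x = 1) ∨ (x = 1 ∧ sgn x = -1) := by
  revert x; decide

/-! ### The basis v_j ⊗ v_k and the generators on it -/

namespace Data

variable {m n : ℕ} (D : Data m n)

/-- The basis vector `v_j ⊗ v_k` of `V ⊗ V`. -/
def T (j k : ℕ) : D.VV := D.tmul (D.v j) (D.v k)

theorem tmul_smul (c : K) (x y : D.V) : D.tmul x (c • y) = c • D.tmul x y := by
  simp [tmul, TensorProduct.tmul_smul]

theorem smul_tmul (c : K) (x y : D.V) : D.tmul (c • x) y = c • D.tmul x y := by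
  rw [tmul, tmul, ← map_smul, TensorProduct.smul_tmul']

theorem tmul_zero (x : D.V) : D.tmul x 0 = 0 := by simp [tmul]

theorem zero_tmul (x : D.V) : D.tmul 0 x = 0 := by simp [tmul]

theorem tmul_sub (x y z : D.V) : D.tmul x (y - z) = D.tmul x y - D.tmul x z := by
  simp [tmul, TensorProduct.tmul_sub]

theorem sub_tmul (x y z : D.V) : D.tmul (x - y) z = D.tmul x z - D.tmul y z := by
  simp [tmul, TensorProduct.sub_tmul]

/-- The basis `v_j ⊗ v_k` of `V ⊗ V`, indexed from `0`. -/
def basisVV : Module.Basis (Fin (m + n) × Fin (m + n)) K D.VV :=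
  ((Pi.basisFun K (Fin (m + n))).tensorProduct (Pi.basisFun K (Fin (m + n)))).map D.equivTensor

theorem v_succ (i : Fin (m + n)) : D.v (i + 1) = Pi.basisFun K (Fin (m + n)) i := by
  ext j
  simp only [v, Pi.basisFun_apply, Pi.single_apply, add_left_inj]
  simp [Fin.ext_iff]

theorem basisVV_apply (p : Fin (m + n) × Fin (m + n)) :
    D.basisVV p = D.T (p.1 + 1) (p.2 + 1) := by
  rw [basisVV, Module.Basis.map_apply, Module.Basis.tensorProduct_apply', T, tmul, v_succ, v_succ]

/-- The linear map with prescribed values on the vectors `v_j ⊗ v_k`. -/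
def constrT {M : Type*} [AddCommGroup M] [Module K M] (F : ℕ → ℕ → M) : D.VV →ₗ[K] M :=
  D.basisVV.constr K fun p => F (p.1 + 1) (p.2 + 1)

theorem constrT_T {M : Type*} [AddCommGroup M] [Module K M] (F : ℕ → ℕ → M) {j k : ℕ}
    (hj : 1 ≤ j ∧ j ≤ m + n) (hk : 1 ≤ k ∧ k ≤ m + n) : D.constrT F (D.T j k) = F j k := by
  obtain ⟨j, rfl⟩ := Nat.exists_eq_add_of_le' hj.1
  obtain ⟨k, rfl⟩ := Nat.exists_eq_add_of_le' hk.1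
  have h := D.basisVV_apply (⟨j, by omega⟩, ⟨k, by omega⟩)
  simp only at h
  rw [← h, constrT, Module.Basis.constr_basis]

theorem lin_ext {M : Type*} [AddCommGroup M] [Module K M] {f g : D.VV →ₗ[K] M}
    (h : ∀ j k, 1 ≤ j ∧ j ≤ m + n → 1 ≤ k ∧ k ≤ m + n → f (D.T j k) = g (D.T j k)) : f = g := by
  apply D.basisVV.ext
  intro p
  rw [basisVV_apply]
  exact h _ _ ⟨by omega, by omega⟩ ⟨by omega, by omega⟩

/-- The coordinate of a vector at `v_j ⊗ v_k`. -/
def coord (j k : ℕ) : D.VV →ₗ[K] K := D.constrT fun a b => if a = j ∧ b = k then 1 else 0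

theorem coord_T (j k : ℕ) {a b : ℕ} (ha : 1 ≤ a ∧ a ≤ m + n) (hb : 1 ≤ b ∧ b ≤ m + n) :
    D.coord j k (D.T a b) = if a = j ∧ b = k then 1 else 0 :=
  D.constrT_T _ ha hb

theorem sum_coord (x : D.VV) :
    ∑ p : Fin (m + n) × Fin (m + n), D.coord (p.1 + 1) (p.2 + 1) x • D.T (p.1 + 1) (p.2 + 1)
      = x := by
  have : (∑ p : Fin (m + n) × Fin (m + n),
      (D.coord (p.1 + 1) (p.2 + 1)).smulRight (D.T (p.1 + 1) (p.2 + 1))) = LinearMap.id := by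
    apply D.basisVV.ext
    intro q
    simp only [LinearMap.sum_apply, LinearMap.smulRight_apply, basisVV_apply, LinearMap.id_apply]
    rw [Finset.sum_eq_single q]
    · rw [coord_T _ _ _ ⟨by omega, by omega⟩ ⟨by omega, by omega⟩]; simp
    · intro p _ hp
      rw [coord_T _ _ _ ⟨by omega, by omega⟩ ⟨by omega, by omega⟩, if_neg, zero_smul]
      intro h
      apply hp
      exact Prod.ext (Fin.ext (by omega)) (Fin.ext (by omega))
    · simp
  have h2 := congrArg (fun f => f x) this
  simpa using h2

theorem ext_coord {x y : D.VV} (h : ∀ j k, 1 ≤ j ∧ j ≤ m + n → 1 ≤ k ∧ k ≤ m + n →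
    D.coord j k x = D.coord j k y) : x = y := by
  rw [← D.sum_coord x, ← D.sum_coord y]
  refine Finset.sum_congr rfl fun p _ => ?_
  rw [h _ _ ⟨by omega, by omega⟩ ⟨by omega, by omega⟩]

theorem span_T_eq_top {p : Submodule K D.VV} (h : ∀ j k, 1 ≤ j ∧ j ≤ m + n →
    1 ≤ k ∧ k ≤ m + n → D.T j k ∈ p) : p = ⊤ := by
  rw [eq_top_iff]
  intro x _
  rw [← D.sum_coord x]
  exact Submodule.sum_mem _ fun q _ =>
    p.smul_mem _ (h _ _ ⟨by omega, by omega⟩ ⟨by omega, by omega⟩)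

theorem toLin_E (a : ℕ) {b : ℕ} (hb : 1 ≤ b ∧ b ≤ m + n) (k : ℕ) :
    Matrix.toLin' (D.E a b) (D.v k) = if k = b then D.v a else 0 := by
  ext i
  obtain ⟨b, rfl⟩ := Nat.exists_eq_add_of_le' hb.1
  simp only [Matrix.toLin'_apply, Matrix.mulVec, dotProduct, E, v, Matrix.of_apply]
  rw [Finset.sum_eq_single (⟨b, by omega⟩ : Fin (m + n))]
  · by_cases h : k = b + 1 <;> by_cases h' : (i : ℕ) + 1 = a <;> simp [h, h', v, eq_comm]
  · intro j _ hj
    rw [if_neg, zero_mul]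
    rintro ⟨-, h⟩
    exact hj (Fin.ext (by simpa using h))
  · simp

theorem toLin_diagonal (d : ℕ → K) (k : ℕ) :
    Matrix.toLin' (Matrix.diagonal fun a : Fin (m + n) => d ((a : ℕ) + 1)) (D.v k) =
      d k • D.v k := by
  ext i
  simp only [Matrix.toLin'_apply, Matrix.mulVec_diagonal, v, Pi.smul_apply, smul_eq_mul]
  split_ifs with h
  · rw [h]
  · simp

theorem toLin_kMat (i : ℕ) (c : ℤ) (k : ℕ) :
    Matrix.toLin' (D.kMat i c) (D.v k) = qh (c * D.h i k) • D.v k :=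
  D.toLin_diagonal (fun a => qh (c * D.h i a)) k

theorem superTensor_T (p : ZMod 2) (x y : D.Mat) (j k : ℕ) :
    D.superTensor p x y (D.T j k) = (sgn (p * D.par j) : K) •
      D.tmul (Matrix.toLin' x (D.v j)) (Matrix.toLin' y (D.v k)) := by
  rw [T, superTensor_tmul, Matrix.toLin'_mul, LinearMap.comp_apply, signMat,
    D.toLin_diagonal (fun a => (sgn (p * D.par a) : K)), map_smul, smul_tmul]

theorem kOp_T (i : ℕ) (c : ℤ) (j k : ℕ) :
    D.kOp i c (D.T j k) = qh (c * (D.h i j + D.h i k)) • D.T j k := by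
  rw [kOp, superTensor_T, toLin_kMat, toLin_kMat, smul_tmul, tmul_smul, smul_smul, smul_smul,
    mul_add, qh_add, zero_mul, T]
  simp [sgn]

theorem eOp_T (i j k : ℕ) :
    D.eOp i (D.T j k) =
      ((sgn (D.genPar i * D.par j) : K) * qh (D.h i j)) •
        D.tmul (D.v j) (Matrix.toLin' (D.eMat i) (D.v k)) +
      qh (-D.h i k) • D.tmul (Matrix.toLin' (D.eMat i) (D.v j)) (D.v k) := by
  rw [eOp, LinearMap.add_apply, superTensor_T, superTensor_T, toLin_kMat, toLin_kMat, smul_tmul,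
    tmul_smul, smul_smul, zero_mul, one_mul, neg_one_mul]
  simp [sgn]

theorem fOp_T (i j k : ℕ) :
    D.fOp i (D.T j k) =
      ((sgn (D.genPar i * D.par j) : K) * qh (D.h i j)) •
        D.tmul (D.v j) (Matrix.toLin' (D.fMat i) (D.v k)) +
      qh (-D.h i k) • D.tmul (Matrix.toLin' (D.fMat i) (D.v j)) (D.v k) := by
  rw [fOp, LinearMap.add_apply, superTensor_T, superTensor_T, toLin_kMat, toLin_kMat, smul_tmul,
    tmul_smul, smul_smul, zero_mul, one_mul, neg_one_mul]
  simp [sgn]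

end Data

/-! ### The generators as operators attached to simple roots -/

namespace Data

variable {m n : ℕ} (D : Data m n)

/-- A pair `(a, b)` such that `X_{ab}` is one of the raising operators on `V`. -/
def Node (a b : ℕ) : Prop :=
  1 ≤ a ∧ ((b = a + 1 ∧ 2 * a + 1 ≤ m + n) ∨ (b = a + 2 ∧ 2 * a + 2 = m + n ∧ D.par (a + 1) = 0))

/-- The condition that the last raising operator on `V` is `E_{s,s'}`. -/
def Long (a : ℕ) : Prop := 2 * a = m + n ∧ D.par a = 1

/-- The diagonal entries of `(-1)^{|v_a|} X_{aa} - (-1)^{|v_b|} X_{bb}`. -/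
def nodeH (a b k : ℕ) : ℤ := sgn (D.par a) * D.xdiag a k - sgn (D.par b) * D.xdiag b k

/-- The coefficient of `X_{ab}` at `- E_{b'a'}`. -/
def kap (a b : ℕ) : K := ((sgn (D.par a * (D.par a + D.par b)) * D.theta a * D.theta b : ℤ) : K)

/-- The raising operator of the node `(a, b)` on `V ⊗ V`. -/
def nodeE (a b : ℕ) : Module.End K D.VV := D.constrT fun j k =>
  ((sgn ((D.par a + D.par b) * D.par j) : K) * qh (D.nodeH a b j)) •
    ((if k = b then D.T j a else 0) -
      D.kap a b • (if k = D.bar a then D.T j (D.bar b) else 0)) +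
  qh (-D.nodeH a b k) • ((if j = b then D.T a k else 0) -
      D.kap a b • (if j = D.bar a then D.T (D.bar b) k else 0))

/-- The lowering operator of the node `(a, b)` on `V ⊗ V`. -/
def nodeF (a b : ℕ) : Module.End K D.VV := D.constrT fun j k =>
  ((sgn ((D.par a + D.par b) * D.par j) : K) * qh (D.nodeH a b j)) •
    ((sgn (D.par a) : K) • ((if k = a then D.T j b else 0) -
      D.kap b a • (if k = D.bar b then D.T j (D.bar a) else 0))) +
  qh (-D.nodeH a b k) • ((sgn (D.par a) : K) • ((if j = a then D.T b k else 0) -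
      D.kap b a • (if j = D.bar b then D.T (D.bar a) k else 0)))

/-- The raising operator of the last node on `V ⊗ V`, for even `m` and odd `v_s`. -/
def longE (a : ℕ) : Module.End K D.VV := D.constrT fun j k =>
  qh (-2 * D.xdiag a j) • (if k = D.bar a then D.T j a else 0) +
  qh (2 * D.xdiag a k) • (if j = D.bar a then D.T a k else 0)

/-- The lowering operator of the last node on `V ⊗ V`, for even `m` and odd `v_s`. -/
def longF (a : ℕ) : Module.End K D.VV := D.constrT fun j k =>
  qh (-2 * D.xdiag a j) • (-(qh 2 + qh (-2)) • (if k = a then D.T j (D.bar a) else 0)) +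
  qh (2 * D.xdiag a k) • (-(qh 2 + qh (-2)) • (if j = a then D.T (D.bar a) k else 0))

/-- The operators indexed by `i` are those of the node `(a, b)`. -/
def IsNode (i a b : ℕ) : Prop :=
  D.genPar i = D.par a + D.par b ∧ D.h i = D.nodeH a b ∧ D.eMat i = D.X a b ∧
    D.fMat i = (sgn (D.par a) : K) • D.X b a

/-- The operators indexed by `i` are those of the long last node. -/
def IsLong (i a : ℕ) : Prop :=
  D.genPar i = 0 ∧ D.h i = (fun k => -2 * D.xdiag a k) ∧ D.eMat i = D.E a (a + 1) ∧
    D.fMat i = -(qh 2 + qh (-2)) • D.E (a + 1) a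

variable {D}

theorem Node.bounds {a b : ℕ} (h : D.Node a b) : 1 ≤ a ∧ a < b ∧ a + b ≤ m + n := by
  rcases h with ⟨h1, h | h⟩ <;> omega

/-- The other odd indices are paired by i ↦ i', so an odd middle index would make n odd. -/
theorem par_middle (hn : Even n) {a : ℕ} (ha : 2 * a = m + n + 1) : D.par a = 0 := by
  by_contra h0
  have h1 : D.par a = 1 := by
    generalize D.par a = x at *
    revert x; decide
  have hc := D.card_odd
  have hinv : Even (((Finset.Icc 1 (m + n)).filter (fun i => D.par i = 1)).erase a).card := by
    rw [← Nat.not_odd_iff_even]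
    intro hodd
    have hz := Finset.sum_involution
      (s := ((Finset.Icc 1 (m + n)).filter (fun i => D.par i = 1)).erase a)
      (f := fun _ => (1 : ZMod 2)) (fun i _ => m + n + 1 - i) (by intros; decide)
      (by intro i hi _; simp only [Finset.mem_erase] at hi; omega)
      (by
        intro i hi
        simp only [Finset.mem_erase, Finset.mem_filter, Finset.mem_Icc] at hi ⊢
        refine ⟨by omega, by omega, ?_⟩
        rw [D.par_symm i (by omega) (by omega)]; exact hi.2.2)
      (by
        intro i hi
        simp only [Finset.mem_erase, Finset.mem_filter, Finset.mem_Icc] at hi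
        omega)
    rw [Finset.sum_const, nsmul_eq_mul, mul_one, ZMod.natCast_eq_zero_iff_even] at hz
    exact (Nat.not_even_iff_odd.2 hodd) hz
  have hmem : a ∈ (Finset.Icc 1 (m + n)).filter (fun i => D.par i = 1) := by
    simp only [Finset.mem_filter, Finset.mem_Icc]; exact ⟨by omega, h1⟩
  rw [Finset.card_erase_of_mem hmem, hc] at hinv
  have hpos : 0 < n := by
    rw [← hc]; exact Finset.card_pos.2 ⟨a, hmem⟩
  rw [Nat.even_sub (by omega)] at hinv
  simp [hn] at hinv

/-- The index i carries the node (i, i + 1), except that for m even and v_s even the index s carries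
(s - 1, s + 1). In that case a = s - 1, which is the source of b = a + 2. -/
theorem exists_isNode (hn : Even n) {a b : ℕ} (h : D.Node a b) :
    ∃ i, 1 ≤ i ∧ i ≤ D.s ∧ D.IsNode i a b := by
  rw [Nat.even_iff] at hn
  rcases h with ⟨h1, ⟨rfl, h2⟩ | ⟨rfl, h2, h3⟩⟩
  · refine ⟨a, h1, by simp only [s]; omega, ?_⟩
    have hc : ¬ (a = D.s ∧ Even m) := by
      rw [Nat.even_iff]; simp only [s]; omega
    refine ⟨by rw [genPar, if_neg hc], ?_, by rw [eMat, if_neg hc], by rw [fMat, if_neg hc]⟩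
    ext k; rw [h, if_neg hc, nodeH]
  · have hs : D.s = a + 1 := by simp only [s]; omega
    have hc : D.s = D.s ∧ Even m := ⟨rfl, by rw [Nat.even_iff]; omega⟩
    have hp : D.par D.s = 0 := by rw [hs, h3]
    refine ⟨D.s, by omega, le_rfl, ?_, ?_, ?_, ?_⟩
    · rw [genPar, if_pos hc, if_pos hp]; simp [hs]
    · ext k; rw [Data.h, if_pos hc, if_pos hp, nodeH]; simp [hs]
    · rw [eMat, if_pos hc, if_pos hp]; simp [hs]
    · rw [fMat, if_pos hc, if_pos hp]; simp [hs]

theorem exists_isLong (hn : Even n) (hN : 2 < m + n) {a : ℕ} (h : D.Long a) :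
    ∃ i, 1 ≤ i ∧ i ≤ D.s ∧ D.IsLong i a := by
  rw [Nat.even_iff] at hn
  obtain ⟨h1, h2⟩ := h
  have hs : D.s = a := by simp only [s]; omega
  have hc : D.s = D.s ∧ Even m := ⟨rfl, by rw [Nat.even_iff]; omega⟩
  have hp : ¬ D.par D.s = 0 := by rw [hs, h2]; decide
  refine ⟨D.s, by omega, le_rfl, ?_, ?_, ?_, ?_⟩
  · rw [genPar, if_pos hc, if_neg hp]
  · ext k; rw [Data.h, if_pos hc, if_neg hp, hs]
  · rw [eMat, if_pos hc, if_neg hp, hs]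
  · rw [fMat, if_pos hc, if_neg hp, hs, smul_smul]; congr 1; ring

theorem isNode_or_isLong (hn : Even n) (hN : 2 < m + n) {i : ℕ} (h1 : 1 ≤ i) (h2 : i ≤ D.s) :
    (∃ a b, D.Node a b ∧ D.IsNode i a b) ∨ (∃ a, D.Long a ∧ D.IsLong i a) := by
  rw [Nat.even_iff] at hn
  by_cases hc : i = D.s ∧ Even m
  · have hm := hc.2
    rw [Nat.even_iff] at hm
    rcases sgn_cases (D.par D.s) with ⟨hp, -⟩ | ⟨hp, -⟩
    · left
      refine ⟨D.s - 1, D.s + 1, ⟨by simp only [s]; omega, .inr ⟨by simp only [s]; omega,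
        by simp only [s]; omega, ?_⟩⟩, ?_, ?_, ?_, ?_⟩
      · rw [← hp]; congr 1; simp only [s]; omega
      · rw [genPar, if_pos hc, if_pos hp]
      · ext k; rw [Data.h, if_pos hc, if_pos hp, nodeH]
      · rw [eMat, if_pos hc, if_pos hp]
      · rw [fMat, if_pos hc, if_pos hp]
    · right
      have hp' : ¬ D.par D.s = 0 := by rw [hp]; decide
      refine ⟨D.s, ⟨by simp only [s]; omega, hp⟩, ?_, ?_, ?_, ?_⟩
      · rw [genPar, if_pos hc, if_neg hp']
      · ext k; rw [Data.h, if_pos hc, if_neg hp']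
      · rw [eMat, if_pos hc, if_neg hp']
      · rw [fMat, if_pos hc, if_neg hp', smul_smul]; congr 1; ring
  · left
    refine ⟨i, i + 1, ⟨h1, .inl ⟨rfl, ?_⟩⟩, by rw [genPar, if_neg hc], ?_, by rw [eMat, if_neg hc],
      by rw [fMat, if_neg hc]⟩
    · rw [Nat.even_iff] at hc; simp only [s] at hc h2; omega
    · ext k; rw [Data.h, if_neg hc, nodeH]

theorem toLin_X {a b : ℕ} (ha : 1 ≤ a ∧ a ≤ m + n) (hb : 1 ≤ b ∧ b ≤ m + n) (k : ℕ) :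
    Matrix.toLin' (D.X a b) (D.v k) = (if k = b then D.v a else 0) -
      D.kap a b • (if k = D.bar a then D.v (D.bar b) else 0) := by
  rw [X, map_sub, map_smul, LinearMap.sub_apply, LinearMap.smul_apply, toLin_E _ _ hb,
    toLin_E _ _ (by simp only [bar]; omega), kap]

theorem eOp_eq_nodeE {i a b : ℕ} (h : D.Node a b) (hi : D.IsNode i a b) :
    D.eOp i = D.nodeE a b := by
  have hb := h.bounds
  apply D.lin_ext
  intro j k hj hk
  rw [eOp_T, nodeE, constrT_T _ _ hj hk, hi.1, hi.2.1, hi.2.2.1,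
    toLin_X ⟨by omega, by omega⟩ ⟨by omega, by omega⟩,
    toLin_X ⟨by omega, by omega⟩ ⟨by omega, by omega⟩,
    tmul_sub, sub_tmul, tmul_smul, smul_tmul]
  congr 4 <;> (split_ifs <;> simp [tmul_zero, zero_tmul, T])

theorem fOp_eq_nodeF {i a b : ℕ} (h : D.Node a b) (hi : D.IsNode i a b) :
    D.fOp i = D.nodeF a b := by
  have hb := h.bounds
  apply D.lin_ext
  intro j k hj hk
  rw [fOp_T, nodeF, constrT_T _ _ hj hk, hi.1, hi.2.1, hi.2.2.2, map_smul,
    LinearMap.smul_apply, LinearMap.smul_apply,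
    tmul_smul, smul_tmul,
    toLin_X ⟨by omega, by omega⟩ ⟨by omega, by omega⟩,
    toLin_X ⟨by omega, by omega⟩ ⟨by omega, by omega⟩,
    tmul_sub, sub_tmul, tmul_smul, smul_tmul]
  congr 5 <;> (split_ifs <;> simp [tmul_zero, zero_tmul, T])

theorem Long.bar {a : ℕ} (h : D.Long a) : D.bar a = a + 1 := by
  have := h.1
  simp only [Data.bar]; omega

theorem eOp_eq_longE (hN : 2 < m + n) {i a : ℕ} (h : D.Long a) (hi : D.IsLong i a) :
    D.eOp i = D.longE a := by
  have hb := h.1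
  apply D.lin_ext
  intro j k hj hk
  rw [eOp_T, longE, constrT_T _ _ hj hk, hi.1, hi.2.1, hi.2.2.1, toLin_E _ _ (by omega),
    toLin_E _ _ (by omega), h.bar]
  simp only [zero_mul, sgn, if_true, Int.cast_one, one_mul]
  congr 2
  · split_ifs <;> simp [tmul_zero, T]
  · ring_nf
  · split_ifs <;> simp [zero_tmul, T]

theorem fOp_eq_longF (hN : 2 < m + n) {i a : ℕ} (h : D.Long a) (hi : D.IsLong i a) :
    D.fOp i = D.longF a := by
  have hb := h.1
  apply D.lin_ext
  intro j k hj hk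
  rw [fOp_T, longF, constrT_T _ _ hj hk, hi.1, hi.2.1, hi.2.2.2, map_smul,
    LinearMap.smul_apply, LinearMap.smul_apply,
    tmul_smul, smul_tmul, toLin_E _ _ (by omega), toLin_E _ _ (by omega), h.bar]
  simp only [zero_mul, sgn, if_true, Int.cast_one, one_mul]
  congr 3
  · split_ifs <;> simp [tmul_zero, T]
  · ring_nf
  · split_ifs <;> simp [zero_tmul, T]

/-- The raising operators on `V ⊗ V` are those of the nodes. -/
theorem exists_eOp_iff (hn : Even n) (hN : 2 < m + n) (P : Module.End K D.VV → Prop) :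
    (∀ i, 1 ≤ i → i ≤ D.s → P (D.eOp i)) ↔
      (∀ a b, D.Node a b → P (D.nodeE a b)) ∧ ∀ a, D.Long a → P (D.longE a) := by
  constructor
  · refine fun h => ⟨fun a b hab => ?_, fun a ha => ?_⟩
    · obtain ⟨i, h1, h2, hi⟩ := exists_isNode hn hab
      rw [← eOp_eq_nodeE hab hi]; exact h i h1 h2
    · obtain ⟨i, h1, h2, hi⟩ := exists_isLong hn hN ha
      rw [← eOp_eq_longE hN ha hi]; exact h i h1 h2
  · rintro ⟨hA, hB⟩ i h1 h2
    rcases isNode_or_isLong hn hN h1 h2 with ⟨a, b, hab, hi⟩ | ⟨a, ha, hi⟩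
    · rw [eOp_eq_nodeE hab hi]; exact hA a b hab
    · rw [eOp_eq_longE hN ha hi]; exact hB a ha

end Data

/-- The coefficient of `v_j ⊗ v_j` in the vectors `u_{jj}`. -/
def fac (α : K) (p : ZMod 2) : K := 1 + α * (sgn p : K) * qh (-2 * sgn p)

/-! ### The spanning vectors of W^+ and W^- as one family in α -/

namespace Data

variable {m n : ℕ} (D : Data m n)

/-- `τ q^{-τ}` for `τ = σ (-1)^{|v_1|}`. -/
def alpha (σ : ℤˣ) : K := ((σ * sgn (D.par 1) : ℤ) : K) * qh (-2 * (σ * sgn (D.par 1)))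

/-- The vectors `u_{jk}` of nonzero weight. -/
def uPair (α : K) (j k : ℕ) : D.VV := D.T j k + (α * (sgn (D.par j * D.par k) : K)) • D.T k j

/-- The vectors `{i}_±`. -/
def br (α : K) (r : ℤ) (i : ℕ) : D.VV :=
  D.T i (D.bar i) + (α * (sgn (D.par i) : K) * qh (2 * r * D.eps i i)) • D.T (D.bar i) i

/-- The vectors `z_{ab}` of weight zero. -/
def zz (α : K) (a b : ℕ) : D.VV :=
  D.br α (-1) a - (((sgn (D.par a + D.par b) * D.theta a * D.theta b : ℤ) : K) *
      qh (-D.eps a a) * qh (-D.eps b b)) • D.br α 1 b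

/-- The spanning vectors of `W`. -/
inductive Gen (α : K) : D.VV → Prop
  | pair (j k : ℕ) (h1 : 1 ≤ j) (h2 : j < k) (h3 : k ≤ m + n) (h4 : j + k ≠ m + n + 1) :
      Gen α (D.uPair α j k)
  | diag (j : ℕ) (h1 : 1 ≤ j) (h2 : j ≤ m + n) (h3 : 2 * j ≠ m + n + 1) :
      Gen α (fac α (D.par j) • D.T j j)
  | zero (a b : ℕ) (h : D.Node a b) : Gen α (D.zz α a b)
  | long (a : ℕ) (h : D.Long a) : Gen α (fac α 1 • D.br α (-1) a)

/-- The span of the vectors `Gen α`. -/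
def Wa (α : K) : Submodule K D.VV := Submodule.span K {x | D.Gen α x}

variable {D}

theorem Gen.mem {α : K} {x : D.VV} (h : D.Gen α x) : x ∈ D.Wa α := Submodule.subset_span h

theorem alpha_cases (σ : ℤˣ) :
    ((σ * sgn (D.par 1) : ℤ) = 1 ∧ D.alpha σ = qh (-2)) ∨
      ((σ * sgn (D.par 1) : ℤ) = -1 ∧ D.alpha σ = -qh 2) := by
  have : ((σ * sgn (D.par 1) : ℤ) = 1) ∨ ((σ * sgn (D.par 1) : ℤ) = -1) := by
    rcases Int.units_eq_one_or σ with rfl | rfl <;>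
      rcases sgn_cases (D.par 1) with ⟨-, h⟩ | ⟨-, h⟩ <;> simp [h]
  rcases this with h | h
  · exact .inl ⟨h, by rw [alpha, h]; simp⟩
  · exact .inr ⟨h, by rw [alpha, h]; simp⟩

/-- For α = q⁻¹ the factor is 1 + q⁻² at an even index and 1 - q⁻¹q = 0 at an odd one; for α = -q
the roles are exchanged. -/
theorem fac_eq_zero_iff_pos (p : ZMod 2) : fac (qh (-2)) p = 0 ↔ p = 1 := by
  rcases sgn_cases p with ⟨rfl, h⟩ | ⟨rfl, h⟩ <;> rw [fac, h]
  · have := qh_add_qh_ne_zero 0 (-4)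
    rw [qh_zero] at this
    simp only [Int.cast_one, mul_one, ← qh_add]
    simpa using this
  · simp only [Int.cast_neg, Int.cast_one, mul_neg, neg_mul, mul_one, ← qh_add]
    simp [qh_zero]

theorem fac_eq_zero_iff_neg (p : ZMod 2) : fac (-qh 2) p = 0 ↔ p = 0 := by
  rcases sgn_cases p with ⟨rfl, h⟩ | ⟨rfl, h⟩ <;> rw [fac, h]
  · simp only [Int.cast_one, mul_one, neg_mul, ← qh_add]
    simp [qh_zero]
  · have := qh_add_qh_ne_zero 0 4
    rw [qh_zero] at this
    simp only [Int.cast_neg, Int.cast_one, mul_neg, neg_neg, mul_one, ← qh_add]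
    simpa using this

/-- The vanishing of the factor is precisely the failure of the parity condition in `Admissible`.
This allows `Gen` to range over all indices without any condition. -/
theorem fac_alpha_eq_zero_iff (σ : ℤˣ) (p : ZMod 2) :
    fac (D.alpha σ) p = 0 ↔ ¬ (σ = 1 ↔ p = D.par 1) := by
  rcases alpha_cases (D := D) σ with ⟨h, h'⟩ | ⟨h, h'⟩ <;> rw [h'] <;>
    simp only [fac_eq_zero_iff_pos, fac_eq_zero_iff_neg] <;> revert h <;>
    generalize D.par 1 = x <;> rcases Int.units_eq_one_or σ with rfl | rfl <;>
    revert x p <;> decide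

theorem eps_self (i : ℕ) (h : 2 * i ≠ m + n + 1) : D.eps i i = sgn (D.par i) := by
  rw [eps, if_pos rfl, if_neg]
  · simp
  · simp only [bar]; omega

theorem eps_middle (i : ℕ) (h : 2 * i = m + n + 1) : D.eps i i = 0 := by
  rw [eps, if_pos rfl, if_pos]
  · simp
  · simp only [bar]; omega

theorem u_pair (σ : ℤˣ) {j k : ℕ} (h1 : j < k) (h2 : k ≤ m + n) (h : j + k ≠ m + n + 1) :
    D.u σ j k = D.uPair (D.alpha σ) j k := by
  have h0 : D.eps j k = 0 := by
    rw [eps, if_neg (by omega), if_neg (by simp only [bar]; omega)]; simp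
  rw [u, if_pos (by simp only [bar]; omega), uPair, h0, alpha, T, T]
  congr 2
  push_cast
  simp only [qh_zero, mul_one, mul_assoc]
  ring

theorem u_diag (σ : ℤˣ) {j : ℕ} (h2 : j ≤ m + n) (h : 2 * j ≠ m + n + 1) :
    D.u σ j j = fac (D.alpha σ) (D.par j) • D.T j j := by
  rw [u, if_pos (by simp only [bar]; omega), eps_self _ h, fac, alpha, T, add_smul, one_smul]
  congr 2
  have : D.par j * D.par j = D.par j := by generalize D.par j = x; revert x; decide
  rw [this]
  push_cast
  simp only [mul_assoc]
  ring

theorem brace_eq (σ : ℤˣ) (r : ℤ) (i : ℕ) : D.brace σ r i = D.br (D.alpha σ) r i := by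
  rw [brace, br, alpha, T, T, sgn_add]
  congr 2
  push_cast
  simp only [mul_assoc]
  ring

theorem uZero_eq (σ : ℤˣ) (i k : ℕ) : D.uZero σ i k = D.zz (D.alpha σ) i k := by
  rw [uZero, zz, brace_eq, brace_eq]

theorem W_eq (hn : Even n) (hN : 2 < m + n) (σ : ℤˣ) : D.W σ = D.Wa (D.alpha σ) := by
  rw [Nat.even_iff] at hn
  apply le_antisymm
  · rw [W, Submodule.span_le]
    rintro _ ⟨i, j, ⟨h1, h2, ⟨h3, h4⟩ | ⟨rfl, h3, h4⟩⟩, rfl⟩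
    · by_cases h : j = D.bar i
      · rw [SetLike.mem_coe, u, if_neg (by simpa using h)]
        by_cases hc : i = D.s ∧ Even m
        · rw [if_pos hc]
          have hm := hc.2
          rw [Nat.even_iff] at hm
          have hi := hc.1
          simp only [s] at hi
          simp only [bar] at h
          rcases sgn_cases (D.par D.s) with ⟨hp, -⟩ | ⟨hp, -⟩
          · rw [if_pos hp, uZero_eq]
            refine (Gen.zero _ _ ?_).mem
            refine ⟨?_, .inr ⟨?_, ?_, ?_⟩⟩
            · simp only [s]; omega
            · simp only [s, bar]; omega
            · simp only [s]; omega
            · rw [← hp]; congr 1; simp only [s]; omega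
          · rw [if_neg (by rw [hp]; decide), brace_eq]
            have hl : D.Long D.s := ⟨by simp only [s]; omega, hp⟩
            have := (Gen.long (α := D.alpha σ) _ hl).mem
            -- Admissibility of (s, s') is what makes the factor `fac` invertible here.
            rwa [Submodule.smul_mem_iff] at this
            rw [Ne, fac_alpha_eq_zero_iff, not_not]
            have := h4 hc.2 hp hc.1 (by simp only [s, bar]; omega)
            rwa [hp] at this
        · rw [if_neg hc, uZero_eq]
          refine (Gen.zero _ _ ⟨h1, .inl ⟨rfl, ?_⟩⟩).mem
          simp only [s, Nat.even_iff, bar] at hc h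
          omega
      · simp only [bar] at h
        rw [SetLike.mem_coe, u_pair σ h3 h2 (by omega)]
        exact (Gen.pair _ _ h1 h3 h2 (by omega)).mem
    · simp only [bar] at h3
      rw [SetLike.mem_coe, u_diag σ h2 (by omega)]
      exact (Gen.diag _ h1 h2 (by omega)).mem
  · rw [Wa, Submodule.span_le]
    rintro _ (⟨j, k, h1, h2, h3, h4⟩ | ⟨j, h1, h2, h3⟩ | ⟨a, b, h⟩ | ⟨a, h⟩)
    · rw [SetLike.mem_coe, ← u_pair σ h2 h3 h4]
      refine Submodule.subset_span ⟨j, k, ⟨h1, h3, .inl ⟨h2, ?_⟩⟩, rfl⟩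
      intro _ _ _ h
      simp only [s, bar] at *
      omega
    · rw [SetLike.mem_coe, ← u_diag σ h2 h3]
      by_cases h : σ = 1 ↔ D.par j = D.par 1
      · exact Submodule.subset_span ⟨j, j, ⟨h1, h2, .inr ⟨rfl, by simp only [bar]; omega, h⟩⟩, rfl⟩
      -- A square excluded from W is the zero vector in `Gen`, so it adds nothing to the span.
      · rw [u_diag σ h2 h3, (fac_alpha_eq_zero_iff σ _).2 h, zero_smul]
        exact zero_mem _
    · rcases h with ⟨h1, ⟨rfl, h2⟩ | ⟨rfl, h2, h3⟩⟩
      · refine Submodule.subset_span ⟨a, D.bar a, ⟨h1, ?_, .inl ⟨?_, ?_⟩⟩, ?_⟩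
        · simp only [bar]; omega
        · simp only [bar]; omega
        · simp only [s, bar, Nat.even_iff]; omega
        · rw [u, if_neg (by simp), if_neg (by simp only [s, Nat.even_iff]; omega), uZero_eq]
      -- The fork node (s - 1, s + 1) gives the vector attached to the pair (s, s'), since s + 1 =
      -- s'.
      · have hs : D.s = a + 1 := by simp only [s]; omega
        have hp : D.par D.s = 0 := by rw [hs, h3]
        refine Submodule.subset_span ⟨D.s, D.bar D.s, ⟨?_, ?_, .inl ⟨?_, ?_⟩⟩, ?_⟩
        · omega
        · simp only [bar]; omega
        · simp only [bar]; omega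
        · rw [hp]; intro _ h; exact absurd h (by decide)
        · rw [u, if_neg (by simp), if_pos ⟨rfl, by rw [Nat.even_iff]; omega⟩, if_pos hp, uZero_eq]
          simp only [hs, bar]
          congr 1
          omega
    · have hs : D.s = a := by have := h.1; simp only [s]; omega
      have h1 := h.1
      by_cases h' : σ = 1 ↔ (1 : ZMod 2) = D.par 1
      · refine Submodule.smul_mem _ _ ?_
        rw [← brace_eq]
        refine Submodule.subset_span ⟨a, D.bar a, ⟨?_, ?_, .inl ⟨?_, ?_⟩⟩, ?_⟩
        · omega
        · simp only [bar]; omega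
        · simp only [bar]; omega
        · intro _ _ _ _; rw [hs, h.2]; exact h'
        · rw [u, if_neg (by simp), if_pos ⟨hs.symm, by rw [Nat.even_iff]; omega⟩, hs, if_neg]
          rw [h.2]; decide
      · rw [(fac_alpha_eq_zero_iff σ _).2 h', zero_smul]
        exact zero_mem _

end Data

theorem sgn_zero : sgn 0 = 1 := rfl

theorem sgn_one : sgn 1 = -1 := rfl

theorem zmod_one_add_one : (1 + 1 : ZMod 2) = 0 := rfl

theorem X_ne_zero : (RatFunc.X : K) ≠ 0 := RatFunc.X_ne_zero

/-- The shortest path from `ℕ` to `K`; the tactics `module` and `match_scalars` need it. -/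
instance natAlgebraK : Algebra ℕ K := Semiring.toNatAlgebra

/-- The shortest path from `ℤ` to `K`; the tactics `module` and `match_scalars` need it. -/
instance intAlgebraK : Algebra ℤ K := Ring.toIntAlgebra K

/-! ### Raising operators on the spanning vectors -/

namespace Data

variable {m n : ℕ} {D : Data m n}

theorem zmod_two_cases (x : ZMod 2) : x = 0 ∨ x = 1 := by revert x; decide

theorem bar_bar {j : ℕ} (hj : j ≤ m + n) : D.bar (D.bar j) = j := by
  simp only [bar]; omega

theorem par_bar {j : ℕ} (hj : 1 ≤ j ∧ j ≤ m + n) : D.par (D.bar j) = D.par j :=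
  D.par_symm j hj.1 hj.2

theorem nodeH_of_ne {a b l : ℕ} (h1 : l ≠ a) (h2 : l ≠ b) (h3 : l ≠ D.bar a) (h4 : l ≠ D.bar b) :
    D.nodeH a b l = 0 := by
  simp [nodeH, xdiag, *]

theorem Node.nodeH_a {a b : ℕ} (h : D.Node a b) : D.nodeH a b a = sgn (D.par a) := by
  have := h.bounds
  have h1 : a ≠ D.bar a := by simp only [bar]; omega
  have h2 : a ≠ D.bar b := by simp only [bar]; omega
  have h3 : a ≠ b := by omega
  simp [nodeH, xdiag, *]

theorem Node.nodeH_bar_a {a b : ℕ} (h : D.Node a b) : D.nodeH a b (D.bar a) = -sgn (D.par a) := by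
  have := h.bounds
  have h1 : D.bar a ≠ a := by simp only [bar]; omega
  have h2 : D.bar a ≠ D.bar b := by simp only [bar]; omega
  have h3 : D.bar a ≠ b := by simp only [bar]; omega
  simp [nodeH, xdiag, *]

theorem Node.nodeH_b {a b : ℕ} (h : D.Node a b) : D.nodeH a b b = -D.eps b b := by
  have := h.bounds
  have h1 : b ≠ a := by omega
  have h2 : b ≠ D.bar a := by simp only [bar]; omega
  simp [nodeH, xdiag, eps, *]

theorem Node.nodeH_bar_b {a b : ℕ} (h : D.Node a b) : D.nodeH a b (D.bar b) = D.eps b b := by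
  have := h.bounds
  have h1 : D.bar b ≠ a := by simp only [bar]; omega
  have h2 : D.bar b ≠ D.bar a := by simp only [bar]; omega
  simp only [nodeH, xdiag, eps, if_neg h1, if_neg h2, if_true, eq_comm (a := b) (b := D.bar b)]
  ring

theorem nodeE_T {a b j k : ℕ} (hj : 1 ≤ j ∧ j ≤ m + n) (hk : 1 ≤ k ∧ k ≤ m + n) :
    D.nodeE a b (D.T j k) = ((sgn ((D.par a + D.par b) * D.par j) : K) * qh (D.nodeH a b j)) •
      ((if k = b then D.T j a else 0) -
        D.kap a b • (if k = D.bar a then D.T j (D.bar b) else 0)) +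
      qh (-D.nodeH a b k) • ((if j = b then D.T a k else 0) -
        D.kap a b • (if j = D.bar a then D.T (D.bar b) k else 0)) :=
  D.constrT_T _ hj hk

section NodeAction

variable {a b : ℕ}

theorem nodeE_T_eq_zero {j k : ℕ} (hj : 1 ≤ j ∧ j ≤ m + n)
    (hk : 1 ≤ k ∧ k ≤ m + n) (h1 : j ≠ b) (h2 : j ≠ D.bar a) (h3 : k ≠ b) (h4 : k ≠ D.bar a) :
    D.nodeE a b (D.T j k) = 0 := by
  rw [nodeE_T hj hk]; simp [*]

theorem Node.nodeE_T_l_b (h : D.Node a b) {l : ℕ} (hl : 1 ≤ l ∧ l ≤ m + n) (h1 : l ≠ b)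
    (h2 : l ≠ D.bar a) : D.nodeE a b (D.T l b) =
      ((sgn ((D.par a + D.par b) * D.par l) : K) * qh (D.nodeH a b l)) • D.T l a := by
  have := h.bounds
  have h3 : b ≠ D.bar a := by simp only [bar]; omega
  rw [nodeE_T hl (by omega)]; simp [*]

theorem Node.nodeE_T_b_l (h : D.Node a b) {l : ℕ} (hl : 1 ≤ l ∧ l ≤ m + n) (h1 : l ≠ b)
    (h2 : l ≠ D.bar a) : D.nodeE a b (D.T b l) = qh (-D.nodeH a b l) • D.T a l := by
  have := h.bounds
  have h3 : b ≠ D.bar a := by simp only [bar]; omega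
  rw [nodeE_T (by omega) hl]; simp [*]

theorem Node.nodeE_T_l_a' (h : D.Node a b) {l : ℕ} (hl : 1 ≤ l ∧ l ≤ m + n) (h1 : l ≠ b)
    (h2 : l ≠ D.bar a) : D.nodeE a b (D.T l (D.bar a)) =
      (-((sgn ((D.par a + D.par b) * D.par l) : K) * qh (D.nodeH a b l) * D.kap a b)) •
        D.T l (D.bar b) := by
  have := h.bounds
  have h3 : D.bar a ≠ b := by simp only [bar]; omega
  rw [nodeE_T hl (by simp only [bar]; omega)]; simp [*]; module

theorem Node.nodeE_T_a'_l (h : D.Node a b) {l : ℕ} (hl : 1 ≤ l ∧ l ≤ m + n) (h1 : l ≠ b)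
    (h2 : l ≠ D.bar a) : D.nodeE a b (D.T (D.bar a) l) =
      (-(qh (-D.nodeH a b l) * D.kap a b)) • D.T (D.bar b) l := by
  have := h.bounds
  have h3 : D.bar a ≠ b := by simp only [bar]; omega
  rw [nodeE_T (by simp only [bar]; omega) hl]; simp [*]; module

theorem Node.nodeE_T_b_b (h : D.Node a b) : D.nodeE a b (D.T b b) =
    ((sgn ((D.par a + D.par b) * D.par b) : K) * qh (-D.eps b b)) • D.T b a +
      qh (D.eps b b) • D.T a b := by
  have := h.bounds
  have h3 : b ≠ D.bar a := by simp only [bar]; omega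
  rw [nodeE_T (by omega) (by omega), h.nodeH_b]; simp [*]

theorem Node.nodeE_T_a'_a' (h : D.Node a b) : D.nodeE a b (D.T (D.bar a) (D.bar a)) =
    (-((sgn ((D.par a + D.par b) * D.par a) : K) * qh (-sgn (D.par a)) * D.kap a b)) •
        D.T (D.bar a) (D.bar b) +
      (-(qh (sgn (D.par a)) * D.kap a b)) • D.T (D.bar b) (D.bar a) := by
  have := h.bounds
  have h3 : D.bar a ≠ b := by simp only [bar]; omega
  rw [nodeE_T (by simp only [bar]; omega) (by simp only [bar]; omega), h.nodeH_bar_a,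
    par_bar (by omega)]
  simp [*]; module

theorem Node.nodeE_T_b_a' (h : D.Node a b) : D.nodeE a b (D.T b (D.bar a)) =
    (-((sgn ((D.par a + D.par b) * D.par b) : K) * qh (-D.eps b b) * D.kap a b)) •
        D.T b (D.bar b) +
      qh (sgn (D.par a)) • D.T a (D.bar a) := by
  have := h.bounds
  have h3 : D.bar a ≠ b := by simp only [bar]; omega
  rw [nodeE_T (by omega) (by simp only [bar]; omega), h.nodeH_bar_a, h.nodeH_b]
  simp [*, Ne.symm h3]; module

theorem Node.nodeE_T_a'_b (h : D.Node a b) : D.nodeE a b (D.T (D.bar a) b) =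
    ((sgn ((D.par a + D.par b) * D.par a) : K) * qh (-sgn (D.par a))) • D.T (D.bar a) a +
      (-(qh (D.eps b b) * D.kap a b)) • D.T (D.bar b) b := by
  have := h.bounds
  have h3 : D.bar a ≠ b := by simp only [bar]; omega
  rw [nodeE_T (by simp only [bar]; omega) (by omega), h.nodeH_bar_a, h.nodeH_b,
    par_bar (by omega)]
  simp [*, Ne.symm h3]; module

/-! ### The action of a node on the spanning vectors of `W` -/

variable {α : K}

/-- Since l is none of a, b, a', b', the Cartan element acts by 0 on v_l; only signs appear and α
plays no role. -/
theorem Node.nodeE_uPair_l_b (h : D.Node a b) {l : ℕ} (hl : 1 ≤ l ∧ l ≤ m + n) (h1 : l ≠ a)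
    (h2 : l ≠ b) (h3 : l ≠ D.bar a) (h4 : l ≠ D.bar b) :
    D.nodeE a b (D.uPair α l b) =
      (sgn ((D.par a + D.par b) * D.par l) : K) • D.uPair α l a := by
  rw [uPair, map_add, map_smul, h.nodeE_T_l_b hl h2 h3, h.nodeE_T_b_l hl h2 h3,
    nodeH_of_ne h1 h2 h3 h4, uPair, neg_zero, qh_zero]
  match_scalars
  · simp
  · rcases zmod_two_cases (D.par a) with ha | ha <;>
      rcases zmod_two_cases (D.par b) with hb | hb <;>
      rcases zmod_two_cases (D.par l) with hl | hl <;>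
      simp [ha, hb, hl, sgn_zero, sgn_one, zmod_one_add_one, mul_comm]

theorem Node.nodeE_uPair_b_l (h : D.Node a b) {l : ℕ} (hl : 1 ≤ l ∧ l ≤ m + n) (h1 : l ≠ a)
    (h2 : l ≠ b) (h3 : l ≠ D.bar a) (h4 : l ≠ D.bar b) :
    D.nodeE a b (D.uPair α b l) = D.uPair α a l := by
  rw [uPair, map_add, map_smul, h.nodeE_T_l_b hl h2 h3, h.nodeE_T_b_l hl h2 h3,
    nodeH_of_ne h1 h2 h3 h4, uPair, neg_zero, qh_zero]
  match_scalars
  · simp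
  · rcases zmod_two_cases (D.par a) with ha | ha <;>
      rcases zmod_two_cases (D.par b) with hb | hb <;>
      rcases zmod_two_cases (D.par l) with hl | hl <;>
      simp [ha, hb, hl, sgn_zero, sgn_one, zmod_one_add_one, mul_comm]

theorem Node.nodeE_uPair_l_a' (h : D.Node a b) {l : ℕ} (hl : 1 ≤ l ∧ l ≤ m + n) (h1 : l ≠ a)
    (h2 : l ≠ b) (h3 : l ≠ D.bar a) (h4 : l ≠ D.bar b) :
    D.nodeE a b (D.uPair α l (D.bar a)) =
      (-((sgn ((D.par a + D.par b) * D.par l) : K) * D.kap a b)) • D.uPair α l (D.bar b) := by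
  have hb := h.bounds
  rw [uPair, map_add, map_smul, h.nodeE_T_l_a' hl h2 h3, h.nodeE_T_a'_l hl h2 h3,
    nodeH_of_ne h1 h2 h3 h4, uPair, neg_zero, qh_zero, par_bar (by omega), par_bar (by omega)]
  match_scalars
  · simp
  · rcases zmod_two_cases (D.par a) with ha | ha <;>
      rcases zmod_two_cases (D.par b) with hb | hb <;>
      rcases zmod_two_cases (D.par l) with hl | hl <;>
      simp [ha, hb, hl, sgn_zero, sgn_one, zmod_one_add_one, mul_comm]

theorem Node.nodeE_uPair_a'_l (h : D.Node a b) {l : ℕ} (hl : 1 ≤ l ∧ l ≤ m + n) (h1 : l ≠ a)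
    (h2 : l ≠ b) (h3 : l ≠ D.bar a) (h4 : l ≠ D.bar b) :
    D.nodeE a b (D.uPair α (D.bar a) l) = (-D.kap a b) • D.uPair α (D.bar b) l := by
  have hb := h.bounds
  rw [uPair, map_add, map_smul, h.nodeE_T_l_a' hl h2 h3, h.nodeE_T_a'_l hl h2 h3,
    nodeH_of_ne h1 h2 h3 h4, uPair, neg_zero, qh_zero, par_bar (by omega), par_bar (by omega)]
  match_scalars
  · simp
  · rcases zmod_two_cases (D.par a) with ha | ha <;>
      rcases zmod_two_cases (D.par b) with hb | hb <;>
      rcases zmod_two_cases (D.par l) with hl | hl <;>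
      simp [ha, hb, hl, sgn_zero, sgn_one, zmod_one_add_one, mul_comm]

/-- Both terms of u_{ab} go to v_a ⊗ v_a, and their coefficients add up to a multiple of `fac`. Thus
the image vanishes exactly when u_{aa} is excluded from W. -/
theorem Node.nodeE_uPair_a_b (h : D.Node a b) :
    D.nodeE a b (D.uPair α a b) =
      ((sgn ((D.par a + D.par b) * D.par a) : K) * qh (sgn (D.par a))) •
        fac α (D.par a) • D.T a a := by
  have hb := h.bounds
  have h1 : a ≠ D.bar a := by simp only [bar]; omega
  rw [uPair, map_add, map_smul, h.nodeE_T_l_b (by omega) (by omega) h1,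
    h.nodeE_T_b_l (by omega) (by omega) h1, h.nodeH_a, fac]
  match_scalars
  rcases zmod_two_cases (D.par a) with ha | ha <;> rcases zmod_two_cases (D.par b) with hb | hb <;>
    simp [ha, hb, sgn_zero, sgn_one, zmod_one_add_one, qh] <;>
    field_simp [X_ne_zero] <;> ring

theorem Node.nodeE_uPair_b'_a' (h : D.Node a b) (hb' : 2 * b ≠ m + n + 1) :
    D.nodeE a b (D.uPair α (D.bar b) (D.bar a)) =
      (-((sgn ((D.par a + D.par b) * D.par b) : K) * qh (sgn (D.par b)) * D.kap a b)) •
        fac α (D.par b) • D.T (D.bar b) (D.bar b) := by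
  have hb := h.bounds
  have h1 : D.bar b ≠ D.bar a := by simp only [bar]; omega
  have h2 : D.bar b ≠ b := by simp only [bar]; omega
  rw [uPair, map_add, map_smul, h.nodeE_T_l_a' (by simp only [bar]; omega) h2 h1,
    h.nodeE_T_a'_l (by simp only [bar]; omega) h2 h1, h.nodeH_bar_b, fac, eps_self _ hb',
    par_bar (by omega), par_bar (by omega)]
  match_scalars
  rcases zmod_two_cases (D.par a) with ha | ha <;> rcases zmod_two_cases (D.par b) with hb | hb <;>
    simp [ha, hb, sgn_zero, sgn_one, zmod_one_add_one, qh] <;> field_simp [X_ne_zero] <;> ring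

/-- This is the origin of the combination `zz`: both indices of u_{ba'} can be raised, and the two
results have weight zero. The identity holds for every α. -/
theorem Node.nodeE_uPair_b_a' (h : D.Node a b) :
    D.nodeE a b (D.uPair α b (D.bar a)) = qh (sgn (D.par a)) • D.zz α a b := by
  have hb := h.bounds
  rw [uPair, map_add, map_smul, h.nodeE_T_b_a', h.nodeE_T_a'_b, zz, br, br, par_bar (by omega),
    eps_self a (by omega), kap]
  have he : qh (2 * 1 * D.eps b b) = qh (D.eps b b) * qh (D.eps b b) := by
    rw [← qh_add]; congr 1; ring
  have hne := qh_ne_zero (D.eps b b)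
  rw [he, qh_neg (D.eps b b)]
  generalize qh (D.eps b b) = e at hne
  match_scalars <;> rcases zmod_two_cases (D.par a) with ha | ha <;>
    rcases zmod_two_cases (D.par b) with hb | hb <;>
    simp [ha, hb, sgn_zero, sgn_one, zmod_one_add_one, qh] <;>
    field_simp [X_ne_zero]

/-- The exponent r = -1 in `br` is the one for which raising the index b gives a multiple of
u_{ab'}; at the index a the exponent r = 1 plays this part (`Node.nodeE_br_a_one`). -/
theorem Node.nodeE_br_b (h : D.Node a b) (hb' : 2 * b ≠ m + n + 1) :
    D.nodeE a b (D.br α (-1) b) = qh (-sgn (D.par b)) • D.uPair α a (D.bar b) := by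
  have hb := h.bounds
  have h1 : D.bar b ≠ D.bar a := by simp only [bar]; omega
  have h2 : D.bar b ≠ b := by simp only [bar]; omega
  rw [br, map_add, map_smul, h.nodeE_T_l_b (by simp only [bar]; omega) h2 h1,
    h.nodeE_T_b_l (by simp only [bar]; omega) h2 h1, h.nodeH_bar_b, uPair, eps_self _ hb',
    par_bar (by omega)]
  match_scalars <;> rcases zmod_two_cases (D.par a) with ha | ha <;>
    rcases zmod_two_cases (D.par b) with hb | hb <;>
    simp [ha, hb, sgn_zero, sgn_one, zmod_one_add_one, qh] <;> field_simp [X_ne_zero]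

theorem Node.nodeE_br_a (h : D.Node a b) (r : ℤ) :
    D.nodeE a b (D.br α r a) =
      (-(D.kap a b * (sgn ((D.par a + D.par b) * D.par a) : K) * qh (sgn (D.par a)))) •
      (D.T a (D.bar b) + (α * (sgn (D.par a * D.par b) : K) *
        qh (2 * (r - 1) * sgn (D.par a))) • D.T (D.bar b) a) := by
  have hb := h.bounds
  have h1 : a ≠ D.bar a := by simp only [bar]; omega
  rw [br, map_add, map_smul, h.nodeE_T_l_a' (by omega) (by omega) h1,
    h.nodeE_T_a'_l (by omega) (by omega) h1, h.nodeH_a, eps_self a (by omega)]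
  have hr : qh (2 * (r - 1) * sgn (D.par a)) =
      qh (2 * r * sgn (D.par a)) * qh (-2 * sgn (D.par a)) := by rw [← qh_add]; congr 1; ring
  rw [hr]
  generalize qh (2 * r * sgn (D.par a)) = e
  match_scalars <;> rcases zmod_two_cases (D.par a) with ha | ha <;>
    rcases zmod_two_cases (D.par b) with hb | hb <;>
    simp [ha, hb, sgn_zero, sgn_one, zmod_one_add_one, qh] <;> field_simp [X_ne_zero]

theorem Node.nodeE_br_a_one (h : D.Node a b) :
    D.nodeE a b (D.br α 1 a) =
      (-(D.kap a b * (sgn ((D.par a + D.par b) * D.par a) : K) * qh (sgn (D.par a)))) •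
        D.uPair α a (D.bar b) := by
  have hb := h.bounds
  rw [h.nodeE_br_a, uPair, par_bar (by omega)]
  simp [qh_zero]

/-- The coefficient is nonzero for equal parities of v_a and v_b and zero for different ones. For an
odd root u_{ab'} must therefore be reached in another way, and this is where exceptional cases
arise. -/
theorem Node.nodeE_zz (h : D.Node a b) (hb' : 2 * b ≠ m + n + 1) :
    D.nodeE a b (D.zz α a b) =
      (-((D.theta a * D.theta b : ℤ) : K) * (qh (sgn (D.par a)) +
        (sgn (D.par a + D.par b) : K) * qh (-sgn (D.par a) - 2 * sgn (D.par b)))) •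
        D.uPair α a (D.bar b) := by
  have hb := h.bounds
  have h1 : D.bar b ≠ D.bar a := by simp only [bar]; omega
  have h2 : D.bar b ≠ b := by simp only [bar]; omega
  rw [zz, map_sub, map_smul, h.nodeE_br_a, br, map_add, map_smul,
    h.nodeE_T_l_b (by simp only [bar]; omega) h2 h1,
    h.nodeE_T_b_l (by simp only [bar]; omega) h2 h1, h.nodeH_bar_b, uPair, eps_self _ hb',
    eps_self a (by omega), par_bar (by omega), kap]
  match_scalars <;> rcases zmod_two_cases (D.par a) with ha | ha <;>
    rcases zmod_two_cases (D.par b) with hb | hb <;>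
    simp [ha, hb, sgn_zero, sgn_one, zmod_one_add_one, qh] <;> field_simp [X_ne_zero] <;> ring

/-- Here b = b', so the brace at b collapses to (1 + α) v_b ⊗ v_b. Comparing the coefficients of v_a
⊗ v_b and v_b ⊗ v_a leaves α² + (q - q⁻¹)α = 1, which is why α must be one of the two special
values. -/
theorem Node.nodeE_zz_middle (hn : Even n) (h : D.Node a b) (hb' : 2 * b = m + n + 1)
    (hα : α = qh (-2) ∨ α = -qh 2) :
    D.nodeE a b (D.zz α a b) =
      (-((D.theta a * D.theta b : ℤ) : K) * (qh (sgn (D.par a)) +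
        (sgn (D.par a) : K) * (1 + α) * qh (-sgn (D.par a)))) •
        D.uPair α a (D.bar b) := by
  have hb := h.bounds
  have h1 : D.bar b = b := by simp only [bar]; omega
  have h0 := par_middle (D := D) hn hb'
  rw [zz, map_sub, map_smul, h.nodeE_br_a, br, map_add, map_smul, h1,
    h.nodeE_T_b_b, uPair, eps_middle _ hb', eps_self a (by omega), kap, h0]
  match_scalars <;> rcases zmod_two_cases (D.par a) with ha | ha <;>
    rcases hα with rfl | rfl <;>
    simp [ha, sgn_zero, sgn_one, qh] <;> field_simp [X_ne_zero] <;> ring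

/-- At the fork, two nodes share the index a, and the operator of one acts on the vector of the
other. Proportionality to u_{ab'} again amounts to the quadratic equation for α. -/
theorem Node.nodeE_zz_bar (h : D.Node a b) (hb' : 2 * a + 2 = m + n)
    (h0 : D.par b = 0) (hα : α = qh (-2) ∨ α = -qh 2) :
    D.nodeE a b (D.zz α a (D.bar b)) =
      (-((D.theta a : ℤ) : K) * (qh (sgn (D.par a)) +
        (sgn (D.par a) : K) * α * qh (-sgn (D.par a)))) •
        D.uPair α a (D.bar b) := by
  have hb := h.bounds
  have h1 : D.bar b ≠ D.bar a := by simp only [bar]; omega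
  have h2 : D.bar b ≠ b := by
    rcases h with ⟨_, h | h⟩ <;> simp only [bar] <;> omega
  have h3 : D.theta (D.bar b) = 1 := by
    apply D.theta_even <;> try (simp only [bar]; omega)
    rw [par_bar (by omega), h0]
  have h4 : 2 * D.bar b ≠ m + n + 1 := by
    rcases h with ⟨_, h | h⟩ <;> simp only [bar] <;> omega
  rw [zz, map_sub, map_smul, h.nodeE_br_a, br, map_add, map_smul, bar_bar (by omega),
    h.nodeE_T_l_b (by simp only [bar]; omega) h2 h1,
    h.nodeE_T_b_l (by simp only [bar]; omega) h2 h1, h.nodeH_bar_b, uPair, eps_self _ h4,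
    eps_self a (by omega), par_bar (by omega), eps_self b (by simp only [bar] at h4; omega),
    kap, h0, h3, D.theta_even b (by omega) (by omega) h0]
  match_scalars <;> rcases zmod_two_cases (D.par a) with ha | ha <;>
    rcases hα with rfl | rfl <;>
    simp [ha, sgn_zero, sgn_one, qh] <;> field_simp [X_ne_zero] <;> ring

/-- The image of v_b ⊗ v_b is a multiple of u_{ab} for only one of the two values of α; for the
other the factor `fac` is zero. -/
theorem Node.nodeE_diag_b (h : D.Node a b) (hb' : 2 * b ≠ m + n + 1)
    (hα : α = qh (-2) ∨ α = -qh 2) :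
    D.nodeE a b (fac α (D.par b) • D.T b b) =
      (fac α (D.par b) * qh (sgn (D.par b))) • D.uPair α a b := by
  have hb := h.bounds
  rw [map_smul, h.nodeE_T_b_b, uPair, eps_self _ hb', fac]
  match_scalars <;> rcases zmod_two_cases (D.par a) with ha | ha <;>
    rcases zmod_two_cases (D.par b) with hb | hb <;> rcases hα with rfl | rfl <;>
    simp [ha, hb, sgn_zero, sgn_one, zmod_one_add_one, qh] <;> field_simp [X_ne_zero] <;> ring

theorem Node.nodeE_diag_a' (h : D.Node a b) (hα : α = qh (-2) ∨ α = -qh 2) :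
    D.nodeE a b (fac α (D.par a) • D.T (D.bar a) (D.bar a)) =
      (-(fac α (D.par a) * D.kap a b * qh (sgn (D.par a)))) •
        D.uPair α (D.bar b) (D.bar a) := by
  have hb := h.bounds
  rw [map_smul, h.nodeE_T_a'_a', uPair, fac, par_bar (by omega), par_bar (by omega)]
  match_scalars <;> rcases zmod_two_cases (D.par a) with ha | ha <;>
    rcases zmod_two_cases (D.par b) with hb | hb <;> rcases hα with rfl | rfl <;>
    simp [ha, hb, sgn_zero, sgn_one, zmod_one_add_one, qh] <;> field_simp [X_ne_zero] <;> ring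

end NodeAction

section LongAction

variable {a : ℕ} {α : K}

theorem longE_T {j k : ℕ} (hj : 1 ≤ j ∧ j ≤ m + n) (hk : 1 ≤ k ∧ k ≤ m + n) :
    D.longE a (D.T j k) = qh (-2 * D.xdiag a j) • (if k = D.bar a then D.T j a else 0) +
      qh (2 * D.xdiag a k) • (if j = D.bar a then D.T a k else 0) :=
  D.constrT_T _ hj hk

theorem xdiag_of_ne {l : ℕ} (h1 : l ≠ a) (h2 : l ≠ D.bar a) : D.xdiag a l = 0 := by
  simp [xdiag, h1, h2]

theorem Long.ne (h : D.Long a) : a ≠ D.bar a := by rw [h.bar]; omega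

theorem Long.xdiag_self (h : D.Long a) : D.xdiag a a = 1 := by
  simp [xdiag, h.ne]

theorem Long.xdiag_bar (h : D.Long a) : D.xdiag a (D.bar a) = -1 := by
  simp [xdiag, h.ne.symm]

theorem Long.range (h : D.Long a) (hN : 2 < m + n) :
    (1 ≤ a ∧ a ≤ m + n) ∧ 1 ≤ D.bar a ∧ D.bar a ≤ m + n := by
  have := h.1
  simp only [Data.bar]; omega

theorem Long.longE_uPair_l_a' (h : D.Long a) (hN : 2 < m + n) {l : ℕ} (hl : 1 ≤ l ∧ l ≤ m + n)
    (h1 : l ≠ a) (h2 : l ≠ D.bar a) :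
    D.longE a (D.uPair α l (D.bar a)) = D.uPair α l a := by
  have := h.range hN
  rw [uPair, map_add, map_smul, longE_T hl this.2, longE_T this.2 hl, xdiag_of_ne h1 h2,
    par_bar this.1, uPair]
  simp [h2, qh_zero]

theorem Long.longE_uPair_a'_l (h : D.Long a) (hN : 2 < m + n) {l : ℕ} (hl : 1 ≤ l ∧ l ≤ m + n)
    (h1 : l ≠ a) (h2 : l ≠ D.bar a) :
    D.longE a (D.uPair α (D.bar a) l) = D.uPair α a l := by
  have := h.range hN
  rw [uPair, map_add, map_smul, longE_T hl this.2, longE_T this.2 hl, xdiag_of_ne h1 h2,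
    par_bar this.1, uPair]
  simp [h2, qh_zero]

theorem Long.longE_T_eq_zero {j k : ℕ} (hj : 1 ≤ j ∧ j ≤ m + n)
    (hk : 1 ≤ k ∧ k ≤ m + n) (h1 : j ≠ D.bar a) (h2 : k ≠ D.bar a) :
    D.longE a (D.T j k) = 0 := by
  rw [longE_T hj hk]; simp [*]

theorem Long.longE_diag (h : D.Long a) (hN : 2 < m + n) (hα : α = qh (-2) ∨ α = -qh 2) :
    D.longE a (fac α (D.par a) • D.T (D.bar a) (D.bar a)) =
      qh (-2) • fac α 1 • D.br α (-1) a := by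
  have := h.range hN
  have h1 := h.1
  rw [map_smul, longE_T this.2 this.2, h.xdiag_bar, if_pos rfl, if_pos rfl, br, fac, fac,
    eps_self a (by omega), h.2]
  match_scalars <;> rcases hα with rfl | rfl <;>
    simp [sgn_one, qh] <;> field_simp [X_ne_zero] <;> ring

theorem Long.longE_br (h : D.Long a) (hN : 2 < m + n) (r : ℤ) :
    D.longE a (D.br α r a) = (qh (-2) - α * qh (2 - 2 * r)) • D.T a a := by
  have := h.range hN
  have h1 := h.1
  have hr : qh (2 * r * sgn 1) = qh (-2) * qh (2 - 2 * r) := by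
    rw [← qh_add]; congr 1; rw [sgn_one]; ring
  rw [br, map_add, map_smul, longE_T this.1 this.2, longE_T this.2 this.1, h.xdiag_self,
    eps_self a (by omega), h.2, hr]
  simp only [h.ne, if_false, if_true]
  match_scalars
  simp [sgn_one, qh]
  field_simp [X_ne_zero]
  ring

end LongAction

end Data

/-! ### Stability of W under the raising operators -/

namespace Data

variable {m n : ℕ} {D : Data m n} {α : K}

theorem br_eq_zero_of_ne {a b l : ℕ} (r : ℤ) (hl : 1 ≤ l ∧ l ≤ m + n) (h1 : l ≠ a) (h2 : l ≠ b)
    (h3 : l ≠ D.bar a) (h4 : l ≠ D.bar b) (hb : b ≤ m + n) (ha : a ≤ m + n) :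
    D.nodeE a b (D.br α r l) = 0 := by
  have h5 : D.bar l ≠ b := by rintro rfl; exact h4 (bar_bar hl.2).symm
  have h6 : D.bar l ≠ D.bar a := by simp only [bar]; omega
  have h7 : 1 ≤ D.bar l ∧ D.bar l ≤ m + n := by simp only [bar]; omega
  rw [br, map_add, map_smul, nodeE_T_eq_zero hl h7 h2 h3 h5 h6, nodeE_T_eq_zero h7 hl h5 h6 h2 h3]
  simp

theorem Node.uPair_a_b'_mem {a b : ℕ} (h : D.Node a b) : D.uPair α a (D.bar b) ∈ D.Wa α := by
  have hb := h.bounds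
  refine (Gen.pair _ _ hb.1 ?_ ?_ ?_).mem <;> simp only [bar]
  · rcases h with ⟨_, h | h⟩ <;> omega
  · omega
  · omega

/-- `W` is stable under the raising operators of the nodes. -/
theorem Node.nodeE_mem (hn : Even n) {a b : ℕ} (h : D.Node a b) (hα : α = qh (-2) ∨ α = -qh 2)
    {x : D.VV} (hx : x ∈ D.Wa α) : D.nodeE a b x ∈ D.Wa α := by
  have hb := h.bounds
  have hadj : b = a + 1 ∨ (b = a + 2 ∧ 2 * a + 2 = m + n ∧ D.par (a + 1) = 0) := by
    rcases h with ⟨_, h | h⟩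
    · exact .inl h.1
    · exact .inr h
  have ha' : D.bar a = m + n + 1 - a := rfl
  have hb' : D.bar b = m + n + 1 - b := rfl
  suffices D.Wa α ≤ (D.Wa α).comap (D.nodeE a b) from this hx
  refine Submodule.span_le.2 ?_
  rintro _ (⟨j, k, h1, h2, h3, h4⟩ | ⟨j, h1, h2, h3⟩ | ⟨c, d, h'⟩ | ⟨c, h'⟩)
  · simp only [Submodule.comap_coe, Set.mem_preimage, SetLike.mem_coe]
    by_cases hkb : k = b
    · subst hkb
      by_cases hja : j = a
      · subst hja
        rw [h.nodeE_uPair_a_b]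
        exact Submodule.smul_mem _ _ (Gen.diag _ h1 (by omega) (by omega)).mem
      · rw [h.nodeE_uPair_l_b (by omega) hja (by omega) (by omega) (by omega)]
        exact Submodule.smul_mem _ _ (Gen.pair _ _ h1 (by omega) (by omega) (by omega)).mem
    by_cases hka : k = D.bar a
    · subst hka
      by_cases hjb : j = b
      · subst hjb
        rw [h.nodeE_uPair_b_a']
        exact Submodule.smul_mem _ _ (Gen.zero _ _ h).mem
      by_cases hjb' : j = D.bar b
      · subst hjb'
        rw [h.nodeE_uPair_b'_a' (by omega), ← par_bar (j := b) (by omega)]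
        exact Submodule.smul_mem _ _ (Gen.diag _ h1 (by omega) (by omega)).mem
      · rw [h.nodeE_uPair_l_a' (by omega) (by omega) hjb (by omega) hjb']
        exact Submodule.smul_mem _ _ (Gen.pair _ _ h1 (by omega) (by omega) (by omega)).mem
    by_cases hjb : j = b
    · subst hjb
      rw [h.nodeE_uPair_b_l (by omega) (by omega) hkb hka (by omega)]
      exact (Gen.pair _ _ hb.1 (by omega) (by omega) (by omega)).mem
    by_cases hja : j = D.bar a
    · subst hja
      rw [h.nodeE_uPair_a'_l (by omega) (by omega) hkb hka (by omega)]
      exact Submodule.smul_mem _ _ (Gen.pair _ _ (by omega) (by omega) (by omega) (by omega)).mem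
    · rw [uPair, map_add, map_smul, nodeE_T_eq_zero (by omega) (by omega) hjb hja hkb hka,
        nodeE_T_eq_zero (by omega) (by omega) hkb hka hjb hja]
      simp
  · simp only [Submodule.comap_coe, Set.mem_preimage, SetLike.mem_coe]
    by_cases hjb : j = b
    · subst hjb
      rw [h.nodeE_diag_b h3 hα]
      exact Submodule.smul_mem _ _ (Gen.pair _ _ hb.1 (by omega) (by omega) (by omega)).mem
    by_cases hja : j = D.bar a
    · subst hja
      rw [par_bar (by omega), h.nodeE_diag_a' hα]
      exact Submodule.smul_mem _ _ (Gen.pair _ _ (by omega) (by omega) (by omega) (by omega)).mem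
    · rw [map_smul, nodeE_T_eq_zero (by omega) (by omega) hjb hja hjb hja, smul_zero]
      exact zero_mem _
  · simp only [Submodule.comap_coe, Set.mem_preimage, SetLike.mem_coe]
    have hcd := h'.bounds
    have hadj' : d = c + 1 ∨ (d = c + 2 ∧ 2 * c + 2 = m + n ∧ D.par (c + 1) = 0) := by
      rcases h' with ⟨_, h | h⟩
      · exact .inl h.1
      · exact .inr h
    by_cases hca : c = a
    · subst hca
      by_cases hdb : d = b
      · subst hdb
        by_cases hmid : 2 * d = m + n + 1
        · rw [h.nodeE_zz_middle hn hmid hα]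
          exact Submodule.smul_mem _ _ h.uPair_a_b'_mem
        · rw [h.nodeE_zz hmid]
          exact Submodule.smul_mem _ _ h.uPair_a_b'_mem
      -- Two different nodes with the same a exist only at the fork, where their second indices are
      -- s and s + 1 = s'.
      · have hd : d = D.bar b := by omega
        have hpb : D.par b = 0 := by
          rcases hadj with h5 | ⟨h5, h6, h7⟩
          · rcases hadj' with h8 | ⟨_, _, h9⟩
            · omega
            · rw [h5, h9]
          · rw [← par_bar (by omega), ← h7]; congr 1; omega
        rw [hd, h.nodeE_zz_bar (by omega) hpb hα]
        exact Submodule.smul_mem _ _ h.uPair_a_b'_mem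
    -- For an adjacent node only one of the two braces of z_{cd} is moved: the first, with r = -1,
    -- if c = b, and the second, with r = 1, if d = a.
    by_cases hcb : c = b
    · subst hcb
      rw [zz, map_sub, map_smul, h.nodeE_br_b (by omega), br_eq_zero_of_ne (l := d) _ (by omega)
        (by omega) (by omega) (by omega) (by omega) (by omega) (by omega), smul_zero, sub_zero]
      exact Submodule.smul_mem _ _ h.uPair_a_b'_mem
    have hc0 : D.nodeE a b (D.br α (-1) c) = 0 :=
      br_eq_zero_of_ne (l := c) _ (by omega)
        (by omega) (by omega) (by omega) (by omega) (by omega) (by omega)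
    by_cases hda : d = a
    · subst hda
      rw [zz, map_sub, map_smul, h.nodeE_br_a_one, hc0, zero_sub]
      exact neg_mem (Submodule.smul_mem _ _ (Submodule.smul_mem _ _ h.uPair_a_b'_mem))
    · rw [zz, map_sub, map_smul, hc0, br_eq_zero_of_ne (l := d) _ (by omega)
        (by omega) (by omega) (by omega) (by omega) (by omega) (by omega)]
      simp
  · simp only [Submodule.comap_coe, Set.mem_preimage, SetLike.mem_coe]
    have hc := h'.1
    rw [map_smul]
    refine Submodule.smul_mem _ _ ?_
    by_cases hcb : c = b
    · subst hcb
      rw [h.nodeE_br_b (by omega)]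
      exact Submodule.smul_mem _ _ h.uPair_a_b'_mem
    -- A fork requires v_s even and a long node requires v_s odd, so they never occur together.
    · have : b = a + 1 := by
        rcases hadj with h5 | ⟨h5, h6, h7⟩
        · exact h5
        · have h8 : c = a + 1 := by omega
          rw [← h8, h'.2] at h7
          exact absurd h7 (by decide)
      rw [br_eq_zero_of_ne (l := c) _ (by omega)
        (by omega) (by omega) (by omega) (by omega) (by omega) (by omega)]
      exact zero_mem _

/-- The coefficient of `Long.longE_br` at r = 1, the exponent with which the index s enters
z_{s-1,s}. The image is thus a multiple of the spanning vector at (s, s), including when that vector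
is zero. -/
theorem qh_sub_eq_fac : qh (-2) - α * qh (2 - 2 * 1) = qh (-2) * fac α 1 := by
  have h : qh (-2) * qh 2 = 1 := by rw [← qh_add]; exact qh_zero
  have h2 : fac α 1 = 1 - α * qh 2 := by rw [fac, sgn_one]; simp; ring
  have h3 : qh (2 - 2 * 1) = 1 := qh_zero
  rw [h2, h3]
  linear_combination α * h

theorem longE_br_eq_zero_of_ne {a l : ℕ} (r : ℤ) (hl : 1 ≤ l ∧ l ≤ m + n) (ha : a ≤ m + n)
    (h1 : l ≠ a) (h2 : l ≠ D.bar a) : D.longE a (D.br α r l) = 0 := by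
  have h4 : D.bar l ≠ D.bar a := by simp only [bar]; omega
  have h5 : 1 ≤ D.bar l ∧ D.bar l ≤ m + n := by simp only [bar]; omega
  rw [br, map_add, map_smul, Long.longE_T_eq_zero hl h5 h2 h4, Long.longE_T_eq_zero h5 hl h4 h2]
  simp

/-- `W` is stable under the raising operator of the long node. -/
theorem Long.longE_mem (hN : 2 < m + n) {a : ℕ} (h : D.Long a) (hα : α = qh (-2) ∨ α = -qh 2)
    {x : D.VV} (hx : x ∈ D.Wa α) : D.longE a x ∈ D.Wa α := by
  have h0 := h.1
  have ha' : D.bar a = m + n + 1 - a := rfl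
  -- Whatever r is, the image is a multiple of v_s ⊗ v_s, and the factor carried by the long vector
  -- is the one carried by the square of v_s.
  have hbr : ∀ r, fac α 1 • D.longE a (D.br α r a) ∈ D.Wa α := by
    intro r
    have hg := (Gen.diag (D := D) (α := α) a (by omega) (by omega) (by omega)).mem
    rw [h.2] at hg
    rw [h.longE_br hN, smul_comm]
    exact Submodule.smul_mem _ _ hg
  suffices D.Wa α ≤ (D.Wa α).comap (D.longE a) from this hx
  refine Submodule.span_le.2 ?_
  rintro _ (⟨j, k, h1, h2, h3, h4⟩ | ⟨j, h1, h2, h3⟩ | ⟨c, d, h'⟩ | ⟨c, h'⟩)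
  · simp only [Submodule.comap_coe, Set.mem_preimage, SetLike.mem_coe]
    by_cases hka : k = D.bar a
    · subst hka
      rw [h.longE_uPair_l_a' hN (by omega) (by omega) (by omega)]
      exact (Gen.pair _ _ (by omega) (by omega) (by omega) (by omega)).mem
    by_cases hja : j = D.bar a
    · subst hja
      rw [h.longE_uPair_a'_l hN (by omega) (by omega) (by omega)]
      exact (Gen.pair _ _ (by omega) (by omega) (by omega) (by omega)).mem
    · rw [uPair, map_add, map_smul, Long.longE_T_eq_zero (by omega) (by omega) hja hka,
        Long.longE_T_eq_zero (by omega) (by omega) hka hja]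
      simp
  · simp only [Submodule.comap_coe, Set.mem_preimage, SetLike.mem_coe]
    by_cases hja : j = D.bar a
    · subst hja
      rw [par_bar (by omega), h.longE_diag hN hα]
      exact Submodule.smul_mem _ _ (Gen.long _ h).mem
    · rw [map_smul, Long.longE_T_eq_zero (by omega) (by omega) hja hja, smul_zero]
      exact zero_mem _
  · simp only [Submodule.comap_coe, Set.mem_preimage, SetLike.mem_coe]
    have hcd := h'.bounds
    have hadj' : d = c + 1 := by
      rcases h' with ⟨_, h5 | ⟨h5, h6, h7⟩⟩
      · exact h5.1
      · have h8 : a = c + 1 := by omega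
        rw [← h8, h.2] at h7
        exact absurd h7 (by decide)
    have hc' : D.bar c = m + n + 1 - c := rfl
    have hc0 : D.longE a (D.br α (-1) c) = 0 :=
      longE_br_eq_zero_of_ne _ (by omega) (by omega) (by omega) (by omega)
    by_cases hda : d = a
    · subst hda
      rw [zz, map_sub, map_smul, hc0, zero_sub, h.longE_br hN]
      have hg := (Gen.diag (D := D) (α := α) d (by omega) (by omega) (by omega)).mem
      rw [h.2] at hg
      have hq := Submodule.smul_mem _ (qh (-2)) hg
      rw [smul_smul] at hq
      rw [qh_sub_eq_fac]
      exact neg_mem (Submodule.smul_mem _ _ hq)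
    · have hd' : D.bar d = m + n + 1 - d := rfl
      have hd0 : D.longE a (D.br α 1 d) = 0 :=
        longE_br_eq_zero_of_ne _ (by omega) (by omega) (by omega) (by omega)
      rw [zz, map_sub, map_smul, hc0, hd0]
      simp
  · simp only [Submodule.comap_coe, Set.mem_preimage, SetLike.mem_coe]
    have : c = a := by have := h'.1; omega
    rw [this, map_smul]
    exact hbr _

theorem eOp_mem (hn : Even n) (hN : 2 < m + n) (hα : α = qh (-2) ∨ α = -qh 2) {i : ℕ} (h1 : 1 ≤ i)
    (h2 : i ≤ D.s) {x : D.VV} (hx : x ∈ D.Wa α) : D.eOp i x ∈ D.Wa α := by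
  refine (exists_eOp_iff hn hN fun f => ∀ x ∈ D.Wa α, f x ∈ D.Wa α).2
    ⟨fun a b h x hx => ?_, fun a h x hx => ?_⟩ i h1 h2 x hx
  · exact h.nodeE_mem hn hα hx
  · exact h.longE_mem hN hα hx

end Data

/-! ### The flip exchanging raising and lowering operators -/

namespace Data

variable {m n : ℕ} (D : Data m n)

/-- The linear map `v_j ⊗ v_k ↦ ± v_{k'} ⊗ v_{j'}`, which exchanges raising and lowering
operators. -/
def psi : D.VV →ₗ[K] D.VV := D.constrT fun j k =>
  ((sgn (D.par j * D.par k) * D.theta j * D.theta k : ℤ) : K) • D.T (D.bar k) (D.bar j)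

variable {D} {α : K}

theorem psi_T {j k : ℕ} (hj : 1 ≤ j ∧ j ≤ m + n) (hk : 1 ≤ k ∧ k ≤ m + n) :
    D.psi (D.T j k) = ((sgn (D.par j * D.par k) * D.theta j * D.theta k : ℤ) : K) •
      D.T (D.bar k) (D.bar j) :=
  D.constrT_T _ hj hk

theorem bar_range {j : ℕ} (hj : 1 ≤ j ∧ j ≤ m + n) : 1 ≤ D.bar j ∧ D.bar j ≤ m + n := by
  simp only [bar]; omega

theorem bar_eq_iff {j k : ℕ} (hj : j ≤ m + n) (hk : k ≤ m + n) :
    D.bar j = k ↔ j = D.bar k := by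
  simp only [bar]; omega

theorem bar_eq_bar_iff {j k : ℕ} (hj : j ≤ m + n) (hk : k ≤ m + n) :
    D.bar j = D.bar k ↔ j = k := by
  simp only [bar]; omega

theorem theta_bar {j : ℕ} (hj : 1 ≤ j ∧ j ≤ m + n) :
    (D.theta (D.bar j) : ℤ) = sgn (D.par j) * D.theta j := by
  rcases zmod_two_cases (D.par j) with h | h
  · have h1 := D.theta_even j hj.1 hj.2 h
    have h2 := D.theta_even (D.bar j) (bar_range hj).1 (bar_range hj).2 (by rw [par_bar hj, h])
    rw [h1, h2, h]; rfl
  · have h1 := D.theta_odd j hj.1 hj.2 h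
    rw [h, h1, sgn_one]; simp [bar]

theorem theta_mul_self (j : ℕ) : (D.theta j : ℤ) * D.theta j = 1 := by
  rcases Int.units_eq_one_or (D.theta j) with h | h <;> simp [h]

theorem xdiag_bar_right (a : ℕ) (ha : a ≤ m + n) {k : ℕ} (hk : k ≤ m + n) :
    D.xdiag a (D.bar k) = -D.xdiag a k := by
  simp only [xdiag, bar_eq_iff hk ha, bar_eq_bar_iff hk ha]
  ring

theorem nodeH_bar (a b : ℕ) (ha : a ≤ m + n) (hb : b ≤ m + n) {k : ℕ} (hk : k ≤ m + n) :
    D.nodeH a b (D.bar k) = -D.nodeH a b k := by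
  rw [nodeH, xdiag_bar_right _ ha hk, xdiag_bar_right _ hb hk, nodeH]; ring

theorem nodeF_T {a b j k : ℕ} (hj : 1 ≤ j ∧ j ≤ m + n) (hk : 1 ≤ k ∧ k ≤ m + n) :
    D.nodeF a b (D.T j k) = ((sgn ((D.par a + D.par b) * D.par j) : K) * qh (D.nodeH a b j)) •
      ((sgn (D.par a) : K) • ((if k = a then D.T j b else 0) -
        D.kap b a • (if k = D.bar b then D.T j (D.bar a) else 0))) +
      qh (-D.nodeH a b k) • ((sgn (D.par a) : K) • ((if j = a then D.T b k else 0) -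
        D.kap b a • (if j = D.bar b then D.T (D.bar a) k else 0))) :=
  D.constrT_T _ hj hk

theorem longF_T {a j k : ℕ} (hj : 1 ≤ j ∧ j ≤ m + n) (hk : 1 ≤ k ∧ k ≤ m + n) :
    D.longF a (D.T j k) =
      qh (-2 * D.xdiag a j) • (-(qh 2 + qh (-2)) • (if k = a then D.T j (D.bar a) else 0)) +
      qh (2 * D.xdiag a k) • (-(qh 2 + qh (-2)) • (if j = a then D.T (D.bar a) k else 0)) :=
  D.constrT_T _ hj hk

/-- On V, the substitution v_j ↦ θ_j v_{j'} turns X_{ab} into a multiple of X_{ba} and h into -h.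
Exchanging the tensor factors turns q^{h/2} ⊗ x + x ⊗ q^{-h/2} into x ⊗ q^{h/2} + q^{-h/2} ⊗ x, and
h ↦ -h restores the original coproduct. -/
theorem Node.nodeF_psi {a b : ℕ} (h : D.Node a b) (x : D.VV) :
    D.nodeF a b (D.psi x) =
      (-(sgn (D.par a) * sgn (D.par b * (D.par a + D.par b)) : ℤ) : K) •
        D.psi (D.nodeE a b x) := by
  have hb := h.bounds
  have ha1 : 1 ≤ a ∧ a ≤ m + n := by omega
  have hb1 : 1 ≤ b ∧ b ≤ m + n := by omega
  have h3 : D.bar a ≠ b := by simp only [bar]; omega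
  suffices D.nodeF a b ∘ₗ D.psi =
      (-(sgn (D.par a) * sgn (D.par b * (D.par a + D.par b)) : ℤ) : K) •
        (D.psi ∘ₗ D.nodeE a b) from LinearMap.congr_fun this x
  apply D.lin_ext
  intro j k hj hk
  simp only [LinearMap.comp_apply, LinearMap.smul_apply]
  rw [psi_T hj hk, map_smul, nodeF_T (bar_range hk) (bar_range hj), nodeE_T hj hk,
    nodeH_bar _ _ ha1.2 hb1.2 hj.2, nodeH_bar _ _ ha1.2 hb1.2 hk.2, neg_neg, par_bar hk]
  simp only [bar_eq_iff hk.2 ha1.2, bar_eq_iff hj.2 ha1.2, bar_eq_bar_iff hk.2 hb1.2,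
    bar_eq_bar_iff hj.2 hb1.2, map_add, map_smul, map_sub, smul_add]
  generalize qh (D.nodeH a b j) = y
  generalize qh (-D.nodeH a b k) = z
  -- The flip of the tensor factors matches the first summand of Δ with the second.
  rw [add_comm]
  congr 1
  · by_cases hkb : k = b
    · subst hkb
      simp only [h3.symm, if_true, if_false, psi_T hj ha1, map_zero, smul_zero, zero_sub, sub_zero,
        smul_smul, ← neg_smul, kap]
      congr 1
      have ht := theta_mul_self (D := D) k
      have ht' : ((D.theta k : ℤ) : K) * ((D.theta k : ℤ) : K) = 1 := by exact_mod_cast ht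
      rcases zmod_two_cases (D.par a) with hpa | hpa <;>
        rcases zmod_two_cases (D.par k) with hpb | hpb <;>
        rcases zmod_two_cases (D.par j) with hpj | hpj <;>
        simp [hpa, hpb, hpj, sgn_zero, sgn_one, zmod_one_add_one] <;>
        linear_combination (((D.theta j : ℤ) : K) * ((D.theta a : ℤ) : K) * y) * ht'
    · by_cases hka : k = D.bar a
      · subst hka
        simp only [h3, if_true, if_false, psi_T hj (bar_range hb1), map_zero, smul_zero, zero_sub,
          sub_zero, smul_smul, ← neg_smul, kap, par_bar ha1, par_bar hb1, theta_bar ha1,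
          theta_bar hb1, bar_bar hb1.2]
        congr 1
        have ht := theta_mul_self (D := D) b
        have ht' : ((D.theta b : ℤ) : K) * ((D.theta b : ℤ) : K) = 1 := by exact_mod_cast ht
        rcases zmod_two_cases (D.par a) with hpa | hpa <;>
          rcases zmod_two_cases (D.par b) with hpb | hpb <;>
          rcases zmod_two_cases (D.par j) with hpj | hpj <;>
          simp [hpa, hpb, hpj, sgn_zero, sgn_one, zmod_one_add_one] <;>
          linear_combination -(((D.theta j : ℤ) : K) * ((D.theta a : ℤ) : K) * y) * ht'
      · simp [hkb, hka]
  · by_cases hjb : j = b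
    · subst hjb
      simp only [h3.symm, if_true, if_false, psi_T ha1 hk, map_zero, smul_zero, zero_sub, sub_zero,
        smul_smul, ← neg_smul, kap]
      congr 1
      have ht := theta_mul_self (D := D) j
      have ht' : ((D.theta j : ℤ) : K) * ((D.theta j : ℤ) : K) = 1 := by exact_mod_cast ht
      rcases zmod_two_cases (D.par a) with hpa | hpa <;>
        rcases zmod_two_cases (D.par j) with hpb | hpb <;>
        rcases zmod_two_cases (D.par k) with hpj | hpj <;>
        simp [hpa, hpb, hpj, sgn_zero, sgn_one, zmod_one_add_one] <;>
        linear_combination (((D.theta k : ℤ) : K) * ((D.theta a : ℤ) : K) * z) * ht'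
    · by_cases hja : j = D.bar a
      · subst hja
        simp only [h3, if_true, if_false, psi_T (bar_range hb1) hk, map_zero, smul_zero, zero_sub,
          sub_zero, smul_smul, ← neg_smul, kap, par_bar ha1, par_bar hb1, theta_bar ha1,
          theta_bar hb1, bar_bar hb1.2]
        congr 1
        have ht := theta_mul_self (D := D) b
        have ht' : ((D.theta b : ℤ) : K) * ((D.theta b : ℤ) : K) = 1 := by exact_mod_cast ht
        rcases zmod_two_cases (D.par a) with hpa | hpa <;>
          rcases zmod_two_cases (D.par b) with hpb | hpb <;>
          rcases zmod_two_cases (D.par k) with hpj | hpj <;>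
          simp [hpa, hpb, hpj, sgn_zero, sgn_one, zmod_one_add_one] <;>
          linear_combination -(((D.theta k : ℤ) : K) * ((D.theta a : ℤ) : K) * z) * ht'
      · simp [hjb, hja]

theorem Long.longF_psi {a : ℕ} (h : D.Long a) (hN : 2 < m + n) (x : D.VV) :
    D.longF a (D.psi x) = (qh 2 + qh (-2)) • D.psi (D.longE a x) := by
  obtain ⟨ha, ha'⟩ := h.range hN
  suffices D.longF a ∘ₗ D.psi = (qh 2 + qh (-2)) • (D.psi ∘ₗ D.longE a) from
    LinearMap.congr_fun this x
  apply D.lin_ext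
  intro j k hj hk
  simp only [LinearMap.comp_apply, LinearMap.smul_apply]
  rw [psi_T hj hk, map_smul, longF_T (bar_range hk) (bar_range hj), longE_T hj hk,
    xdiag_bar_right _ ha.2 hj.2, xdiag_bar_right _ ha.2 hk.2]
  simp only [bar_eq_iff hk.2 ha.2, bar_eq_iff hj.2 ha.2, map_add, map_smul, smul_add]
  rw [add_comm, show (2 : ℤ) * -D.xdiag a j = -2 * D.xdiag a j by ring,
    show (-2 : ℤ) * -D.xdiag a k = 2 * D.xdiag a k by ring]
  congr 1
  · by_cases hka : k = D.bar a
    · subst hka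
      simp only [if_true, psi_T hj ha, smul_smul, par_bar ha, theta_bar ha, h.2]
      congr 1
      simp only [sgn_one]
      push_cast
      ring
    · simp [hka]
  · by_cases hja : j = D.bar a
    · subst hja
      simp only [if_true, psi_T ha hk, smul_smul, par_bar ha, theta_bar ha, h.2]
      congr 1
      simp only [sgn_one]
      push_cast
      ring
    · simp [hja]

theorem psi_uPair {j k : ℕ} (hj : 1 ≤ j ∧ j ≤ m + n) (hk : 1 ≤ k ∧ k ≤ m + n) :
    D.psi (D.uPair α j k) = ((sgn (D.par j * D.par k) * D.theta j * D.theta k : ℤ) : K) •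
      D.uPair α (D.bar k) (D.bar j) := by
  rw [uPair, map_add, map_smul, psi_T hj hk, psi_T hk hj, uPair, par_bar hj, par_bar hk,
    mul_comm (D.par k)]
  push_cast
  module

/-- The sign is (-1)^{|v_j|} θ_j θ_{j'} = 1. Hence `psi` fixes all vectors of the form Σ x_j v_j ⊗
v_{j'}, in particular w_3 and the vectors `zz`. -/
theorem psi_T_bar {j : ℕ} (hj : 1 ≤ j ∧ j ≤ m + n) : D.psi (D.T j (D.bar j)) = D.T j (D.bar j) := by
  rw [psi_T hj (bar_range hj), bar_bar hj.2, par_bar hj, theta_bar hj]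
  have : sgn (D.par j * D.par j) * D.theta j * (sgn (D.par j) * D.theta j) = 1 := by
    rcases zmod_two_cases (D.par j) with h | h <;>
      rcases Int.units_eq_one_or (D.theta j) with h' | h' <;> simp [h, h', sgn_zero, sgn_one]
  rw [this]; simp

theorem psi_br (r : ℤ) {j : ℕ} (hj : 1 ≤ j ∧ j ≤ m + n) : D.psi (D.br α r j) = D.br α r j := by
  have := psi_T_bar (D := D) (bar_range (D := D) hj)
  rw [bar_bar hj.2] at this
  rw [br, map_add, map_smul, psi_T_bar hj, this]

theorem psi_zz {a b : ℕ} (h : D.Node a b) : D.psi (D.zz α a b) = D.zz α a b := by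
  have := h.bounds
  rw [zz, map_sub, map_smul, psi_br _ (by omega), psi_br _ (by omega)]

theorem psi_diag {j : ℕ} (hj : 1 ≤ j ∧ j ≤ m + n) (c : K) : D.psi (c • D.T j j) =
    (sgn (D.par j) : K) • c • D.T (D.bar j) (D.bar j) := by
  rw [map_smul, psi_T hj hj, mul_assoc, theta_mul_self, mul_one, smul_comm]
  congr 3
  rcases zmod_two_cases (D.par j) with h | h <;> simp [h]

theorem sgn_theta_ne_zero (p : ZMod 2) (j k : ℕ) :
    ((sgn p * D.theta j * D.theta k : ℤ) : K) ≠ 0 := by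
  rcases zmod_two_cases p with h | h <;>
    rcases Int.units_eq_one_or (D.theta j) with h' | h' <;>
    rcases Int.units_eq_one_or (D.theta k) with h'' | h'' <;> simp [h, h', h'', sgn_zero, sgn_one]

theorem sgn_int_ne_zero (p : ZMod 2) : sgn p ≠ 0 := by
  rcases zmod_two_cases p with h | h <;> simp [h, sgn_zero, sgn_one]

theorem sgn_ne_zero (p : ZMod 2) : (sgn p : K) ≠ 0 := by
  rcases zmod_two_cases p with h | h <;> simp [h, sgn_zero, sgn_one]

/-- `psi` permutes the spanning vectors up to scalars. The converse direction, with a nonzero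
scalar, provides preimages inside W, and these carry statements about raising operators over to
lowering ones. -/
theorem Gen.psi (hN : 2 < m + n) {x : D.VV} (h : D.Gen α x) :
    ∃ y, D.Gen α y ∧ (∃ ε : K, D.psi x = ε • y) ∧ ∃ ε : K, ε ≠ 0 ∧ D.psi y = ε • x := by
  rcases h with (⟨j, k, h1, h2, h3, h4⟩ | ⟨j, h1, h2, h3⟩ | ⟨c, d, h'⟩ | ⟨c, h'⟩)
  · have hj : 1 ≤ j ∧ j ≤ m + n := by omega
    have hk : 1 ≤ k ∧ k ≤ m + n := by omega
    refine ⟨D.uPair α (D.bar k) (D.bar j), .pair _ _ ?_ ?_ ?_ ?_, ⟨_, psi_uPair hj hk⟩, _, ?_, by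
      rw [psi_uPair (bar_range hk) (bar_range hj), bar_bar hj.2, bar_bar hk.2]⟩
    · exact (bar_range hk).1
    · simp only [bar]; omega
    · exact (bar_range hj).2
    · simp only [bar]; omega
    · exact sgn_theta_ne_zero _ _ _
  · have hj : 1 ≤ j ∧ j ≤ m + n := by omega
    refine ⟨fac α (D.par j) • D.T (D.bar j) (D.bar j), ?_, ⟨_, psi_diag hj _⟩, _, ?_, by
      rw [psi_diag (bar_range hj), bar_bar hj.2]⟩
    · rw [← par_bar hj]
      refine .diag _ (bar_range hj).1 (bar_range hj).2 ?_
      simp only [bar]; omega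
    · exact sgn_ne_zero _
  · exact ⟨_, .zero _ _ h', ⟨1, by rw [psi_zz h', one_smul]⟩, 1, one_ne_zero,
      by rw [psi_zz h', one_smul]⟩
  · have := h'.range hN
    exact ⟨_, .long _ h', ⟨1, by rw [map_smul, psi_br _ this.1, one_smul]⟩, 1, one_ne_zero,
      by rw [map_smul, psi_br _ this.1, one_smul]⟩

theorem psi_mem (hN : 2 < m + n) {x : D.VV} (h : x ∈ D.Wa α) : D.psi x ∈ D.Wa α := by
  suffices D.Wa α ≤ (D.Wa α).comap D.psi from this h
  refine Submodule.span_le.2 fun x hx => ?_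
  obtain ⟨y, hy, ⟨ε, h⟩, -⟩ := Gen.psi hN hx
  rw [SetLike.mem_coe, Submodule.mem_comap, h]
  exact Submodule.smul_mem _ _ hy.mem

theorem le_map_psi (hN : 2 < m + n) : D.Wa α ≤ (D.Wa α).map D.psi := by
  refine Submodule.span_le.2 fun x hx => ?_
  obtain ⟨y, hy, -, ε, hε, h⟩ := Gen.psi hN hx
  exact ⟨ε⁻¹ • y, Submodule.smul_mem _ _ hy.mem, by
    rw [map_smul, h, smul_smul, inv_mul_cancel₀ hε, one_smul]⟩

/-- Every lowering operator composed with `psi` is a multiple of `psi` composed with a raising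
operator. -/
theorem exists_fOp_psi (hn : Even n) (hN : 2 < m + n) {i : ℕ} (h1 : 1 ≤ i) (h2 : i ≤ D.s) :
    ∃ c : K, c ≠ 0 ∧ ∀ x, D.fOp i (D.psi x) = c • D.psi (D.eOp i x) := by
  rcases isNode_or_isLong hn hN h1 h2 with ⟨a, b, hab, hi⟩ | ⟨a, ha, hi⟩
  · rw [eOp_eq_nodeE hab hi, fOp_eq_nodeF hab hi]
    refine ⟨_, ?_, hab.nodeF_psi⟩
    have h3 := sgn_ne_zero (D.par a)
    have h4 := sgn_ne_zero (D.par b * (D.par a + D.par b))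
    push_cast
    exact neg_ne_zero.2 (mul_ne_zero h3 h4)
  · rw [eOp_eq_longE hN ha hi, fOp_eq_longF hN ha hi]
    exact ⟨_, qh_add_qh_ne_zero _ _, ha.longF_psi hN⟩

theorem fOp_mem (hn : Even n) (hN : 2 < m + n) (hα : α = qh (-2) ∨ α = -qh 2) {i : ℕ} (h1 : 1 ≤ i)
    (h2 : i ≤ D.s) {x : D.VV} (hx : x ∈ D.Wa α) : D.fOp i x ∈ D.Wa α := by
  obtain ⟨y, hy, rfl⟩ := le_map_psi hN hx
  obtain ⟨c, -, hc⟩ := exists_fOp_psi (D := D) hn hN h1 h2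
  rw [hc]
  exact Submodule.smul_mem _ _ (psi_mem hN (eOp_mem hn hN hα h1 h2 hy))

theorem h_bar (hN : 2 < m + n) {i : ℕ} (h2 : i ≤ D.s) {k : ℕ} (hk : k ≤ m + n) :
    D.h i (D.bar k) = -D.h i k := by
  have hs : D.s ≤ m + n := by simp only [s]; omega
  by_cases hc : i = D.s ∧ Even m
  · rw [h, h, if_pos hc, if_pos hc]
    rw [xdiag_bar_right _ (by omega) hk, xdiag_bar_right _ (by simp only [s]; omega) hk,
      xdiag_bar_right _ hs hk]
    split_ifs <;> ring
  · rw [h, h, if_neg hc, if_neg hc, xdiag_bar_right _ (by omega) hk,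
      xdiag_bar_right _ (by simp only [s] at h2; omega) hk]
    ring

theorem kOp_T_bar (hN : 2 < m + n) {i : ℕ} (h2 : i ≤ D.s) (c : ℤ) {k : ℕ} (hk : k ≤ m + n) :
    D.kOp i c (D.T k (D.bar k)) = D.T k (D.bar k) := by
  rw [kOp_T, h_bar hN h2 hk, add_neg_cancel, mul_zero, qh_zero, one_smul]

theorem kOp_br (hN : 2 < m + n) {i : ℕ} (h2 : i ≤ D.s) (c r : ℤ) {k : ℕ}
    (hk : 1 ≤ k ∧ k ≤ m + n) : D.kOp i c (D.br α r k) = D.br α r k := by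
  have := kOp_T_bar hN h2 c (bar_range (D := D) hk).2
  rw [bar_bar hk.2] at this
  rw [br, map_add, map_smul, this, kOp_T_bar hN h2 c hk.2]

theorem Gen.kOp (hN : 2 < m + n) {i : ℕ} (h2 : i ≤ D.s) (c : ℤ) {x : D.VV} (h : D.Gen α x) :
    ∃ ε : K, D.kOp i c x = ε • x := by
  rcases h with (⟨j, k, h1, h2, h3, h4⟩ | ⟨j, h1, h2, h3⟩ | ⟨a, d, h'⟩ | ⟨a, h'⟩)
  · refine ⟨qh (c * (D.h i j + D.h i k)), ?_⟩
    rw [uPair, map_add, map_smul, kOp_T, kOp_T, add_comm (D.h i k)]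
    module
  · exact ⟨_, by rw [map_smul, kOp_T, smul_comm]⟩
  · have := h'.bounds
    refine ⟨1, ?_⟩
    rw [zz, map_sub, map_smul, kOp_br hN h2 _ _ (by omega), kOp_br hN h2 _ _ (by omega), one_smul]
  · exact ⟨1, by rw [map_smul, kOp_br hN h2 _ _ (h'.range hN).1, one_smul]⟩

theorem kOp_mem (hN : 2 < m + n) {i : ℕ} (h2 : i ≤ D.s) (c : ℤ) {x : D.VV} (hx : x ∈ D.Wa α) :
    D.kOp i c x ∈ D.Wa α := by
  suffices D.Wa α ≤ (D.Wa α).comap (D.kOp i c) from this hx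
  refine Submodule.span_le.2 fun x hx => ?_
  obtain ⟨ε, h⟩ := Gen.kOp hN h2 c hx
  rw [SetLike.mem_coe, Submodule.mem_comap, h]
  exact Submodule.smul_mem _ _ hx.mem

end Data

/-! ### Singular vectors and the recursion in weight zero -/

namespace Data

variable {m n : ℕ} {D : Data m n} {α : K}

/-- The transposed form of the action: it lists the coordinates of x that contribute to one
coordinate of its image, so the equation e x = 0 can be read coordinate by coordinate. -/
theorem coord_nodeE {a b j k : ℕ} (hab : D.Node a b) (x : D.VV) :
    D.coord j k (D.nodeE a b x) =
      (sgn ((D.par a + D.par b) * D.par j) : K) * qh (D.nodeH a b j) *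
        ((if k = a then D.coord j b x else 0) -
          D.kap a b * (if k = D.bar b then D.coord j (D.bar a) x else 0)) +
      qh (-D.nodeH a b k) * ((if j = a then D.coord b k x else 0) -
          D.kap a b * (if j = D.bar b then D.coord (D.bar a) k x else 0)) := by
  have hb := hab.bounds
  have ha1 : 1 ≤ a ∧ a ≤ m + n := by omega
  have hb1 : 1 ≤ b ∧ b ≤ m + n := by omega
  suffices D.coord j k ∘ₗ D.nodeE a b =
      ((sgn ((D.par a + D.par b) * D.par j) : K) * qh (D.nodeH a b j)) •
        ((if k = a then D.coord j b else 0) -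
          D.kap a b • (if k = D.bar b then D.coord j (D.bar a) else 0)) +
      qh (-D.nodeH a b k) • ((if j = a then D.coord b k else 0) -
          D.kap a b • (if j = D.bar b then D.coord (D.bar a) k else 0)) by
    have h2 := LinearMap.congr_fun this x
    rw [LinearMap.comp_apply] at h2
    rw [h2]
    simp only [LinearMap.add_apply, LinearMap.smul_apply, LinearMap.sub_apply, smul_eq_mul]
    congr 3
    all_goals (try congr 1)
    all_goals (split_ifs <;> simp)
  apply D.lin_ext
  intro c d hc hd
  simp only [LinearMap.comp_apply, LinearMap.add_apply, LinearMap.smul_apply,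
    LinearMap.sub_apply, smul_eq_mul]
  rw [nodeE_T hc hd]
  have e1 : ∀ l, 1 ≤ l ∧ l ≤ m + n → (D.coord j k) (D.T c l) = if c = j ∧ l = k then 1 else 0 :=
    fun l hl => coord_T _ _ _ hc hl
  have e2 : ∀ l, 1 ≤ l ∧ l ≤ m + n → (D.coord j k) (D.T l d) = if l = j ∧ d = k then 1 else 0 :=
    fun l hl => coord_T _ _ _ hl hd
  simp only [map_add, map_smul, map_sub, smul_eq_mul, apply_ite (D.coord j k), map_zero,
    e1 _ ha1, e2 _ ha1, e1 _ (bar_range hb1), e2 _ (bar_range hb1)]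
  have e3 : ∀ (p : Prop) [Decidable p] (l r : ℕ), (if p then D.coord l r else 0) (D.T c d) =
      if p then (if c = l ∧ d = r then 1 else 0) else 0 := by
    intro p _ l r
    split_ifs <;> simp_all [coord_T]
  rw [e3, e3, e3, e3]
  congr 1
  · by_cases hcj : c = j
    · subst hcj
      simp only [true_and, ← ite_and, and_comm, eq_comm]
    · simp [hcj]
  · by_cases hdk : d = k
    · subst hdk
      congr 2
      · grind
      · grind
    · simp [hdk]

theorem coord_longE {a j k : ℕ} (ha : D.Long a) (hN : 2 < m + n) (x : D.VV) :
    D.coord j k (D.longE a x) =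
      qh (-2 * D.xdiag a j) * (if k = a then D.coord j (D.bar a) x else 0) +
      qh (2 * D.xdiag a k) * (if j = a then D.coord (D.bar a) k x else 0) := by
  obtain ⟨ha1, ha2⟩ := ha.range hN
  suffices D.coord j k ∘ₗ D.longE a =
      qh (-2 * D.xdiag a j) • (if k = a then D.coord j (D.bar a) else 0) +
      qh (2 * D.xdiag a k) • (if j = a then D.coord (D.bar a) k else 0) by
    have h2 := LinearMap.congr_fun this x
    rw [LinearMap.comp_apply] at h2
    rw [h2]
    simp only [LinearMap.add_apply, LinearMap.smul_apply, smul_eq_mul]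
    congr 2
    all_goals (split_ifs <;> simp)
  apply D.lin_ext
  intro c d hc hd
  simp only [LinearMap.comp_apply, LinearMap.add_apply, LinearMap.smul_apply, smul_eq_mul]
  rw [longE_T hc hd]
  have e1 : (D.coord j k) (D.T c a) = if c = j ∧ a = k then 1 else 0 := coord_T _ _ _ hc ha1
  have e2 : (D.coord j k) (D.T a d) = if a = j ∧ d = k then 1 else 0 := coord_T _ _ _ ha1 hd
  simp only [map_add, map_smul, smul_eq_mul, apply_ite (D.coord j k), map_zero, e1, e2]
  have e3 : ∀ (p : Prop) [Decidable p] (l r : ℕ), (if p then D.coord l r else 0) (D.T c d) =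
      if p then (if c = l ∧ d = r then 1 else 0) else 0 := by
    intro p _ l r
    split_ifs <;> simp_all [coord_T]
  rw [e3, e3]
  congr 1
  · by_cases hcj : c = j
    · subst hcj
      simp only [true_and, ← ite_and, and_comm, eq_comm]
    · simp [hcj]
  · by_cases hdk : d = k
    · subst hdk
      grind
    · simp [hdk]

/-- A vector killed by all raising operators. -/
def Singular (D : Data m n) (x : D.VV) : Prop :=
  (∀ a b, D.Node a b → D.nodeE a b x = 0) ∧ ∀ a, D.Long a → D.longE a x = 0

theorem singular_iff (hn : Even n) (hN : 2 < m + n) (x : D.VV) :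
    D.Singular x ↔ ∀ i, 1 ≤ i → i ≤ D.s → D.eOp i x = 0 :=
  (exists_eOp_iff hn hN fun f => f x = 0).symm

/-- Every basis vector but the first is moved by a raising operator. -/
theorem exists_source (hN : 2 < m + n) {k : ℕ} (h1 : 2 ≤ k) (h2 : k ≤ m + n) :
    (∃ a b, D.Node a b ∧ (k = b ∨ k = D.bar a)) ∨ ∃ a, D.Long a ∧ k = D.bar a := by
  by_cases h3 : 2 * k ≤ m + n + 1
  · exact .inl ⟨k - 1, k, ⟨by omega, .inl ⟨by omega, by omega⟩⟩, .inl rfl⟩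
  · by_cases h4 : 2 * k = m + n + 2
    · rcases zmod_two_cases (D.par (k - 1)) with hp | hp
      · refine .inl ⟨k - 2, k, ⟨by omega, .inr ⟨by omega, by omega, ?_⟩⟩, .inl rfl⟩
        rw [← hp]; congr 1; omega
      · refine .inr ⟨k - 1, ⟨by omega, hp⟩, ?_⟩
        simp only [bar]; omega
    · refine .inl ⟨m + n + 1 - k, m + n + 1 - k + 1, ⟨by omega, .inl ⟨by omega, by omega⟩⟩, .inr ?_⟩
      simp only [bar]; omega

/-- The coordinate (l, a) of e x receives (l, b) through the second factor. The excluded values l =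
a and l = b' are those for which the first factor contributes as well. -/
theorem Node.coord_l_b {a b : ℕ} (h : D.Node a b) {x : D.VV} (hx : D.nodeE a b x = 0) {l : ℕ}
    (h1 : l ≠ a) (h2 : l ≠ D.bar b) : D.coord l b x = 0 := by
  have hb := h.bounds
  have h3 : a ≠ D.bar b := by simp only [bar]; omega
  have := coord_nodeE (j := l) (k := a) h x
  rw [hx] at this
  simpa [h1, h2, h3, qh_ne_zero, sgn_int_ne_zero] using this

theorem Node.coord_l_a' {a b : ℕ} (h : D.Node a b) {x : D.VV} (hx : D.nodeE a b x = 0) {l : ℕ}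
    (h1 : l ≠ a) (h2 : l ≠ D.bar b) : D.coord l (D.bar a) x = 0 := by
  have hb := h.bounds
  have h3 : D.bar b ≠ a := by simp only [bar]; omega
  have := coord_nodeE (j := l) (k := D.bar b) h x
  rw [hx] at this
  simpa [h1, h2, h3, qh_ne_zero, sgn_int_ne_zero, kap, Units.ne_zero] using this

theorem Node.coord_b_l {a b : ℕ} (h : D.Node a b) {x : D.VV} (hx : D.nodeE a b x = 0) {l : ℕ}
    (h1 : l ≠ a) (h2 : l ≠ D.bar b) : D.coord b l x = 0 := by
  have hb := h.bounds
  have h3 : a ≠ D.bar b := by simp only [bar]; omega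
  have := coord_nodeE (j := a) (k := l) h x
  rw [hx] at this
  simpa [h1, h2, h3, qh_ne_zero, sgn_int_ne_zero] using this

theorem Node.coord_a'_l {a b : ℕ} (h : D.Node a b) {x : D.VV} (hx : D.nodeE a b x = 0) {l : ℕ}
    (h1 : l ≠ a) (h2 : l ≠ D.bar b) : D.coord (D.bar a) l x = 0 := by
  have hb := h.bounds
  have h3 : D.bar b ≠ a := by simp only [bar]; omega
  have := coord_nodeE (j := D.bar b) (k := l) h x
  rw [hx] at this
  simpa [h1, h2, h3, qh_ne_zero, sgn_int_ne_zero, kap, Units.ne_zero] using this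

/-- Here both factors contribute to the coordinate (a, a), so the equation gives a relation between
(a, b) and (b, a) instead of a vanishing. -/
theorem Node.coord_a_b {a b : ℕ} (h : D.Node a b) {x : D.VV} (hx : D.nodeE a b x = 0) :
    (sgn ((D.par a + D.par b) * D.par a) : K) * qh (sgn (D.par a)) * D.coord a b x +
      qh (-sgn (D.par a)) * D.coord b a x = 0 := by
  have hb := h.bounds
  have h3 : a ≠ D.bar b := by simp only [bar]; omega
  have := coord_nodeE (j := a) (k := a) h x
  rw [hx, h.nodeH_a] at this
  simpa [h3] using this.symm

theorem Long.coord_l_a' {a : ℕ} (h : D.Long a) (hN : 2 < m + n) {x : D.VV} (hx : D.longE a x = 0)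
    {l : ℕ} (h1 : l ≠ a) : D.coord l (D.bar a) x = 0 := by
  have := coord_longE (j := l) (k := a) h hN x
  rw [hx] at this
  simpa [h1, qh_ne_zero] using this

theorem Long.coord_a'_l {a : ℕ} (h : D.Long a) (hN : 2 < m + n) {x : D.VV} (hx : D.longE a x = 0)
    {l : ℕ} (h1 : l ≠ a) : D.coord (D.bar a) l x = 0 := by
  have := coord_longE (j := a) (k := l) h hN x
  rw [hx] at this
  simpa [h1, qh_ne_zero] using this

/-- The recursion of the coefficients of `w_3`. -/
def Rec (D : Data m n) (y : ℕ → K) : Prop :=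
  (∀ a b, D.Node a b →
    y b = ((D.theta a * D.theta b : ℤ) : K) * qh (sgn (D.par a) + D.eps b b) * y a ∧
    y (D.bar a) = ((sgn (D.par a + D.par b) * D.theta a * D.theta b : ℤ) : K) *
      qh (sgn (D.par a) + D.eps b b) * y (D.bar b)) ∧
  ∀ a, D.Long a → y (D.bar a) = -(qh (-4) * y a)

/-- Every index above 1 is the source of a raising operator, and the recursion expresses its value
through a smaller index; so y 1 determines everything. -/
theorem Rec.eq_zero (hN : 2 < m + n) {y : ℕ → K} (hy : D.Rec y) (h1 : y 1 = 0) {l : ℕ}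
    (hl : 1 ≤ l ∧ l ≤ m + n) : y l = 0 := by
  induction l using Nat.strong_induction_on with
  | _ l ih =>
    rcases hl.1.eq_or_lt with rfl | h2
    · exact h1
    · rcases exists_source (D := D) hN h2 hl.2 with ⟨a, b, hab, rfl | rfl⟩ | ⟨a, ha, rfl⟩
      · have := hab.bounds
        rw [(hy.1 a l hab).1, ih a (by omega) (by omega), mul_zero]
      · have := hab.bounds
        rw [(hy.1 a b hab).2, ih (D.bar b) (by simp only [bar]; omega)
          (by simp only [bar]; omega), mul_zero]
      · have := ha.1
        rw [hy.2 a ha, ih a (by simp only [bar]; omega) (by omega)]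
        simp

theorem Rec.sub_smul {y z : ℕ → K} (hy : D.Rec y) (hz : D.Rec z) (c : K) :
    D.Rec fun l => y l - c * z l := by
  refine ⟨fun a b h => ⟨?_, ?_⟩, fun a h => ?_⟩
  · simp only [(hy.1 a b h).1, (hz.1 a b h).1]; ring
  · simp only [(hy.1 a b h).2, (hz.1 a b h).2]; ring
  · simp only [hy.2 a h, hz.2 a h]; ring

/-- The coordinates of weight zero of a singular vector satisfy the recursion. -/
theorem Singular.rec (hN : 2 < m + n) {x : D.VV} (hx : D.Singular x) :
    D.Rec fun l => D.coord l (D.bar l) x := by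
  refine ⟨fun a b h => ⟨?_, ?_⟩, fun a h => ?_⟩
  · have hb := h.bounds
    have h3 : a ≠ D.bar b := by simp only [bar]; omega
    -- At (a, b') exactly the weight zero coordinates (b, b') and (a, a') contribute; at (b', a) it
    -- is (b', b) and (a', a).
    have := coord_nodeE (j := a) (k := D.bar b) h x
    rw [hx.1 a b h, h.nodeH_a, h.nodeH_bar_b, map_zero, if_neg h3.symm, if_pos rfl, if_pos rfl,
      if_neg h3, kap, qh_neg] at this
    rw [qh_add]
    have hne := qh_ne_zero (D.eps b b)
    field_simp at this
    rcases zmod_two_cases (D.par a) with hpa | hpa <;>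
      rcases zmod_two_cases (D.par b) with hpb | hpb <;>
      simp [hpa, hpb, sgn_zero, sgn_one, zmod_one_add_one] at this ⊢ <;>
      linear_combination -this
  · have hb := h.bounds
    have h3 : a ≠ D.bar b := by simp only [bar]; omega
    have := coord_nodeE (j := D.bar b) (k := a) h x
    rw [hx.1 a b h, h.nodeH_a, h.nodeH_bar_b, map_zero, if_neg h3.symm, if_pos rfl, if_pos rfl,
      if_neg h3, kap, qh_neg, par_bar (by omega)] at this
    beta_reduce
    rw [qh_add, bar_bar (by omega : a ≤ m + n), bar_bar (by omega : b ≤ m + n)]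
    have hne := qh_ne_zero (sgn (D.par a))
    field_simp at this
    rcases zmod_two_cases (D.par a) with hpa | hpa <;>
      rcases zmod_two_cases (D.par b) with hpb | hpb <;>
      rcases Int.units_eq_one_or (D.theta a) with hta | hta <;>
      rcases Int.units_eq_one_or (D.theta b) with htb | htb <;>
      simp [hpa, hpb, hta, htb, sgn_zero, sgn_one, zmod_one_add_one, qh] at this ⊢ <;>
      first
      | linear_combination this
      | linear_combination -this
  · have := coord_longE (j := a) (k := a) h hN x
    rw [hx.2 a h, if_pos rfl, if_pos rfl, h.xdiag_self, map_zero] at this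
    beta_reduce
    rw [bar_bar (h.range hN).1.2]
    simp [qh] at this ⊢
    field_simp [X_ne_zero] at this ⊢
    linear_combination -this

end Data

/-! ### The coefficients of w_3 -/

namespace Data

variable {m n : ℕ} {D : Data m n} {α : K}

theorem c_one : D.c 1 = 1 := by rw [c]

theorem c_of_le {a : ℕ} (h1 : 1 ≤ a) (h2 : a + 1 ≤ D.s) :
    D.c (a + 1) = ((D.theta a * D.theta (a + 1) : ℤ) : K) *
      qh (sgn (D.par a) + sgn (D.par (a + 1))) * D.c a := by
  obtain ⟨k, rfl⟩ := Nat.exists_eq_add_of_le' h1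
  rw [c, if_pos h2]; ring

theorem c_middle (hn : Even n) {a : ℕ} (h1 : 1 ≤ a) (h2 : 2 * a + 1 = m + n) :
    D.c (a + 1) = ((D.theta a * D.theta (a + 1) : ℤ) : K) * qh (sgn (D.par a)) * D.c a := by
  rw [Nat.even_iff] at hn
  obtain ⟨k, rfl⟩ := Nat.exists_eq_add_of_le' h1
  have hs : D.s = k + 1 := by simp only [s]; omega
  rw [c, if_neg (by omega), if_pos (by omega), if_neg (by rw [Nat.even_iff]; omega), hs]; ring

theorem c_middle_succ (hn : Even n) {a : ℕ} (h2 : 2 * a + 1 = m + n) :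
    D.c (a + 2) = ((sgn (D.par a + D.par (a + 1)) * D.theta a * D.theta (a + 1) : ℤ) : K) *
      qh (sgn (D.par a)) * D.c (a + 1) := by
  rw [Nat.even_iff] at hn
  have hs : D.s = a := by simp only [s]; omega
  rw [c, if_neg (by omega), if_neg (by omega), if_pos ⟨by omega, by rw [Nat.even_iff]; omega⟩, hs]
  ring

theorem c_fork (hn : Even n) {a : ℕ} (h2 : 2 * a + 2 = m + n)
    (h3 : D.par (a + 1) = 0) :
    D.c (a + 2) = ((D.theta a * D.theta (a + 2) : ℤ) : K) *
      qh (sgn (D.par a) + sgn (D.par (a + 1))) * D.c a := by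
  rw [Nat.even_iff] at hn
  have hs : D.s = a + 1 := by simp only [s]; omega
  rw [c, if_neg (by omega), if_pos (by omega), if_pos (by rw [Nat.even_iff]; omega), hs, if_pos h3,
    add_comm (sgn (D.par (a + 1)))]
  simp only [Nat.add_sub_cancel]
  ring

theorem c_long (hn : Even n) {a : ℕ} (hN : 2 < m + n) (h : D.Long a) :
    D.c (a + 1) = -(qh (-4) * D.c a) := by
  have h2 := h.1
  rw [Nat.even_iff] at hn
  obtain ⟨k, rfl⟩ := Nat.exists_eq_add_of_le' (show 1 ≤ a by omega)
  have hs : D.s = k + 1 := by simp only [s]; omega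
  rw [c, if_neg (by omega), if_pos (by omega), if_pos (by rw [Nat.even_iff]; omega), hs, if_neg,
    h.2, sgn_one]
  · norm_num
  · rw [h.2]; decide

theorem c_bar (hn : Even n) {a : ℕ} (h1 : 1 ≤ a) (h2 : a < D.s) :
    D.c (D.bar a) = ((sgn (D.par a + D.par (a + 1)) * D.theta a * D.theta (a + 1) : ℤ) : K) *
      qh (sgn (D.par a) + sgn (D.par (a + 1))) * D.c (D.bar (a + 1)) := by
  rw [Nat.even_iff] at hn
  simp only [s] at h2
  obtain ⟨k, hk⟩ := Nat.exists_eq_add_of_le' (show 2 ≤ D.bar a by simp only [bar]; omega)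
  have hk2 : D.bar (a + 1) = k + 1 := by simp only [bar] at hk ⊢; omega
  have hk3 : D.bar (k + 2) = a := by simp only [bar] at hk ⊢; omega
  have hk4 : k + 2 = m + n + 1 - a := by rw [← hk]; rfl
  rw [hk, hk2, c, if_neg (by simp only [s]; omega), if_neg (by simp only [s]; omega),
    if_neg (by rw [Nat.even_iff]; simp only [s]; omega)]
  simp only [hk3]
  ring

/-- The case distinctions in the definition of c fit one formula, in which `eps b b` is 0 at the
middle index and (-1)^{|v_b|} elsewhere. At the fork the second relation is a consistency statement,
which holds because c_s = c_{s+1} there. -/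
theorem rec_c (hn : Even n) (hN : 2 < m + n) : D.Rec D.c := by
  have hn' := Nat.even_iff.1 hn
  refine ⟨?_, fun a h => by rw [h.bar]; exact c_long hn hN h⟩
  rintro a b ⟨h1, ⟨rfl, h2⟩ | ⟨rfl, h2, h3⟩⟩
  · by_cases hm : 2 * a + 1 = m + n
    · rw [eps_middle _ (by omega), add_zero, c_middle hn h1 hm]
      refine ⟨rfl, ?_⟩
      have e1 : D.bar a = a + 2 := by simp only [bar]; omega
      have e2 : D.bar (a + 1) = a + 1 := by simp only [bar]; omega
      rw [e1, e2, c_middle_succ hn hm, c_middle hn h1 hm]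
    · rw [eps_self _ (by omega)]
      exact ⟨c_of_le h1 (by simp only [s]; omega), c_bar hn h1 (by simp only [s]; omega)⟩
  · have hp : D.par (a + 2) = 0 := by
      rw [← par_bar (by omega), ← h3]; congr 1; simp only [bar]; omega
    have ht1 : D.theta (a + 1) = 1 := D.theta_even _ (by omega) (by omega) h3
    have ht2 : D.theta (a + 2) = 1 := D.theta_even _ (by omega) (by omega) hp
    have hc := c_fork hn h2 h3
    refine ⟨by rw [hc, eps_self _ (by omega), hp, h3], ?_⟩
    have e2 : D.bar (a + 2) = a + 1 := by simp only [bar]; omega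
    have e3 : D.bar (a + 1) = a + 2 := by simp only [bar]; omega
    rw [c_bar hn h1 (by simp only [s]; omega), eps_self _ (by omega), e2, e3, hc,
      c_of_le h1 (by simp only [s]; omega), hp, h3, ht1, ht2]

theorem coord_w₃ {j : ℕ} (hj : 1 ≤ j ∧ j ≤ m + n) (k : ℕ) :
    D.coord j k D.w₃ = if k = D.bar j then D.c j else 0 := by
  rw [w₃, map_sum, Finset.sum_eq_single j]
  · rw [map_smul]
    change D.c j • D.coord j k (D.T j (D.bar j)) = _
    rw [coord_T _ _ _ hj (bar_range hj)]
    simp [eq_comm]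
  · intro i hi hij
    rw [Finset.mem_Icc] at hi
    rw [map_smul]
    change D.c i • D.coord j k (D.T i (D.bar i)) = _
    rw [coord_T _ _ _ hi (bar_range hi), if_neg (fun h => hij h.1), smul_zero]
  · intro h
    exact absurd (Finset.mem_Icc.2 hj) h

/-- The vector `w_3` is killed by all raising operators. -/
theorem singular_w₃ (hn : Even n) (hN : 2 < m + n) : D.Singular D.w₃ := by
  refine ⟨fun a b h => D.ext_coord fun j k hj hk => ?_, fun a h => D.ext_coord fun j k hj hk => ?_⟩
  · have hb := h.bounds
    have ha1 : 1 ≤ a ∧ a ≤ m + n := by omega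
    have hb1 : 1 ≤ b ∧ b ≤ m + n := by omega
    obtain ⟨r1, r2⟩ := (rec_c hn hN).1 a b h
    have h3 : a ≠ D.bar b := by simp only [bar]; omega
    rw [coord_nodeE h, map_zero, coord_w₃ hj, coord_w₃ hj, coord_w₃ hb1,
      coord_w₃ (bar_range ha1), bar_bar ha1.2]
    simp only [eq_comm (a := b), bar_eq_iff hj.2 hb1.2, bar_eq_bar_iff hj.2 ha1.2,
      eq_comm (a := D.bar a)]
    -- Only the coordinates (a, b') and (b', a) of the image can be nonzero; each of them vanishes
    -- by one of the two relations of the recursion.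
    by_cases h4 : j = a ∧ k = D.bar b
    · obtain ⟨rfl, rfl⟩ := h4
      rw [h.nodeH_a, h.nodeH_bar_b, r1]
      simp only [h3, h3.symm, if_true, if_false, kap]
      rw [qh_add, qh_neg]
      have := qh_ne_zero (D.eps b b)
      field_simp
      rcases zmod_two_cases (D.par j) with hpa | hpa <;>
        rcases zmod_two_cases (D.par b) with hpb | hpb <;>
        simp [hpa, hpb, sgn_zero, sgn_one, zmod_one_add_one] <;> ring
    · by_cases h5 : j = D.bar b ∧ k = a
      · obtain ⟨rfl, rfl⟩ := h5
        rw [h.nodeH_a, h.nodeH_bar_b, r2, par_bar hb1]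
        simp only [h3, h3.symm, if_true, if_false, kap]
        rw [qh_add, qh_neg]
        have := qh_ne_zero (sgn (D.par k))
        field_simp
        rcases zmod_two_cases (D.par k) with hpa | hpa <;>
          rcases zmod_two_cases (D.par b) with hpb | hpb <;>
          rcases Int.units_eq_one_or (D.theta k) with hta | hta <;>
          rcases Int.units_eq_one_or (D.theta b) with htb | htb <;>
          simp [hpa, hpb, hta, htb, sgn_zero, sgn_one, zmod_one_add_one]
      · split_ifs <;> first | (exfalso; omega) | simp
  · obtain ⟨ha1, ha2⟩ := h.range hN
    rw [coord_longE h hN, map_zero, coord_w₃ hj, coord_w₃ ha2, bar_bar ha1.2,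
      (rec_c hn hN).2 a h]
    simp only [bar_eq_bar_iff ha1.2 hj.2]
    by_cases h4 : j = a ∧ k = a
    · obtain ⟨rfl, rfl⟩ := h4
      simp [h.xdiag_self, qh]
      field_simp [X_ne_zero]
      ring
    · split_ifs <;> first | (exfalso; omega) | simp

/-- The coordinates of weight zero of a singular vector. -/
theorem Singular.coord_eq (hn : Even n) (hN : 2 < m + n) {x : D.VV} (hx : D.Singular x) {l : ℕ}
    (hl : 1 ≤ l ∧ l ≤ m + n) : D.coord l (D.bar l) x = D.coord 1 (D.bar 1) x * D.c l := by
  -- The difference of the two sides satisfies the recursion and vanishes at 1, because c_1 = 1.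
  have := ((hx.rec hN).sub_smul (rec_c hn hN) (D.coord 1 (D.bar 1) x)).eq_zero hN
    (by rw [c_one, mul_one, sub_self]) hl
  exact sub_eq_zero.1 this

end Data

/-! ### The invariant form and its value at w_3 -/

namespace Data

variable {m n : ℕ} (D : Data m n)

/-- The sum of the signs of `v_1, …, v_k`. -/
def psum (k : ℕ) : ℤ := ∑ i ∈ Finset.Icc 1 k, sgn (D.par i)

/-- The invariant form on `V ⊗ V`. -/
def phi : D.VV →ₗ[K] K :=
  D.constrT fun j k => if k = D.bar j then (sgn (D.par j) : K) * D.c j else 0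

variable {D}

theorem psum_succ (k : ℕ) : D.psum (k + 1) = D.psum k + sgn (D.par (k + 1)) := by
  rw [psum, Finset.sum_Icc_succ_top (by omega), psum]

theorem psum_zero : D.psum 0 = 0 := rfl

theorem sum_fold {M : Type*} [AddCommMonoid M] (f : ℕ → M) :
    ∑ i ∈ Finset.Icc 1 (m + n), f i = (∑ i ∈ Finset.Icc 1 D.s, (f i + f (D.bar i))) +
      if Even (m + n) then 0 else f (D.s + 1) := by
  rw [Finset.sum_add_distrib]
  have h1 : ∑ i ∈ Finset.Icc 1 D.s, f (D.bar i) =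
      ∑ i ∈ Finset.Icc (m + n + 1 - D.s) (m + n), f i := by
    refine Finset.sum_nbij' D.bar D.bar ?_ ?_ ?_ ?_ ?_ <;> intro i hi <;>
      simp only [Finset.mem_Icc, bar, s] at hi ⊢ <;> omega
  have h2 : Finset.Icc 1 (m + n) = Finset.Icc 1 D.s ∪
      (Finset.Icc (m + n + 1 - D.s) (m + n) ∪
        if Even (m + n) then ∅ else {D.s + 1}) := by
    ext i
    split_ifs with h <;> rw [Nat.even_iff] at h <;>
      simp only [Finset.mem_union, Finset.mem_Icc, Finset.mem_singleton, s, Finset.notMem_empty,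
        or_false] <;> omega
  rw [h1, h2, Finset.sum_union, Finset.sum_union, ← add_assoc]
  · congr 1
    split_ifs <;> simp
  · rw [Finset.disjoint_left]
    intro i hi
    split_ifs with h <;> rw [Nat.even_iff] at h <;>
      simp only [Finset.mem_Icc, Finset.mem_singleton, s, Finset.notMem_empty,
        not_false_iff] at hi ⊢ <;> omega
  · rw [Finset.disjoint_left]
    intro i hi
    split_ifs with h <;> rw [Nat.even_iff] at h <;>
      simp only [Finset.mem_union, Finset.mem_Icc, Finset.mem_singleton, s,
        Finset.notMem_empty, or_false] at hi ⊢ <;> omega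

theorem psum_total : D.psum (m + n) = (m : ℤ) - n := by
  have h : ∀ i, sgn (D.par i) = 1 - 2 * if D.par i = 1 then 1 else 0 := by
    intro i
    rcases zmod_two_cases (D.par i) with h | h <;> simp [h, sgn_zero, sgn_one]
  rw [psum, Finset.sum_congr rfl fun i _ => h i, Finset.sum_sub_distrib, ← Finset.mul_sum,
    Finset.sum_boole, D.card_odd]
  simp
  ring

/-- Parities are symmetric under i ↦ i', so the total m - n is twice the half sum, plus 1 for the
middle index of odd N, which is even. -/
theorem psum_s (hn : Even n) :
    2 * D.psum D.s + (if Even (m + n) then 0 else 1) = (m : ℤ) - n := by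
  rw [← psum_total (D := D), psum, psum, sum_fold (D := D), Finset.mul_sum]
  congr 1
  · refine Finset.sum_congr rfl fun i hi => ?_
    rw [Finset.mem_Icc] at hi
    rw [par_bar ⟨hi.1, by have := hi.2; simp only [s] at this; omega⟩, two_mul]
  · split_ifs with h
    · rfl
    · rw [Nat.even_iff] at h
      rw [par_middle hn (by simp only [s]; omega)]; rfl

theorem theta_mul_sq (j k : ℕ) :
    ((D.theta j * D.theta k : ℤ) : K) * ((D.theta j * D.theta k : ℤ) : K) = 1 := by
  rcases Int.units_eq_one_or (D.theta j) with h | h <;>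
    rcases Int.units_eq_one_or (D.theta k) with h' | h' <;> simp [h, h']

/-- With P_k = `psum k`, squaring removes the signs θ, and P_{a-1} + P_a grows at each step by
(-1)^{|v_a|} + (-1)^{|v_{a+1}|}, the exponent in r_{a,a+1}². -/
theorem c_mul_self {a : ℕ} (h1 : 1 ≤ a) (h2 : a ≤ D.s) :
    D.c a * D.c a = qh (2 * (D.psum (a - 1) + D.psum a - sgn (D.par 1))) := by
  induction a, h1 using Nat.le_induction with
  | base => rw [c_one, psum_succ 0]; simp [psum_zero, qh_zero]
  | succ a h1 ih =>
    rw [c_of_le h1 h2]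
    have ht := theta_mul_sq (D := D) a (a + 1)
    have h3 : qh (2 * (D.psum (a + 1 - 1) + D.psum (a + 1) - sgn (D.par 1))) =
        qh (sgn (D.par a) + sgn (D.par (a + 1))) * qh (sgn (D.par a) + sgn (D.par (a + 1))) *
        qh (2 * (D.psum (a - 1) + D.psum a - sgn (D.par 1))) := by
      obtain ⟨k, rfl⟩ := Nat.exists_eq_add_of_le' h1
      rw [← qh_add, ← qh_add]
      congr 1
      simp only [Nat.add_sub_cancel]
      rw [psum_succ (k + 1), psum_succ k]
      ring
    rw [h3, ← ih (by omega)]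
    linear_combination (qh (sgn (D.par a) + sgn (D.par (a + 1))) *
      qh (sgn (D.par a) + sgn (D.par (a + 1))) * D.c a * D.c a) * ht

/-- The quantity (-1)^{|v_a|} c_a c_{a'} does not depend on a, since c_{a+1} and c_{a'} carry the
same factor r_{a,a+1} up to the sign that is compensated. So the second half of the coefficients is
known from the first. -/
theorem c_mul_bar (hn : Even n) {a : ℕ} (h1 : 1 ≤ a) (h2 : a ≤ D.s) :
    (sgn (D.par a) : K) * D.c a * D.c (D.bar a) = (sgn (D.par 1) : K) * D.c (D.bar 1) := by
  induction a, h1 using Nat.le_induction with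
  | base => rw [c_one, mul_one]
  | succ a h1 ih =>
    rw [← ih (by omega), c_of_le h1 h2, c_bar hn h1 (by omega)]
    have hs : (sgn (D.par a) : K) * (sgn (D.par a + D.par (a + 1)) : K) = sgn (D.par (a + 1)) := by
      rw [sgn_add]
      have := sgn_mul_self (D.par a)
      push_cast
      rw [← mul_assoc, ← Int.cast_mul, this]
      simp
    rw [← hs]
    push_cast
    ring

/-- The constant value is found at the innermost pair, where the three shapes of the last node are
compared. -/
theorem c_bar_s (hn : Even n) (hN : 2 < m + n) :
    (sgn (D.par D.s) : K) * D.c D.s * D.c (D.bar D.s) =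
      qh (2 * ((m : ℤ) - n - 1 - sgn (D.par 1))) := by
  have hn' := Nat.even_iff.1 hn
  have hs := psum_s (D := D) hn
  have h1 : 1 ≤ D.s := by simp only [s]; omega
  have hsq := c_mul_self h1 le_rfl
  obtain ⟨k, hk⟩ := Nat.exists_eq_add_of_le' h1
  have hps := psum_succ (D := D) k
  rw [hk] at hsq hs ⊢
  simp only [Nat.add_sub_cancel] at hsq
  split_ifs at hs with he
  · have he' := he
    rw [Nat.even_iff] at he'
    have hk' : 2 * (k + 1) = m + n := by simp only [s] at hk; omega
    have hb : D.bar (k + 1) = k + 1 + 1 := by simp only [bar]; omega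
    -- For v_s even the fork gives c_{s+1} = c_s; for v_s odd the long node gives c_{s+1} = -q⁻²
    -- c_s.
    rcases zmod_two_cases (D.par (k + 1)) with hp | hp
    · have hc : D.c (k + 1 + 1) = D.c (k + 1) := by
        have h2 : 1 ≤ k := by omega
        rw [show k + 1 + 1 = k + 2 from rfl, c_fork hn (by omega) hp, c_of_le h2 (by omega)]
        have ht1 : D.theta (k + 1) = 1 := D.theta_even _ (by omega) (by omega) hp
        have ht2 : D.theta (k + 2) = 1 := by
          apply D.theta_even _ (by omega) (by omega)
          rw [show k + 2 = D.bar (k + 1) from hb.symm, par_bar (by omega), hp]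
        rw [ht1, ht2]
      rw [hb, hc, hp, sgn_zero, Int.cast_one, one_mul, hsq]
      rw [hp, sgn_zero] at hps
      congr 1
      linarith
    · have hc : D.c (k + 1 + 1) = _ := c_long hn hN ⟨hk', hp⟩
      rw [hb, hc, hp, sgn_one]
      have : qh (2 * ((m : ℤ) - n - 1 - sgn (D.par 1))) =
          qh (-4) * qh (2 * (D.psum k + D.psum (k + 1) - sgn (D.par 1))) := by
        rw [hp, sgn_one] at hps
        rw [← qh_add]
        congr 1
        linarith
      rw [this, ← hsq]
      push_cast
      ring
  · rw [Nat.even_iff] at he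
    have hk' : 2 * (k + 1) + 1 = m + n := by simp only [s] at hk; omega
    have hb : D.bar (k + 1) = k + 1 + 2 := by simp only [bar]; omega
    have hp : D.par (k + 1 + 1) = 0 := par_middle hn (by omega)
    have h3 : qh (2 * ((m : ℤ) - n - 1 - sgn (D.par 1))) =
        qh (sgn (D.par (k + 1))) * qh (sgn (D.par (k + 1))) *
          qh (2 * (D.psum k + D.psum (k + 1) - sgn (D.par 1))) := by
      rw [← qh_add, ← qh_add]
      congr 1
      linarith
    have ht := theta_mul_sq (D := D) (k + 1) (k + 1 + 1)
    have hss : (sgn (D.par (k + 1)) : K) * (sgn (D.par (k + 1)) : K) = 1 := by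
      exact_mod_cast sgn_mul_self (D.par (k + 1))
    rw [hb, c_middle_succ hn hk', c_middle hn (by omega) hk', h3, ← hsq, hp, add_zero]
    push_cast at ht ⊢
    linear_combination (qh (sgn (D.par (k + 1))) * qh (sgn (D.par (k + 1))) * D.c (k + 1) *
      D.c (k + 1)) * (hss + (sgn (D.par (k + 1)) : K) * (sgn (D.par (k + 1)) : K) * ht)

/-- The last coefficient of `w_3`. -/
theorem c_last (hn : Even n) (hN : 2 < m + n) :
    D.c (D.bar 1) = (sgn (D.par 1) : K) * qh (2 * ((m : ℤ) - n - 1 - sgn (D.par 1))) := by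
  have h1 : 1 ≤ D.s := by simp only [s]; omega
  rw [← c_bar_s hn hN, c_mul_bar hn h1 le_rfl, ← mul_assoc, ← Int.cast_mul, sgn_mul_self]
  simp

/-- The sum telescopes: for either sign ε, (q - q⁻¹) times the a-th term is ε(q^{2εP_a} -
q^{2εP_{a-1}}). -/
theorem sum_psum (ε : ℤ) (hε : ε = 1 ∨ ε = -1) (k : ℕ) :
    (qh 2 - qh (-2)) * ∑ a ∈ Finset.Icc 1 k,
      (sgn (D.par a) : K) * qh (2 * ε * (D.psum (a - 1) + D.psum a)) =
        (ε : K) * (qh (4 * ε * D.psum k) - 1) := by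
  induction k with
  | zero => simp [psum_zero, qh_zero]
  | succ k ih =>
    rw [Finset.sum_Icc_succ_top (by omega), mul_add, ih, psum_succ]
    simp only [Nat.add_sub_cancel]
    have h1 : 2 * ε * (D.psum k + (D.psum k + sgn (D.par (k + 1)))) =
      4 * ε * D.psum k + 2 * ε * sgn (D.par (k + 1)) := by ring
    have h2 : 4 * ε * (D.psum k + sgn (D.par (k + 1))) =
      4 * ε * D.psum k + 4 * ε * sgn (D.par (k + 1)) := by ring
    rw [h1, h2, qh_add, qh_add]
    generalize qh (4 * ε * D.psum k) = y
    rcases hε with rfl | rfl <;>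
      rcases zmod_two_cases (D.par (k + 1)) with h | h <;> rw [h] <;>
      simp [sgn_zero, sgn_one, qh] <;> field_simp [X_ne_zero] <;> ring

theorem phi_T {j k : ℕ} (hj : 1 ≤ j ∧ j ≤ m + n) (hk : 1 ≤ k ∧ k ≤ m + n) :
    D.phi (D.T j k) = if k = D.bar j then (sgn (D.par j) : K) * D.c j else 0 :=
  D.constrT_T _ hj hk

theorem phi_w₃ : D.phi D.w₃ =
    ∑ i ∈ Finset.Icc 1 (m + n), (sgn (D.par i) : K) * (D.c i * D.c i) := by
  rw [w₃, map_sum]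
  refine Finset.sum_congr rfl fun i hi => ?_
  rw [Finset.mem_Icc] at hi
  rw [map_smul]
  change D.c i • D.phi (D.T i (D.bar i)) = _
  rw [phi_T hi (bar_range hi), if_pos rfl, smul_eq_mul]
  ring

/-- The squares c_a² with a ≤ s are powers of q with exponent P_{a-1} + P_a up to a shift, and the
squares c_{a'}² = C²/c_a² have the opposite exponents. The two halves telescope with ε = 1 and ε =
-1. -/
theorem phi_w₃_eq (hn : Even n) (hN : 2 < m + n) :
    (qh 2 - qh (-2)) * D.phi D.w₃ = qh (-2 * sgn (D.par 1)) * (qh (2 * ((m : ℤ) - n)) - 1) *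
      (qh 0 + qh (2 * ((m : ℤ) - n) - 4)) := by
  have h1 : 1 ≤ D.s := by simp only [s]; omega
  have hs := psum_s (D := D) hn
  set C : K := qh (2 * ((m : ℤ) - n - 1 - sgn (D.par 1))) with hC
  have hsq : ∀ a ∈ Finset.Icc 1 D.s, (sgn (D.par a) : K) * (D.c a * D.c a) +
      (sgn (D.par (D.bar a)) : K) * (D.c (D.bar a) * D.c (D.bar a)) =
      qh (-2 * sgn (D.par 1)) *
        ((sgn (D.par a) : K) * qh (2 * 1 * (D.psum (a - 1) + D.psum a))) +
      C * C * qh (2 * sgn (D.par 1)) *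
        ((sgn (D.par a) : K) * qh (2 * (-1) * (D.psum (a - 1) + D.psum a))) := by
    intro a ha
    rw [Finset.mem_Icc] at ha
    have ha2 : a ≤ m + n := by have := ha.2; simp only [s] at this; omega
    have e1 := c_mul_self ha.1 ha.2
    have e2 := c_mul_bar hn ha.1 ha.2
    rw [← c_mul_bar hn h1 le_rfl, c_bar_s hn hN, ← hC] at e2
    have e3 : qh (2 * (D.psum (a - 1) + D.psum a - sgn (D.par 1))) =
        qh (-2 * sgn (D.par 1)) * qh (2 * 1 * (D.psum (a - 1) + D.psum a)) := by
      rw [← qh_add]; congr 1; ring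
    -- The explicit inverse of c_a², needed to write c_{a'}² as C² times a power of q.
    have e4 : qh (2 * sgn (D.par 1)) * qh (2 * (-1) * (D.psum (a - 1) + D.psum a)) *
        (D.c a * D.c a) = 1 := by
      rw [e1, ← qh_add, ← qh_add, ← qh_zero]; congr 1; ring
    have hss : (sgn (D.par a) : K) * (sgn (D.par a) : K) = 1 := by
      exact_mod_cast sgn_mul_self (D.par a)
    rw [par_bar ⟨ha.1, ha2⟩]
    have hne : D.c a * D.c a ≠ 0 := by rw [e1]; exact qh_ne_zero _
    have e5 : D.c (D.bar a) * D.c (D.bar a) * (D.c a * D.c a) = C * C := by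
      rw [← e2]
      linear_combination (-(D.c (D.bar a) * D.c (D.bar a) * (D.c a * D.c a))) * hss
    have e6 : D.c (D.bar a) * D.c (D.bar a) =
        C * C * (qh (2 * sgn (D.par 1)) * qh (2 * (-1) * (D.psum (a - 1) + D.psum a))) := by
      apply mul_right_cancel₀ hne
      rw [e5]
      linear_combination (-(C * C)) * e4
    rw [e6, e1, e3]
    ring
  have s1 := sum_psum (D := D) 1 (.inl rfl) D.s
  have s2 := sum_psum (D := D) (-1) (.inr rfl) D.s
  rw [phi_w₃, sum_fold (D := D), Finset.sum_congr rfl hsq, Finset.sum_add_distrib, ← Finset.mul_sum,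
    ← Finset.mul_sum, mul_add, mul_add]
  have hC2 : C * C * qh (2 * sgn (D.par 1)) =
      qh (-2 * sgn (D.par 1)) * (qh (2 * ((m : ℤ) - n)) * qh (2 * ((m : ℤ) - n) - 4)) := by
    rw [hC]; simp only [← qh_add]; congr 1; ring
  rw [mul_left_comm, s1, mul_left_comm (qh 2 - qh (-2)), s2, hC2]
  simp only [Int.cast_one, Int.cast_neg, one_mul, mul_one]
  by_cases he : Even (m + n)
  · rw [if_pos he] at hs ⊢
    have f1 : qh (4 * D.psum D.s) = qh (2 * ((m : ℤ) - n)) := by congr 1; linarith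
    have f2 : qh (2 * ((m : ℤ) - n)) * qh (4 * -1 * D.psum D.s) = 1 := by
      rw [← qh_add, ← qh_zero]; congr 1; linarith
    rw [f1, qh_zero, mul_zero, add_zero]
    linear_combination (-qh (-2 * sgn (D.par 1)) * qh (2 * ((m : ℤ) - n) - 4)) * f2
  · rw [if_neg he] at hs ⊢
    rw [Nat.even_iff] at he
    have hk' : 2 * D.s + 1 = m + n := by simp only [s]; omega
    have hp : D.par (D.s + 1) = 0 := par_middle hn (by omega)
    -- For odd N the middle coefficient is its own partner and contributes a separate square.
    have hc : D.c (D.s + 1) * D.c (D.s + 1) =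
        qh (-2 * sgn (D.par 1)) * qh (2 * ((m : ℤ) - n) - 2) := by
      have hsq' := c_mul_self h1 le_rfl
      have ht := theta_mul_sq (D := D) D.s (D.s + 1)
      have e : qh (-2 * sgn (D.par 1)) * qh (2 * ((m : ℤ) - n) - 2) =
          qh (sgn (D.par D.s)) * qh (sgn (D.par D.s)) *
            qh (2 * (D.psum (D.s - 1) + D.psum D.s - sgn (D.par 1))) := by
        have hps := psum_succ (D := D) (D.s - 1)
        rw [Nat.sub_add_cancel h1] at hps
        rw [← qh_add, ← qh_add, ← qh_add]
        congr 1
        linarith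
      rw [c_middle hn h1 hk', e, ← hsq']
      linear_combination (qh (sgn (D.par D.s)) * qh (sgn (D.par D.s)) * D.c D.s * D.c D.s) * ht
    have f1 : qh (4 * D.psum D.s) = qh (2 * ((m : ℤ) - n) - 2) := by congr 1; linarith
    have f2 : qh (2 * ((m : ℤ) - n)) * qh (4 * -1 * D.psum D.s) = qh 2 := by
      rw [← qh_add]; congr 1; linarith
    have f3 : qh (2 * ((m : ℤ) - n)) = qh 2 * qh (2 * ((m : ℤ) - n) - 2) := by
      rw [← qh_add]; congr 1; ring
    have f4 : qh (2 * ((m : ℤ) - n) - 4) = qh (-2) * qh (2 * ((m : ℤ) - n) - 2) := by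
      rw [← qh_add]; congr 1; ring
    have f5 : qh 2 * qh (-2) = 1 := by rw [← qh_add]; exact qh_zero
    rw [hp, hc, f1, sgn_zero, qh_zero]
    rw [f3] at f2 ⊢
    rw [f4]
    generalize qh (2 * ((m : ℤ) - n) - 2) = y at *
    generalize qh (4 * -1 * D.psum D.s) = w at *
    push_cast
    linear_combination (-qh (-2 * sgn (D.par 1)) * qh (-2) * y) * f2 -
      (qh (-2 * sgn (D.par 1)) * y) * f5

theorem phi_w₃_eq_zero_iff (hn : Even n) (hN : 2 < m + n) : D.phi D.w₃ = 0 ↔ n = m := by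
  have h := phi_w₃_eq (D := D) hn hN
  have h1 : qh 2 - qh (-2) ≠ 0 := by
    rw [sub_ne_zero]
    intro h
    have := qh_injective h
    omega
  constructor
  · intro h0
    rw [h0, mul_zero, eq_comm, mul_eq_zero, mul_eq_zero, sub_eq_zero, qh_eq_one_iff] at h
    rcases h with (h | h) | h
    · exact absurd h (qh_ne_zero _)
    · omega
    · exact absurd h (qh_add_qh_ne_zero _ _)
  · rintro rfl
    simp only [sub_self, mul_zero, qh_zero, zero_mul] at h
    exact (mul_eq_zero.1 h).resolve_left h1

end Data

/-! ### Directness of the sum and the kernel of the form -/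

namespace Data

variable {m n : ℕ} (D : Data m n)

/-- The projection of `V ⊗ V` to the weight space of weight zero. -/
def pi0 : Module.End K D.VV := D.constrT fun j k => if k = D.bar j then D.T j k else 0

variable {D} {α : K}

theorem pi0_T {j k : ℕ} (hj : 1 ≤ j ∧ j ≤ m + n) (hk : 1 ≤ k ∧ k ≤ m + n) :
    D.pi0 (D.T j k) = if k = D.bar j then D.T j k else 0 :=
  D.constrT_T _ hj hk

theorem coord_pi0 (j k : ℕ) (x : D.VV) :
    D.coord j k (D.pi0 x) = if k = D.bar j then D.coord j k x else 0 := by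
  suffices D.coord j k ∘ₗ D.pi0 = if k = D.bar j then D.coord j k else 0 by
    have h := LinearMap.congr_fun this x
    rw [LinearMap.comp_apply] at h
    rw [h]
    split_ifs <;> rfl
  apply D.lin_ext
  intro a b ha hb
  rw [LinearMap.comp_apply, pi0_T ha hb]
  by_cases h : a = j ∧ b = k
  · obtain ⟨rfl, rfl⟩ := h
    split_ifs <;> simp
  · split_ifs <;> simp [coord_T _ _ _ ha hb, h]

theorem pi0_br (r : ℤ) {j : ℕ} (hj : 1 ≤ j ∧ j ≤ m + n) : D.pi0 (D.br α r j) = D.br α r j := by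
  rw [br, map_add, map_smul, pi0_T hj (bar_range hj), pi0_T (bar_range hj) hj, bar_bar hj.2,
    if_pos rfl, if_pos rfl]

theorem Gen.pi0 (hN : 2 < m + n) {x : D.VV} (h : D.Gen α x) : D.pi0 x = 0 ∨ D.pi0 x = x := by
  rcases h with (⟨j, k, h1, h2, h3, h4⟩ | ⟨j, h1, h2, h3⟩ | ⟨a, b, h'⟩ | ⟨a, h'⟩)
  · left
    rw [uPair, map_add, map_smul, pi0_T (by omega) (by omega), pi0_T (by omega) (by omega),
      if_neg (by simp only [bar]; omega), if_neg (by simp only [bar]; omega), smul_zero, add_zero]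
  · left
    rw [map_smul, pi0_T (by omega) (by omega), if_neg (by simp only [bar]; omega), smul_zero]
  · right
    have := h'.bounds
    rw [zz, map_sub, map_smul, pi0_br _ (by omega), pi0_br _ (by omega)]
  · right
    rw [map_smul, pi0_br _ (h'.range hN).1]

theorem pi0_mem (hN : 2 < m + n) {x : D.VV} (h : x ∈ D.Wa α) : D.pi0 x ∈ D.Wa α := by
  suffices D.Wa α ≤ (D.Wa α).comap D.pi0 from this h
  refine Submodule.span_le.2 fun x hx => ?_
  rw [SetLike.mem_coe, Submodule.mem_comap]
  rcases hx.pi0 hN with h | h <;> rw [h]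
  exacts [zero_mem _, hx.mem]

theorem Singular.pi0_eq (hn : Even n) (hN : 2 < m + n) {x : D.VV} (hx : D.Singular x) :
    D.pi0 x = D.coord 1 (D.bar 1) x • D.w₃ := by
  refine D.ext_coord fun j k hj hk => ?_
  rw [coord_pi0, map_smul, coord_w₃ hj, smul_eq_mul]
  split_ifs with h
  · rw [h, hx.coord_eq hn hN hj]
  · rw [mul_zero]

theorem pi0_w₃ (hn : Even n) (hN : 2 < m + n) : D.pi0 D.w₃ = D.w₃ := by
  rw [(singular_w₃ hn hN).pi0_eq hn hN, coord_w₃ (by omega), if_pos rfl, c_one, one_smul]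

theorem phi_pi0 (x : D.VV) : D.phi (D.pi0 x) = D.phi x := by
  suffices D.phi ∘ₗ D.pi0 = D.phi from LinearMap.congr_fun this x
  apply D.lin_ext
  intro a b ha hb
  rw [LinearMap.comp_apply, pi0_T ha hb, phi_T ha hb]
  split_ifs with h
  · rw [phi_T ha hb, if_pos h]
  · rw [map_zero]

theorem Wa_le_ker {M : Type*} [AddCommGroup M] [Module K M] (f : D.VV →ₗ[K] M)
    (h : ∀ x, D.Gen α x → f x = 0) {x : D.VV} (hx : x ∈ D.Wa α) : f x = 0 := by
  suffices D.Wa α ≤ LinearMap.ker f from this hx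
  exact Submodule.span_le.2 fun x hx => h x hx

theorem coord_br_of_ne (r : ℤ) {l j k : ℕ} (hl : 1 ≤ l ∧ l ≤ m + n) (h : j + k ≠ m + n + 1) :
    D.coord j k (D.br α r l) = 0 := by
  rw [br, map_add, map_smul, coord_T _ _ _ hl (bar_range hl), coord_T _ _ _ (bar_range hl) hl,
    if_neg (by simp only [bar]; omega), if_neg (by simp only [bar]; omega), smul_zero, add_zero]

/-- Among the spanning vectors only u_{jk} meets the positions (j, k) and (k, j), so its ratio of
coefficients holds throughout W. -/
theorem Wa_coord_swap (hN : 2 < m + n) {x : D.VV} (hx : x ∈ D.Wa α) {j k : ℕ} (h1 : 1 ≤ j)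
    (h2 : j < k) (h3 : k ≤ m + n) (h4 : j + k ≠ m + n + 1) :
    D.coord k j x = α * (sgn (D.par j * D.par k) : K) * D.coord j k x := by
  have h := Wa_le_ker (D.coord k j - (α * (sgn (D.par j * D.par k) : K)) • D.coord j k) ?_ hx
  · exact sub_eq_zero.1 h
  rintro _ (⟨a, b, g1, g2, g3, g4⟩ | ⟨a, g1, g2, g3⟩ | ⟨a, b, h'⟩ | ⟨a, h'⟩) <;>
    rw [LinearMap.sub_apply, LinearMap.smul_apply]
  · rw [uPair, map_add, map_add, map_smul, map_smul, coord_T _ _ _ (by omega) (by omega),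
      coord_T _ _ _ (by omega) (by omega), coord_T _ _ _ (by omega) (by omega),
      coord_T _ _ _ (by omega) (by omega), if_neg (by omega),
      if_neg (c := b = j ∧ a = k) (by omega)]
    by_cases h : a = j ∧ b = k
    · obtain ⟨rfl, rfl⟩ := h
      simp
    · rw [if_neg h, if_neg (by tauto)]; simp
  · rw [map_smul, map_smul, coord_T _ _ _ (by omega) (by omega),
      coord_T _ _ _ (by omega) (by omega), if_neg (by omega), if_neg (by omega)]
    simp
  · have := h'.bounds
    simp only [zz, map_sub, map_smul, coord_br_of_ne _ (show 1 ≤ a ∧ a ≤ m + n by omega) h4,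
      coord_br_of_ne _ (show 1 ≤ b ∧ b ≤ m + n by omega) h4,
      coord_br_of_ne _ (show 1 ≤ a ∧ a ≤ m + n by omega) (show k + j ≠ m + n + 1 by omega),
      coord_br_of_ne _ (show 1 ≤ b ∧ b ≤ m + n by omega) (show k + j ≠ m + n + 1 by omega)]
    simp
  · rw [map_smul, map_smul, coord_br_of_ne _ (h'.range hN).1 h4,
      coord_br_of_ne _ (h'.range hN).1 (by omega)]
    simp

theorem Wa_coord_diag (hN : 2 < m + n) {x : D.VV} (hx : x ∈ D.Wa α) {j : ℕ}
    (h : 2 * j ≠ m + n + 1) (hf : fac α (D.par j) = 0) : D.coord j j x = 0 := by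
  refine Wa_le_ker _ ?_ hx
  rintro _ (⟨a, b, g1, g2, g3, g4⟩ | ⟨a, g1, g2, g3⟩ | ⟨a, b, h'⟩ | ⟨a, h'⟩)
  · rw [uPair, map_add, map_smul, coord_T _ _ _ (by omega) (by omega),
      coord_T _ _ _ (by omega) (by omega), if_neg (by omega), if_neg (by omega), smul_zero,
      add_zero]
  · rw [map_smul, coord_T _ _ _ (by omega) (by omega)]
    split_ifs with h
    · rw [h.1, hf, zero_smul]
    · rw [smul_zero]
  · have := h'.bounds
    rw [zz, map_sub, map_smul, coord_br_of_ne _ (by omega) (by omega),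
      coord_br_of_ne _ (by omega) (by omega), smul_zero, sub_zero]
  · rw [map_smul, coord_br_of_ne _ (h'.range hN).1 (by omega), smul_zero]

/-- A consequence of the two relations of the recursion for c, one for each half of the braces;
hence no condition on α is needed. -/
theorem Node.phi_zz (hn : Even n) (hN : 2 < m + n) {a b : ℕ} (h : D.Node a b) :
    D.phi (D.zz α a b) = 0 := by
  have hb := h.bounds
  have ha1 : 1 ≤ a ∧ a ≤ m + n := by omega
  have hb1 : 1 ≤ b ∧ b ≤ m + n := by omega
  obtain ⟨r1, r2⟩ := (rec_c hn hN).1 a b h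
  rw [zz, br, br, map_sub, map_smul, map_add, map_add, map_smul, map_smul,
    phi_T ha1 (bar_range ha1), phi_T hb1 (bar_range hb1), phi_T (bar_range ha1) ha1,
    phi_T (bar_range hb1) hb1,
    bar_bar ha1.2, bar_bar hb1.2, if_pos rfl, if_pos rfl, if_pos rfl, if_pos rfl, par_bar ha1,
    par_bar hb1, r1, r2, eps_self a (by omega)]
  have e1 : qh (2 * -1 * sgn (D.par a)) = qh (-sgn (D.par a)) * qh (-sgn (D.par a)) := by
    rw [← qh_add]; congr 1; ring
  have e2 : qh (2 * 1 * D.eps b b) = qh (D.eps b b) * qh (D.eps b b) := by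
    rw [← qh_add]; congr 1; ring
  rw [e1, e2, qh_add, qh_neg, qh_neg]
  have n1 := qh_ne_zero (sgn (D.par a))
  have n2 := qh_ne_zero (D.eps b b)
  generalize qh (sgn (D.par a)) = u at n1 ⊢
  generalize qh (D.eps b b) = w at n2 ⊢
  rcases zmod_two_cases (D.par a) with hpa | hpa <;>
    rcases zmod_two_cases (D.par b) with hpb | hpb <;>
    rcases Int.units_eq_one_or (D.theta a) with hta | hta <;>
    rcases Int.units_eq_one_or (D.theta b) with htb | htb <;>
    simp [hpa, hpb, hta, htb, sgn_zero, sgn_one, zmod_one_add_one] <;>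
    field_simp <;> ring

theorem phi_eq_zero (hn : Even n) (hN : 2 < m + n) (hα : α = qh (-2) ∨ α = -qh 2) {x : D.VV}
    (hx : x ∈ D.Wa α) : D.phi x = 0 := by
  refine Wa_le_ker _ ?_ hx
  rintro _ (⟨a, b, g1, g2, g3, g4⟩ | ⟨a, g1, g2, g3⟩ | ⟨a, b, h⟩ | ⟨a, h⟩)
  · rw [uPair, map_add, map_smul, phi_T (by omega) (by omega), phi_T (by omega) (by omega),
      if_neg (by simp only [bar]; omega), if_neg (by simp only [bar]; omega), smul_zero, add_zero]
  · rw [map_smul, phi_T (by omega) (by omega), if_neg (by simp only [bar]; omega), smul_zero]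
  · exact h.phi_zz hn hN
  · obtain ⟨ha, ha'⟩ := h.range hN
    have h1 := h.1
    rw [map_smul, br, map_add, map_smul, phi_T ha ha', phi_T ha' ha, bar_bar ha.2, if_pos rfl,
      if_pos rfl, par_bar ha, h.2, (rec_c hn hN).2 a h, eps_self a (by omega), h.2]
    -- For α = q⁻¹ the vector is zero. For α = -q the brace is v_a ⊗ v_{a'} + q² v_{a'} ⊗ v_a, and
    -- the values of φ cancel because c_{a'} = -q⁻² c_a.
    rcases hα with rfl | rfl
    · rw [(fac_eq_zero_iff_pos 1).2 rfl, zero_smul]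
    · rw [sgn_one]
      have e : qh 2 * qh (-4) * qh 2 = 1 := by
        rw [← qh_add, ← qh_add]; exact qh_zero
      rw [show (2 * -1 * -1 : ℤ) = 2 by rfl]
      simp only [smul_eq_mul]
      push_cast
      linear_combination (fac (-qh 2) 1 * D.c a) * e

/-- The outermost two coordinates of weight zero are proportional on `W`. -/
theorem coord_last (hN : 2 < m + n) {x : D.VV} (hx : x ∈ D.Wa α) :
    D.coord (D.bar 1) 1 x =
      α * (sgn (D.par 1) : K) * qh (-2 * sgn (D.par 1)) * D.coord 1 (D.bar 1) x := by
  have h := Wa_le_ker (D.coord (D.bar 1) 1 -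
    (α * (sgn (D.par 1) : K) * qh (-2 * sgn (D.par 1))) • D.coord 1 (D.bar 1)) ?_ hx
  · exact sub_eq_zero.1 h
  have h1 : 1 ≤ 1 ∧ 1 ≤ m + n := by omega
  have hb1 : D.bar 1 = m + n := by simp only [bar]; omega
  -- The outermost positions meet only the brace at index 1, which occurs in z_{1b} and always with
  -- r = -1.
  have hbr : ∀ r l, 1 < l → l < m + n → D.coord (D.bar 1) 1 (D.br α r l) = 0 ∧
      D.coord 1 (D.bar 1) (D.br α r l) = 0 := by
    intro r l h2 h3
    have hl : 1 ≤ l ∧ l ≤ m + n := by omega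
    have hl' := bar_range (D := D) hl
    rw [br, map_add, map_add, map_smul, map_smul, coord_T _ _ _ hl hl', coord_T _ _ _ hl' hl,
      coord_T _ _ _ hl hl', coord_T _ _ _ hl' hl, hb1, if_neg (by omega), if_neg (by omega),
      if_neg (by omega), if_neg (by omega)]
    simp
  rintro _ (⟨a, b, g1, g2, g3, g4⟩ | ⟨a, g1, g2, g3⟩ | ⟨a, b, h⟩ | ⟨a, h⟩) <;>
    rw [LinearMap.sub_apply, LinearMap.smul_apply]
  · rw [uPair, map_add, map_add, map_smul, map_smul, coord_T _ _ _ (by omega) (by omega),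
      coord_T _ _ _ (by omega) (by omega), coord_T _ _ _ (by omega) (by omega),
      coord_T _ _ _ (by omega) (by omega), hb1, if_neg (by omega), if_neg (by omega),
      if_neg (by omega), if_neg (by omega)]
    simp
  · rw [map_smul, map_smul, coord_T _ _ _ (by omega) (by omega),
      coord_T _ _ _ (by omega) (by omega), hb1, if_neg (by omega), if_neg (by omega)]
    simp
  · have := h.bounds
    rw [zz, map_sub, map_sub, map_smul, map_smul, (hbr 1 b (by omega) (by omega)).1,
      (hbr 1 b (by omega) (by omega)).2]
    by_cases h2 : a = 1
    · subst h2
      rw [br, map_add, map_add, map_smul, map_smul, coord_T _ _ _ h1 (bar_range h1),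
        coord_T _ _ _ (bar_range h1) h1, coord_T _ _ _ h1 (bar_range h1),
        coord_T _ _ _ (bar_range h1) h1, eps_self _ (by omega), hb1]
      simp [show (1 : ℕ) ≠ m + n by omega]
    · rw [(hbr _ a (by omega) (by omega)).1, (hbr _ a (by omega) (by omega)).2]
      simp
  · have := h.1
    rw [map_smul, map_smul, (hbr _ a (by omega) (by omega)).1, (hbr _ a (by omega) (by omega)).2]
    simp

/-- On `Wa (-q)` the last weight zero coordinate is -(-1)^{|v_1|} times a power of q when the first
is 1, whereas for w_3 it is (-1)^{|v_1|} times a power of q. Equality would make a sum of two powers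
of q vanish. -/
theorem w₃_notMem (hn : Even n) (hN : 2 < m + n) : D.w₃ ∉ D.Wa (-qh 2) := by
  intro h
  have h1 : 1 ≤ 1 ∧ 1 ≤ m + n := by omega
  have := coord_last hN h
  rw [coord_w₃ (bar_range h1), coord_w₃ h1, bar_bar h1.2, if_pos rfl, if_pos rfl, c_one,
    c_last hn hN] at this
  have h2 : (sgn (D.par 1) : K) * (qh (2 * ((m : ℤ) - n - 1 - sgn (D.par 1))) +
      qh (2 - 2 * sgn (D.par 1))) = 0 := by
    rw [sub_eq_add_neg (2 : ℤ), ← neg_mul, qh_add 2]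
    linear_combination this
  exact (mul_ne_zero (sgn_ne_zero _) (qh_add_qh_ne_zero _ _)) h2

theorem w₃_ne_zero (hN : 2 < m + n) : D.w₃ ≠ 0 := by
  intro h
  have h1 : 1 ≤ 1 ∧ 1 ≤ m + n := by omega
  have := coord_w₃ (D := D) h1 (D.bar 1)
  rw [h, map_zero, if_pos rfl, c_one] at this
  exact zero_ne_one this

theorem alpha_sub_ne_zero : qh (-2) - -qh 2 ≠ 0 := by
  rw [sub_neg_eq_add]; exact qh_add_qh_ne_zero _ _

/-- Only the coordinates of weight zero of a vector in both subspaces can be nonzero. -/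
theorem coord_eq_zero_of_mem (hN : 2 < m + n) {x : D.VV} (h1 : x ∈ D.Wa (qh (-2)))
    (h2 : x ∈ D.Wa (-qh 2)) {j k : ℕ} (hj : 1 ≤ j ∧ j ≤ m + n) (hk : 1 ≤ k ∧ k ≤ m + n)
    (h : j + k ≠ m + n + 1) : D.coord j k x = 0 := by
  have key : ∀ j k, 1 ≤ j → j < k → k ≤ m + n → j + k ≠ m + n + 1 → D.coord j k x = 0 := by
    intro j k g1 g2 g3 g4
    have e1 := Wa_coord_swap hN h1 g1 g2 g3 g4
    have e2 := Wa_coord_swap hN h2 g1 g2 g3 g4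
    have e3 : (qh (-2) - -qh 2) * ((sgn (D.par j * D.par k) : K) * D.coord j k x) = 0 := by
      linear_combination e2 - e1
    exact ((mul_eq_zero.1 ((mul_eq_zero.1 e3).resolve_left alpha_sub_ne_zero)).resolve_left
      (sgn_ne_zero _))
  rcases lt_trichotomy j k with h' | rfl | h'
  · exact key j k hj.1 h' hk.2 h
  · rcases zmod_two_cases (D.par j) with hp | hp
    · exact Wa_coord_diag hN h2 (by omega) ((fac_eq_zero_iff_neg _).2 hp)
    · exact Wa_coord_diag hN h1 (by omega) ((fac_eq_zero_iff_pos _).2 hp)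
  · rw [Wa_coord_swap hN h1 hk.1 h' hj.2 (by omega), key k j hk.1 h' hj.2 (by omega), mul_zero]

/-- A vector in the intersection has only weight zero coordinates. Its image under a raising
operator is again in the intersection but has no weight zero coordinate, so it is 0. The vector is
then singular, hence a multiple of w_3, which `w₃_notMem` excludes unless it is 0. -/
theorem disjoint_Wa (hn : Even n) (hN : 2 < m + n) : Disjoint (D.Wa (qh (-2))) (D.Wa (-qh 2)) := by
  rw [Submodule.disjoint_def]
  intro x h1 h2
  have hx : D.Singular x := by
    refine ⟨fun a b h => D.ext_coord fun j k hj hk => ?_,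
      fun a h => D.ext_coord fun j k hj hk => ?_⟩ <;> rw [map_zero]
    -- A weight zero coordinate of the image comes from coordinates of x of nonzero weight, which
    -- vanish; any other vanishes because the image is in both spaces.
    · by_cases hjk : j + k = m + n + 1
      · have hb := h.bounds
        have ha1 : 1 ≤ a ∧ a ≤ m + n := by omega
        have hb1 : 1 ≤ b ∧ b ≤ m + n := by omega
        have ha2 := bar_range (D := D) ha1
        have z1 : k = a → D.coord j b x = 0 := fun e =>
          coord_eq_zero_of_mem hN h1 h2 hj hb1 (by omega)
        have z2 : k = D.bar b → D.coord j (D.bar a) x = 0 := fun e =>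
          coord_eq_zero_of_mem hN h1 h2 hj ha2 (by simp only [bar] at *; omega)
        have z3 : j = a → D.coord b k x = 0 := fun e =>
          coord_eq_zero_of_mem hN h1 h2 hb1 hk (by omega)
        have z4 : j = D.bar b → D.coord (D.bar a) k x = 0 := fun e =>
          coord_eq_zero_of_mem hN h1 h2 ha2 hk (by simp only [bar] at *; omega)
        rw [coord_nodeE h]
        simp +contextual [z1, z2, z3, z4]
      · exact coord_eq_zero_of_mem hN (h.nodeE_mem hn (.inl rfl) h1) (h.nodeE_mem hn (.inr rfl) h2)
          hj hk hjk
    · by_cases hjk : j + k = m + n + 1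
      · have ha := h.range hN
        have z1 : k = a → D.coord j (D.bar a) x = 0 := fun e =>
          coord_eq_zero_of_mem hN h1 h2 hj ha.2 (by simp only [bar] at *; have := h.1; omega)
        have z2 : j = a → D.coord (D.bar a) k x = 0 := fun e =>
          coord_eq_zero_of_mem hN h1 h2 ha.2 hk (by simp only [bar] at *; have := h.1; omega)
        rw [coord_longE h hN]
        simp +contextual [z1, z2]
      · exact coord_eq_zero_of_mem hN (h.longE_mem hN (.inl rfl) h1) (h.longE_mem hN (.inr rfl) h2)
          hj hk hjk
  have h0 : D.pi0 x = x := by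
    refine D.ext_coord fun j k hj hk => ?_
    rw [coord_pi0]
    split_ifs with h
    · rfl
    · exact (coord_eq_zero_of_mem hN h1 h2 hj hk (by simp only [bar] at h; omega)).symm
  rw [hx.pi0_eq hn hN] at h0
  by_cases ht : D.coord 1 (D.bar 1) x = 0
  · rw [← h0, ht, zero_smul]
  · rw [← h0] at h2
    exact absurd ((Submodule.smul_mem_iff _ ht).1 h2) (w₃_notMem hn hN)

theorem mem_of_two_combinations {Q : Submodule K D.VV} {A B : D.VV} (h1 : A + qh (-2) • B ∈ Q)
    (h2 : A + (-qh 2) • B ∈ Q) : A ∈ Q ∧ B ∈ Q := by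
  have hB : B ∈ Q := by
    have := Q.sub_mem h1 h2
    rw [add_sub_add_left_eq_sub, ← sub_smul] at this
    exact (Submodule.smul_mem_iff _ alpha_sub_ne_zero).1 this
  exact ⟨by simpa using Q.sub_mem h1 (Q.smul_mem (qh (-2)) hB), hB⟩

/-- Each spanning vector has the form A + αB; having it for two values of α separates A from B. In
weight zero this links v_a ⊗ v_{a'} with v_b ⊗ v_{b'} along every node, so v_1 ⊗ v_{1'} yields all
the others. -/
theorem sup_Wa_sup_span (hN : 2 < m + n) :
    D.Wa (qh (-2)) ⊔ D.Wa (-qh 2) ⊔ Submodule.span K {D.T 1 (D.bar 1)} = ⊤ := by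
  set Q := D.Wa (qh (-2)) ⊔ D.Wa (-qh 2) ⊔ Submodule.span K {D.T 1 (D.bar 1)} with hQ
  have q1 : ∀ x, D.Gen (qh (-2)) x → x ∈ Q := fun x hx =>
    Submodule.mem_sup_left (Submodule.mem_sup_left hx.mem)
  have q2 : ∀ x, D.Gen (-qh 2) x → x ∈ Q := fun x hx =>
    Submodule.mem_sup_left (Submodule.mem_sup_right hx.mem)
  have hzz : ∀ a b, D.Node a b → ∃ c d e : K, D.T a (D.bar a) - c • D.T b (D.bar b) ∈ Q ∧
      d ≠ 0 ∧ e ≠ 0 ∧ d • D.T (D.bar a) a - e • D.T (D.bar b) b ∈ Q ∧ c ≠ 0 := by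
    intro a b h
    refine ⟨((sgn (D.par a + D.par b) * D.theta a * D.theta b : ℤ) : K) *
      qh (-D.eps a a) * qh (-D.eps b b), (sgn (D.par a) : K) * qh (2 * (-1) * D.eps a a),
      ((sgn (D.par a + D.par b) * D.theta a * D.theta b : ℤ) : K) *
      qh (-D.eps a a) * qh (-D.eps b b) * ((sgn (D.par b) : K) * qh (2 * 1 * D.eps b b)), ?_⟩
    have hc : ((sgn (D.par a + D.par b) * D.theta a * D.theta b : ℤ) : K) *
      qh (-D.eps a a) * qh (-D.eps b b) ≠ 0 :=
        mul_ne_zero (mul_ne_zero (sgn_theta_ne_zero _ _ _) (qh_ne_zero _)) (qh_ne_zero _)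
    have h1 := q1 _ (.zero a b h)
    have h2 := q2 _ (.zero a b h)
    have key := mem_of_two_combinations (Q := Q) (A := D.T a (D.bar a) -
      (((sgn (D.par a + D.par b) * D.theta a * D.theta b : ℤ) : K) *
      qh (-D.eps a a) * qh (-D.eps b b)) • D.T b (D.bar b))
      (B := ((sgn (D.par a) : K) * qh (2 * (-1) * D.eps a a)) • D.T (D.bar a) a -
      (((sgn (D.par a + D.par b) * D.theta a * D.theta b : ℤ) : K) *
      qh (-D.eps a a) * qh (-D.eps b b) * ((sgn (D.par b) : K) * qh (2 * 1 * D.eps b b))) •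
        D.T (D.bar b) b) (by convert h1 using 1; rw [zz, br, br]; module)
        (by convert h2 using 1; rw [zz, br, br]; module)
    exact ⟨key.1, mul_ne_zero (sgn_ne_zero _) (qh_ne_zero _), mul_ne_zero hc (mul_ne_zero
      (sgn_ne_zero _) (qh_ne_zero _)), key.2, hc⟩
  have hbar : ∀ l, 1 ≤ l ∧ l ≤ m + n → D.T l (D.bar l) ∈ Q := by
    intro l hl
    induction l using Nat.strong_induction_on with
    | _ l ih =>
      rcases hl.1.eq_or_lt with rfl | h2
      · exact Submodule.mem_sup_right (Submodule.mem_span_singleton_self _)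
      · rcases exists_source (D := D) hN h2 hl.2 with ⟨a, b, hab, rfl | rfl⟩ | ⟨a, ha, rfl⟩
        · have := hab.bounds
          obtain ⟨c, d, e, h1, -, -, -, hc⟩ := hzz a l hab
          have h3 := Q.sub_mem (ih a (by omega) (by omega)) h1
          rw [sub_sub_cancel] at h3
          exact (Submodule.smul_mem_iff _ hc).1 h3
        · have := hab.bounds
          obtain ⟨c, d, e, -, hd, he, h1, -⟩ := hzz a b hab
          have h3 := Q.smul_mem e (ih (D.bar b) (by simp only [bar]; omega)
            (by simp only [bar]; omega))
          rw [bar_bar (by omega)] at h3 ⊢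
          have h4 := Q.add_mem h1 h3
          rw [sub_add_cancel] at h4
          exact (Submodule.smul_mem_iff _ hd).1 h4
        · have h3 := ha.1
          have h4 := ih a (by simp only [bar]; omega) (by omega)
          -- The long node links v_a ⊗ v_{a'} with v_{a'} ⊗ v_a, joining the first half of the chain
          -- to the second; only α = -q has a nonzero vector here.
          have h5 := q2 _ (.long a ha)
          rw [Submodule.smul_mem_iff _ (by rw [Ne, fac_eq_zero_iff_neg]; decide), br] at h5
          have h6 := Q.sub_mem h5 h4
          rw [add_sub_cancel_left, Submodule.smul_mem_iff] at h6
          · rwa [bar_bar (by omega)]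
          · exact mul_ne_zero (mul_ne_zero (neg_ne_zero.2 (qh_ne_zero _)) (sgn_ne_zero _))
              (qh_ne_zero _)
  have hpair : ∀ j k, 1 ≤ j → j < k → k ≤ m + n → j + k ≠ m + n + 1 →
      D.T j k ∈ Q ∧ D.T k j ∈ Q := by
    intro j k g1 g2 g3 g4
    have h1 := q1 _ (.pair j k g1 g2 g3 g4)
    have h2 := q2 _ (.pair j k g1 g2 g3 g4)
    rw [uPair, mul_smul] at h1 h2
    have := mem_of_two_combinations h1 h2
    exact ⟨this.1, (Submodule.smul_mem_iff _ (sgn_ne_zero _)).1 this.2⟩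
  refine D.span_T_eq_top fun j k hj hk => ?_
  by_cases hjk : j + k = m + n + 1
  · rw [show k = D.bar j by simp only [bar]; omega]
    exact hbar j hj
  rcases lt_trichotomy j k with h' | rfl | h'
  · exact (hpair j k hj.1 h' hk.2 hjk).1
  · rcases zmod_two_cases (D.par j) with hp | hp
    · have := q1 _ (.diag j hj.1 hj.2 (by omega))
      rwa [Submodule.smul_mem_iff] at this
      rw [Ne, fac_eq_zero_iff_pos, hp]; decide
    · have := q2 _ (.diag j hj.1 hj.2 (by omega))
      rwa [Submodule.smul_mem_iff] at this
      rw [Ne, fac_eq_zero_iff_neg, hp]; decide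
  · exact (hpair k j hk.1 h' hj.2 (by omega)).2

theorem phi_T_one (hN : 2 < m + n) : D.phi (D.T 1 (D.bar 1)) = (sgn (D.par 1) : K) := by
  have h1 : 1 ≤ 1 ∧ 1 ≤ m + n := by omega
  rw [phi_T h1 (bar_range h1), if_pos rfl, c_one, mul_one]

/-- Both spaces lie in the kernel, their sum misses at most the line of v_1 ⊗ v_{1'}, and φ is
nonzero on that line. -/
theorem ker_phi (hn : Even n) (hN : 2 < m + n) :
    LinearMap.ker D.phi = D.Wa (qh (-2)) ⊔ D.Wa (-qh 2) := by
  have hle : D.Wa (qh (-2)) ⊔ D.Wa (-qh 2) ≤ LinearMap.ker D.phi :=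
    sup_le (fun x hx => phi_eq_zero hn hN (.inl rfl) hx) fun x hx => phi_eq_zero hn hN (.inr rfl) hx
  refine le_antisymm (fun x hx => ?_) hle
  have hx' : x ∈ D.Wa (qh (-2)) ⊔ D.Wa (-qh 2) ⊔ Submodule.span K {D.T 1 (D.bar 1)} := by
    rw [sup_Wa_sup_span hN]; trivial
  obtain ⟨y, hy, z, hz, rfl⟩ := Submodule.mem_sup.1 hx'
  obtain ⟨t, rfl⟩ := Submodule.mem_span_singleton.1 hz
  have hy0 : D.phi y = 0 := hle hy
  rw [LinearMap.mem_ker, map_add, hy0, zero_add, map_smul, phi_T_one hN, smul_eq_mul] at hx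
  rw [(mul_eq_zero.1 hx).resolve_right (sgn_ne_zero _), zero_smul, add_zero]
  exact hy

theorem phi_surjective (hN : 2 < m + n) : Function.Surjective D.phi := by
  intro t
  refine ⟨(t * (sgn (D.par 1) : K)⁻¹) • D.T 1 (D.bar 1), ?_⟩
  rw [map_smul, phi_T_one hN, smul_eq_mul, inv_mul_cancel_right₀ (sgn_ne_zero _)]

theorem finrank_quotient (hn : Even n) (hN : 2 < m + n) :
    Module.finrank K (D.VV ⧸ (D.Wa (qh (-2)) ⊔ D.Wa (-qh 2))) = 1 := by
  rw [← ker_phi hn hN, (D.phi.quotKerEquivOfSurjective (phi_surjective hN)).finrank_eq,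
    Module.finrank_self]

theorem Singular.add_right {x y : D.VV} (hx : D.Singular x) (hxy : D.Singular (x + y)) :
    D.Singular y := by
  refine ⟨fun a b h => ?_, fun a h => ?_⟩
  · simpa [hx.1 a b h] using hxy.1 a b h
  · simpa [hx.2 a h] using hxy.2 a h

/-- Both spaces are stable and their sum is direct, so the image of a sum vanishes only if both
parts do. -/
theorem Singular.of_add (hn : Even n) (hN : 2 < m + n) {x y : D.VV} (hx : x ∈ D.Wa (qh (-2)))
    (hy : y ∈ D.Wa (-qh 2)) (h : D.Singular (x + y)) : D.Singular x ∧ D.Singular y := by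
  have key : ∀ u v : D.VV, u ∈ D.Wa (qh (-2)) → v ∈ D.Wa (-qh 2) → u + v = 0 → u = 0 := by
    intro u v hu hv huv
    refine (Submodule.disjoint_def.1 (disjoint_Wa hn hN)) u hu ?_
    rw [eq_neg_of_add_eq_zero_left huv]
    exact neg_mem hv
  have hsx : D.Singular x := by
    refine ⟨fun a b hab => ?_, fun a ha => ?_⟩
    · exact key _ _ (hab.nodeE_mem hn (.inl rfl) hx) (hab.nodeE_mem hn (.inr rfl) hy)
        (by rw [← map_add, h.1 a b hab])
    · exact key _ _ (ha.longE_mem hN (.inl rfl) hx) (ha.longE_mem hN (.inr rfl) hy)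
        (by rw [← map_add, h.2 a ha])
  exact ⟨hsx, hsx.add_right h⟩

/-- As φ(w_3) = 0, one has w_3 = x + y with x and y singular. The weight zero part of y is a
multiple of w_3 inside `Wa (-q)`, hence 0, so w_3 is the weight zero part of x. -/
theorem w₃_mem (hn : Even n) (hN : 2 < m + n) (h : n = m) : D.w₃ ∈ D.Wa (qh (-2)) := by
  have h0 : D.w₃ ∈ LinearMap.ker D.phi := (phi_w₃_eq_zero_iff hn hN).2 h
  rw [ker_phi hn hN] at h0
  obtain ⟨x, hx, y, hy, hxy⟩ := Submodule.mem_sup.1 h0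
  obtain ⟨-, sy⟩ := Singular.of_add hn hN hx hy (by rw [hxy]; exact singular_w₃ hn hN)
  have hy0 := pi0_mem hN hy
  have hpy : D.pi0 y = 0 := by
    rw [sy.pi0_eq hn hN] at hy0 ⊢
    by_cases ht : D.coord 1 (D.bar 1) y = 0
    · rw [ht, zero_smul]
    · exact absurd ((Submodule.smul_mem_iff _ ht).1 hy0) (w₃_notMem hn hN)
  rw [← pi0_w₃ hn hN, ← hxy, map_add, hpy, add_zero]
  exact pi0_mem hN hx

end Data

/-! ### Generation of W from its lowest weight vector -/

theorem qh_four_add_two_add_one : qh 4 + qh 2 + 1 ≠ 0 := by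
  intro h
  have h1 : qh 6 = 1 := by
    have e : qh 6 = qh 2 * qh 4 := (qh_add 2 4)
    have e2 : qh 4 = qh 2 * qh 2 := (qh_add 2 2)
    linear_combination e + (qh 2 - 1) * h - (-(1 : K)) * e2
  rw [qh_eq_one_iff] at h1
  omega

theorem qh_four_sub_two_add_one : qh 4 - qh 2 + 1 ≠ 0 := by
  intro h
  have h1 : qh 6 = -1 := by
    have e : qh 6 = qh 2 * qh 4 := (qh_add 2 4)
    have e2 : qh 4 = qh 2 * qh 2 := (qh_add 2 2)
    linear_combination e + (qh 2 + 1) * h - e2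
  exact qh_ne_neg_one _ h1

namespace Data

variable {m n : ℕ} {D : Data m n} {α : K}

/-- A subspace stable under all raising operators. -/
def IsRaisingStable (D : Data m n) (M : Submodule K D.VV) : Prop :=
  (∀ a b, D.Node a b → ∀ x ∈ M, D.nodeE a b x ∈ M) ∧ ∀ a, D.Long a → ∀ x ∈ M, D.longE a x ∈ M

/-- The exceptional cases, in which `W` is not generated by its lowest weight vector. -/
def Exceptional (D : Data m n) (α : K) : Prop :=
  m + n = 4 ∧ ((D.par 1 ≠ D.par 2 ∧ α = qh (-2)) ∨ (D.par 1 = 0 ∧ D.par 2 = 0 ∧ α = -qh 2))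

theorem mem_of_smul_eq {M : Submodule K D.VV} {x y : D.VV} {c : K} (hc : c ≠ 0) (h : y = c • x)
    (hy : y ∈ M) : x ∈ M := by
  rw [h] at hy
  exact (Submodule.smul_mem_iff _ hc).1 hy

theorem kap_ne_zero (a b : ℕ) : D.kap a b ≠ 0 := sgn_theta_ne_zero _ _ _

theorem neg_theta_ne_zero (a b : ℕ) : -((D.theta a * D.theta b : ℤ) : K) ≠ 0 := by
  rcases Int.units_eq_one_or (D.theta a) with h | h <;>
    rcases Int.units_eq_one_or (D.theta b) with h' | h' <;> simp [h, h']

/-- Up to sign and a power of q^{1/2}, the four values are q² + q + 1, 1, 1 and q² - q + 1. -/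
theorem zz_middle_coeff_ne_zero (hα : α = qh (-2) ∨ α = -qh 2) (p : ZMod 2) :
    qh (sgn p) + (sgn p : K) * (1 + α) * qh (-sgn p) ≠ 0 := by
  have e : ∀ a b c, a + b = c → qh a * qh b = qh c := by rintro a b c rfl; exact (qh_add a b).symm
  rcases zmod_two_cases p with rfl | rfl <;> rcases hα with rfl | rfl <;>
    simp only [sgn_zero, sgn_one, Int.cast_one, Int.cast_neg, neg_neg]
  · intro h
    apply mul_ne_zero (qh_ne_zero (-3)) qh_four_add_two_add_one
    linear_combination h + e (-3) 4 1 rfl + e (-3) 2 (-1) rfl - e (-2) (-1) (-3) rfl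
  · intro h
    apply qh_ne_zero (-1)
    linear_combination h + e 2 (-1) 1 rfl
  · intro h
    apply qh_ne_zero 1
    linear_combination -h - e (-2) 1 (-1) rfl
  · intro h
    apply mul_ne_zero (qh_ne_zero (-1)) qh_four_sub_two_add_one
    linear_combination h + e (-1) 4 3 rfl - e (-1) 2 1 rfl - e 2 1 3 rfl

theorem zz_bar_coeff_ne_zero {p : ZMod 2} (hα : α = -qh 2) (hp : p = 1) :
    qh (sgn p) + (sgn p : K) * α * qh (-sgn p) ≠ 0 := by
  subst hα hp
  rw [sgn_one]
  have := qh_add_qh_ne_zero (-1) 3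
  have e : qh 3 = qh 2 * qh 1 := qh_add 2 1
  rw [e] at this
  simpa using this

theorem Node.eq_add (h : D.Node a b) : b = a + 1 ∨
    (b = a + 2 ∧ 2 * a + 2 = m + n ∧ D.par (a + 1) = 0) := by
  rcases h with ⟨-, h | h⟩
  · exact .inl h.1
  · exact .inr h

/-- The vectors of weight `ε_a - ε_b` are reached from those of weight zero. -/
theorem IsRaisingStable.uPair_a_b'_mem (hn : Even n) (hN : 2 < m + n)
    (hα : α = qh (-2) ∨ α = -qh 2) (hex : ¬ D.Exceptional α) {M : Submodule K D.VV}
    (hM : D.IsRaisingStable M) (hz : ∀ c d, D.Node c d → D.zz α c d ∈ M)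
    (hl : ∀ c, D.Long c → fac α 1 • D.br α (-1) c ∈ M) {a b : ℕ} (h : D.Node a b) :
    D.uPair α a (D.bar b) ∈ M := by
  have hb := h.bounds
  have hadj := h.eq_add
  by_cases hb' : 2 * b = m + n + 1
  · exact mem_of_smul_eq (mul_ne_zero (neg_theta_ne_zero _ _) (zz_middle_coeff_ne_zero hα _))
      (h.nodeE_zz_middle hn hb' hα) (hM.1 a b h _ (hz a b h))
  -- For equal parities the direct route from z_{ab} has a nonzero coefficient. For an odd root it
  -- has coefficient 0, and another vector of weight zero is needed.
  by_cases hp : D.par a = D.par b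
  · refine mem_of_smul_eq (mul_ne_zero (neg_theta_ne_zero _ _) ?_) (h.nodeE_zz hb')
      (hM.1 a b h _ (hz a b h))
    rw [hp, sgn_add, sgn_mul_self, Int.cast_one, one_mul]
    exact qh_add_qh_ne_zero _ _
  by_cases ha : a = 1
  -- With room for the node (2, 3), the vector z_{23} serves: only its brace at 2 is moved.
  · by_cases h5 : 5 ≤ m + n
    · obtain rfl : b = a + 1 := by omega
      have h23 : D.Node (a + 1) (a + 2) := ⟨by omega, .inl ⟨rfl, by omega⟩⟩
      have h1 := hM.1 a (a + 1) h _ (hz _ _ h23)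
      rw [zz, map_sub, map_smul, br_eq_zero_of_ne (l := a + 2) _ (by omega) (by omega) (by omega)
        (by simp only [bar]; omega) (by simp only [bar]; omega) (by omega) (by omega), smul_zero,
        sub_zero] at h1
      exact mem_of_smul_eq (qh_ne_zero _) (h.nodeE_br_b hb') h1
    -- For N = 4 the only remaining source is the end of the diagram: the other node of the fork if
    -- v_2 is even, the long vector if v_2 is odd. Both work only for α = -q, whence the exception
    -- at α = q⁻¹.
    · have h4 : m + n = 4 := by omega
      subst ha
      have hp2 : D.par b = D.par 2 := by
        rcases hadj with h | ⟨h, -, -⟩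
        · rw [h]
        · have := D.par_symm 2 (by omega) (by omega)
          rw [← this, h]
          congr 1
          omega
      have hα' : α = -qh 2 := hα.resolve_left fun h => hex ⟨h4, .inl ⟨by rwa [← hp2], h⟩⟩
      rcases zmod_two_cases (D.par b) with hpb | hpb
      · have hpa : D.par 1 = 1 :=
          (zmod_two_cases (D.par 1)).resolve_left fun h => hp (h.trans hpb.symm)
        have h1 : D.Node 1 (D.bar b) := by
          refine ⟨le_rfl, ?_⟩
          rcases hadj with h | h
          · refine .inr ⟨by simp only [bar]; omega, by omega, ?_⟩
            rw [← h, hpb]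
          · exact .inl ⟨by simp only [bar]; omega, by omega⟩
        refine mem_of_smul_eq (mul_ne_zero ?_ (zz_bar_coeff_ne_zero hα' hpa))
          (h.nodeE_zz_bar (by omega) hpb hα) (hM.1 1 b h _ (hz _ _ h1))
        rcases Int.units_eq_one_or (D.theta 1) with h | h <;> simp [h]
      · have hb2 : b = 2 := by
          rcases hadj with h | ⟨h, -, h'⟩
          · exact h
          · rw [hp2] at hpb
            exact absurd (hpb.symm.trans h') (by decide)
        subst hb2
        have hl2 := hl 2 ⟨by omega, hpb⟩
        rw [Submodule.smul_mem_iff _ (by rw [Ne, hα', fac_eq_zero_iff_neg]; decide)] at hl2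
        exact mem_of_smul_eq (qh_ne_zero _) (h.nodeE_br_b hb') (hM.1 _ _ h _ hl2)
  -- For a > 1 the preceding vector z_{a-1,a} serves: only its brace at a is moved.
  · obtain ⟨k, rfl⟩ := Nat.exists_eq_add_of_le' hb.1
    have hk : D.Node k (k + 1) := ⟨by omega, .inl ⟨rfl, by omega⟩⟩
    have h1 := hM.1 _ _ h _ (hz _ _ hk)
    rw [zz, map_sub, map_smul, br_eq_zero_of_ne (l := k) _ (by omega) (by omega) (by omega)
      (by simp only [bar]; omega) (by simp only [bar]; omega) (by omega) (by omega), zero_sub,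
      neg_mem_iff, Submodule.smul_mem_iff] at h1
    · refine mem_of_smul_eq (neg_ne_zero.2 (mul_ne_zero (mul_ne_zero (kap_ne_zero _ _)
        (sgn_ne_zero _)) (qh_ne_zero _))) h.nodeE_br_a_one h1
    · exact mul_ne_zero (mul_ne_zero (sgn_theta_ne_zero _ _ _) (qh_ne_zero _)) (qh_ne_zero _)

/-- Every basis vector but the last is reached by a raising operator. -/
theorem exists_target (hN : 2 < m + n) {k : ℕ} (h1 : 1 ≤ k) (h2 : k < m + n) :
    (∃ a b, D.Node a b ∧ (k = a ∨ k = D.bar b)) ∨ D.Long k := by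
  rcases exists_source (D := D) hN (k := D.bar k) (by simp only [bar]; omega)
    (by simp only [bar]; omega) with ⟨a, b, hab, h | h⟩ | ⟨a, ha, h⟩
  · exact .inl ⟨a, b, hab, .inr ((bar_eq_iff h2.le (by have := hab.bounds; omega)).1 h)⟩
  · exact .inl ⟨a, b, hab, .inl ((bar_eq_bar_iff h2.le (by have := hab.bounds; omega)).1 h)⟩
  · rw [(bar_eq_bar_iff h2.le (by have := ha.1; omega)).1 h]
    exact .inr ha

section Generation

variable {M : Submodule K D.VV}

/-- The inductive step: u_{jk} is the image of a vector with larger index sum, obtained by lowering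
the index k, or the index j once k = N is the last one. If both indices of the source could be
raised, the source has weight zero (`hs`) or is the square of v_N; when that square is excluded, the
bottom vector takes its place (`hbot`). -/
theorem IsRaisingStable.pair_mem (hN : 2 < m + n)
    (hα : α = qh (-2) ∨ α = -qh 2) (hex : ¬ D.Exceptional α)
    (hM : D.IsRaisingStable M) {j k : ℕ}
    (hs : ∀ a b, D.Node a b → j = a → k = D.bar b → D.uPair α a (D.bar b) ∈ M)
    (hbot : fac α (D.par 1) = 0 → D.uPair α (D.bar 2) (D.bar 1) ∈ M)
    (h1 : 1 ≤ j) (h2 : j < k) (h3 : k ≤ m + n) (h4 : j + k ≠ m + n + 1)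
    (ihp : ∀ j' k', 1 ≤ j' → j' < k' → k' ≤ m + n → j' + k' ≠ m + n + 1 → j + k < j' + k' →
      D.uPair α j' k' ∈ M)
    (ihd : ∀ j', 1 ≤ j' → j' ≤ m + n → 2 * j' ≠ m + n + 1 → j + k < 2 * j' →
      fac α (D.par j') • D.T j' j' ∈ M) : D.uPair α j k ∈ M := by
  by_cases hk : k < m + n
  · rcases exists_target (D := D) hN (k := k) (by omega) hk with ⟨a, b, h, rfl | rfl⟩ | h
    · have hb := h.bounds
      have := hM.1 _ _ h _ (ihp j b h1 (by omega) (by omega) (by omega) (by omega))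
      exact mem_of_smul_eq (sgn_ne_zero _) (h.nodeE_uPair_l_b (by omega) (by omega) (by omega)
        (by simp only [bar]; omega) (by simp only [bar]; omega)) this
    · have hb := h.bounds
      by_cases hj : j = a
      · rw [hj]; exact hs a b h hj rfl
      · have hbb : D.bar b = m + n + 1 - b := rfl
        have hba : D.bar a = m + n + 1 - a := rfl
        have := hM.1 _ _ h _ (ihp j (D.bar a) h1 (by omega) (by omega) (by omega) (by omega))
        exact mem_of_smul_eq (neg_ne_zero.2 (mul_ne_zero (sgn_ne_zero _) (kap_ne_zero _ _)))
          (h.nodeE_uPair_l_a' (by omega) (by omega) (by omega) (by omega) (by omega)) this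
    · have h0 := h.1
      have hba : D.bar k = k + 1 := h.bar
      have := hM.2 _ h _ (ihp j (D.bar k) h1 (by omega) (by omega) (by omega) (by omega))
      rwa [h.longE_uPair_l_a' hN (by omega) (by omega) (by omega)] at this
  · obtain rfl : k = m + n := by omega
    rcases exists_target (D := D) hN h1 h2 with ⟨a, b, h, rfl | rfl⟩ | h
    · have hb := h.bounds
      have hadj := h.eq_add
      have := hM.1 _ _ h _ (ihp b (m + n) (by omega) (by omega) (by omega) (by omega) (by omega))
      rwa [h.nodeE_uPair_b_l (by omega) (by omega) (by omega)
        (by simp only [bar]; omega) (by simp only [bar]; omega)] at this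
    · have hb := h.bounds
      have hadj := h.eq_add
      have hbb : D.bar b = m + n + 1 - b := rfl
      have hba : D.bar a = m + n + 1 - a := rfl
      by_cases ha : a = 1
      · have hba1 : D.bar a = m + n := by omega
        by_cases hf : fac α (D.par 1) = 0
        -- A second node (1, 3) exists only for a fork with N = 4. With the bottom square excluded,
        -- the corresponding vector has no source, and these parities are the exceptional ones.
        · have hb2 : b = 2 := by
            rcases hadj with h | ⟨h, h', h''⟩
            · omega
            · exfalso
              apply hex
              refine ⟨by omega, ?_⟩
              rw [ha] at h''
              rcases hα with rfl | rfl
              · rw [fac_eq_zero_iff_pos] at hf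
                left
                rw [hf, h'']
                exact ⟨by decide, rfl⟩
              · rw [fac_eq_zero_iff_neg] at hf
                exact .inr ⟨hf, h'', rfl⟩
          rw [hb2, ← hba1, ha]
          exact hbot hf
        · have := hM.1 _ _ h _ (ihd (D.bar a) (by omega) (by omega) (by omega) (by omega))
          rw [par_bar (by omega)] at this
          rw [← hba1]
          refine mem_of_smul_eq (neg_ne_zero.2 (mul_ne_zero (mul_ne_zero ?_ (kap_ne_zero _ _))
            (qh_ne_zero _))) (h.nodeE_diag_a' hα) this
          rwa [ha]
      · have := hM.1 _ _ h _ (ihp (D.bar a) (m + n) (by omega) (by omega) (by omega) (by omega)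
          (by omega))
        exact mem_of_smul_eq (neg_ne_zero.2 (kap_ne_zero _ _)) (h.nodeE_uPair_a'_l (by omega)
          (by omega) (by omega) (by omega) (by omega)) this
    · have h0 := h.1
      have hba : D.bar j = j + 1 := h.bar
      have := hM.2 _ h _ (ihp (D.bar j) (m + n) (by omega) (by omega) (by omega) (by omega)
        (by omega))
      rwa [h.longE_uPair_a'_l hN (by omega) (by omega) (by omega)] at this

theorem IsRaisingStable.diag_mem (hN : 2 < m + n) (hα : α = qh (-2) ∨ α = -qh 2)
    (hM : D.IsRaisingStable M) {j : ℕ}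
    (hl : D.Long j → fac α 1 • D.br α (-1) j ∈ M)
    (hbot : fac α (D.par 1) ≠ 0 → D.T (D.bar 1) (D.bar 1) ∈ M)
    (h1 : 1 ≤ j) (h2 : j ≤ m + n) (h3 : 2 * j ≠ m + n + 1)
    (ihp : ∀ j' k', 1 ≤ j' → j' < k' → k' ≤ m + n → j' + k' ≠ m + n + 1 → 2 * j < j' + k' →
      D.uPair α j' k' ∈ M) : fac α (D.par j) • D.T j j ∈ M := by
  by_cases hj : j < m + n
  · rcases exists_target (D := D) hN h1 hj with ⟨a, b, h, rfl | rfl⟩ | h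
    · have hb := h.bounds
      have := hM.1 _ _ h _ (ihp j b h1 (by omega) (by omega) (by omega) (by omega))
      exact mem_of_smul_eq (mul_ne_zero (sgn_ne_zero _) (qh_ne_zero _)) h.nodeE_uPair_a_b this
    · have hb := h.bounds
      have hadj := h.eq_add
      have hbb : D.bar b = m + n + 1 - b := rfl
      have hba : D.bar a = m + n + 1 - a := rfl
      have := hM.1 _ _ h _ (ihp (D.bar b) (D.bar a) h1 (by omega) (by omega) (by omega) (by omega))
      rw [par_bar (by omega)]
      exact mem_of_smul_eq (neg_ne_zero.2 (mul_ne_zero (mul_ne_zero (sgn_ne_zero _) (qh_ne_zero _))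
        (kap_ne_zero _ _))) (h.nodeE_uPair_b'_a' (by omega)) this
    · have := hM.2 _ h _ (hl h)
      rw [map_smul, h.longE_br hN] at this
      rw [h.2]
      rcases hα with rfl | rfl
      · rw [(fac_eq_zero_iff_pos 1).2 rfl, zero_smul]
        exact zero_mem _
      -- For α = -q the long vector is mapped to (q⁻¹ + q³) v_s ⊗ v_s up to a nonzero factor.
      · refine Submodule.smul_mem _ _ ?_
        rw [Submodule.smul_mem_iff _ (by rw [Ne, fac_eq_zero_iff_neg]; decide),
          Submodule.smul_mem_iff] at this
        · exact this
        · rw [neg_mul, sub_neg_eq_add, ← qh_add]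
          exact qh_add_qh_ne_zero _ _
  · have hb1 : D.bar 1 = m + n := by simp only [bar]; omega
    obtain rfl : j = D.bar 1 := by omega
    rw [par_bar (by omega)]
    by_cases hf : fac α (D.par 1) = 0
    · rw [hf, zero_smul]; exact zero_mem _
    · exact Submodule.smul_mem _ _ (hbot hf)

/-- `W` is generated by its lowest weight vector under the raising operators. -/
theorem IsRaisingStable.Wa_le (hn : Even n) (hN : 2 < m + n)
    (hα : α = qh (-2) ∨ α = -qh 2) (hex : ¬ D.Exceptional α)
    (hM : D.IsRaisingStable M)
    (hbot : fac α (D.par 1) ≠ 0 → D.T (D.bar 1) (D.bar 1) ∈ M)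
    (hbot' : fac α (D.par 1) = 0 → D.uPair α (D.bar 2) (D.bar 1) ∈ M) : D.Wa α ≤ M := by
  -- Vectors of weight zero have index sum N + 1 and are images of vectors of larger sum: z_{ab} of
  -- u_{ba'}, and the long vector of the square of v_{a'}.
  have hzero : ∀ t ≤ m + n + 1,
      (∀ j k, 1 ≤ j → j < k → k ≤ m + n → j + k ≠ m + n + 1 → t < j + k → D.uPair α j k ∈ M) →
      (∀ j, 1 ≤ j → j ≤ m + n → 2 * j ≠ m + n + 1 → t < 2 * j → fac α (D.par j) • D.T j j ∈ M) →
      (∀ a b, D.Node a b → D.zz α a b ∈ M) ∧ ∀ a, D.Long a → fac α 1 • D.br α (-1) a ∈ M := by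
    intro t ht ihp ihd
    refine ⟨fun a b h => ?_, fun a h => ?_⟩
    · have hb := h.bounds
      have hba : D.bar a = m + n + 1 - a := rfl
      exact mem_of_smul_eq (qh_ne_zero _) h.nodeE_uPair_b_a' (hM.1 _ _ h _
        (ihp b (D.bar a) (by omega) (by omega) (by omega) (by omega) (by omega)))
    · have h0 := h.1
      have hba : D.bar a = a + 1 := h.bar
      have := ihd (D.bar a) (by omega) (by omega) (by omega) (by omega)
      rw [par_bar (by omega)] at this
      exact mem_of_smul_eq (qh_ne_zero _) (h.longE_diag hN hα) (hM.2 _ h _ this)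
  -- Descending induction on the index sum: M contains all spanning vectors with sum above t, which
  -- is vacuous at t = 2N + 1.
  have key : ∀ d t, t + d = 2 * (m + n) + 1 →
      (∀ j k, 1 ≤ j → j < k → k ≤ m + n → j + k ≠ m + n + 1 → t < j + k → D.uPair α j k ∈ M) ∧
      (∀ j, 1 ≤ j → j ≤ m + n → 2 * j ≠ m + n + 1 → t < 2 * j →
        fac α (D.par j) • D.T j j ∈ M) := by
    intro d
    induction d with
    | zero => exact fun t ht => ⟨fun j k _ _ _ _ _ => by omega, fun j _ _ _ _ => by omega⟩
    | succ d ih =>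
      intro t ht
      obtain ⟨ihp, ihd⟩ := ih (t + 1) (by omega)
      refine ⟨fun j k g1 g2 g3 g4 g5 => ?_, fun j g1 g2 g3 g4 => ?_⟩
      · by_cases hjk : t + 1 < j + k
        · exact ihp j k g1 g2 g3 g4 hjk
        have ht' : j + k = t + 1 := by omega
        refine hM.pair_mem hN hα hex (fun a b h hja hkb => ?_) hbot' g1 g2 g3 g4
          (by rwa [ht']) (by rwa [ht'])
        have hb := h.bounds
        have hbb : D.bar b = m + n + 1 - b := rfl
        obtain ⟨hz, hl⟩ := hzero (t + 1) (by omega) ihp ihd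
        exact hM.uPair_a_b'_mem hn hN hα hex hz hl h
      · by_cases hj : t + 1 < 2 * j
        · exact ihd j g1 g2 g3 hj
        have ht' : 2 * j = t + 1 := by omega
        refine hM.diag_mem hN hα (fun h => ?_) hbot g1 g2 g3 (by rwa [ht'])
        exact (hzero (t + 1) (by have := h.1; omega) ihp ihd).2 j h
  obtain ⟨hp, hd⟩ := key (2 * (m + n) + 1) 0 (by omega)
  obtain ⟨hz, hl⟩ := hzero 0 (by omega) hp hd
  refine Submodule.span_le.2 ?_
  rintro _ (⟨j, k, h1, h2, h3, h4⟩ | ⟨j, h1, h2, h3⟩ | ⟨a, b, h⟩ | ⟨a, h⟩)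
  · exact hp j k h1 h2 h3 h4 (by omega)
  · exact hd j h1 h2 h3 (by omega)
  · exact hz a b h
  · exact hl a h

end Generation

end Data

/-! ### Singular vectors of W, generation and irreducibility -/

namespace Data

variable {m n : ℕ} (D : Data m n)

/-- The highest weight vector of `W`. -/
def topVec (α : K) : D.VV :=
  open Classical in if fac α (D.par 1) = 0 then D.uPair α 1 2 else D.T 1 1

variable {D} {α : K}

theorem topVec_mem (hN : 2 < m + n) : D.topVec α ∈ D.Wa α := by
  rw [topVec]
  split_ifs with h
  · by_cases h3 : m + n = 3
    · exact (Gen.pair _ _ le_rfl (by omega) (by omega) (by omega)).mem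
    · exact (Gen.pair _ _ le_rfl (by omega) (by omega) (by omega)).mem
  · have := (Gen.diag (D := D) (α := α) 1 le_rfl (by omega) (by omega)).mem
    exact (Submodule.smul_mem_iff _ h).1 this

theorem topVec_one : D.topVec (D.alpha 1) = D.w₁ := by
  rw [topVec, if_neg]
  · rfl
  · rw [fac_alpha_eq_zero_iff]; simp

theorem topVec_neg_one : D.topVec (D.alpha (-1)) = D.w₂ := by
  rw [topVec, if_pos]
  · rw [uPair, w₂, sub_eq_add_neg, ← neg_smul, alpha, T, T]
    congr 2
    rcases zmod_two_cases (D.par 1) with h | h <;> rcases zmod_two_cases (D.par 2) with h' | h' <;>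
      simp [h, h', sgn_zero, sgn_one, zmod_one_add_one]
  · rw [fac_alpha_eq_zero_iff]; simp

theorem T_one_ne_zero {k : ℕ} (hk : 1 ≤ k ∧ k ≤ m + n) (x : D.VV) (hx : D.coord 1 k x = 0) :
    D.T 1 k + x ≠ 0 := by
  intro h
  have := congrArg (D.coord 1 k) h
  rw [map_add, coord_T _ _ _ (by omega) hk, hx] at this
  simp at this

theorem topVec_ne_zero (hN : 2 < m + n) : D.topVec α ≠ 0 := by
  rw [topVec]
  split_ifs with h
  · refine T_one_ne_zero (by omega) _ ?_
    rw [map_smul, coord_T _ _ _ (by omega) (by omega), if_neg (by omega), smul_zero]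
  · simpa using T_one_ne_zero (D := D) (k := 1) (by omega) 0 (map_zero _)

theorem singular_topVec (hN : 2 < m + n) : D.Singular (D.topVec α) := by
  rw [topVec]
  split_ifs with hf
  · refine ⟨fun a b h => ?_, fun a h => ?_⟩
    · have hb := h.bounds
      by_cases hb2 : b = 2
      · obtain rfl : a = 1 := by omega
        rw [← hb2, h.nodeE_uPair_a_b, hf, zero_smul, smul_zero]
      · rw [uPair, map_add, map_smul, nodeE_T_eq_zero (by omega) (by omega) (by omega)
          (by simp only [bar]; omega) (by omega) (by simp only [bar]; omega),
          nodeE_T_eq_zero (by omega) (by omega) (by omega)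
          (by simp only [bar]; omega) (by omega) (by simp only [bar]; omega), smul_zero, add_zero]
    · have hb := h.1
      rw [uPair, map_add, map_smul, Long.longE_T_eq_zero (by omega) (by omega)
        (by simp only [bar]; omega) (by simp only [bar]; omega), Long.longE_T_eq_zero (by omega)
        (by omega) (by simp only [bar]; omega) (by simp only [bar]; omega), smul_zero, add_zero]
  · refine ⟨fun a b h => ?_, fun a h => ?_⟩
    · have hb := h.bounds
      exact nodeE_T_eq_zero (by omega) (by omega) (by omega)
          (by simp only [bar]; omega) (by omega) (by simp only [bar]; omega)
    · have hb := h.1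
      exact Long.longE_T_eq_zero (by omega) (by omega)
        (by simp only [bar]; omega) (by simp only [bar]; omega)

theorem singular_w₁ (hN : 2 < m + n) : D.Singular D.w₁ := by
  rw [← topVec_one]; exact singular_topVec hN

theorem singular_w₂ (hN : 2 < m + n) : D.Singular D.w₂ := by
  rw [← topVec_neg_one]; exact singular_topVec hN

/-- The first factor v_j is moved by some raising operator. Because j ≤ k and j + k ≠ N + 1, the
second factor does not interfere, and the coordinate is isolated. -/
theorem Singular.coord_eq_zero (hN : 2 < m + n) {x : D.VV} (hx : D.Singular x) {j k : ℕ}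
    (h1 : 2 ≤ j) (h2 : j ≤ k) (h3 : k ≤ m + n) (h4 : j + k ≠ m + n + 1) : D.coord j k x = 0 := by
  rcases exists_source (D := D) hN h1 (by omega) with ⟨a, b, h, rfl | rfl⟩ | ⟨a, h, rfl⟩
  · have hb := h.bounds
    exact h.coord_b_l (hx.1 _ _ h) (by omega) (by simp only [bar]; omega)
  · have hb := h.bounds
    simp only [bar] at h2
    exact h.coord_a'_l (hx.1 _ _ h) (by omega) (by simp only [bar]; omega)
  · have hb := h.1
    simp only [bar] at h2
    exact h.coord_a'_l hN (hx.2 _ h) (by omega)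

theorem Singular.coord_one_eq_zero (hN : 2 < m + n) {x : D.VV} (hx : D.Singular x) {k : ℕ}
    (h1 : 2 ≤ k) (h2 : k < m + n) (hk : ¬ D.Node 1 k) : D.coord 1 k x = 0 := by
  rcases exists_source (D := D) hN h1 h2.le with ⟨a, b, h, rfl | rfl⟩ | ⟨a, h, rfl⟩
  · have hb := h.bounds
    exact h.coord_l_b (hx.1 _ _ h) (by rintro rfl; exact hk h) (by simp only [bar]; omega)
  · have hb := h.bounds
    simp only [bar] at h2
    exact h.coord_l_a' (hx.1 _ _ h) (by omega) (by simp only [bar]; omega)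
  · have hb := h.1
    exact h.coord_l_a' hN (hx.2 _ h) (by omega)

/-- The equation at (1, 1) relates the positions (1, b) and (b, 1); combined with the swap rule of W
it reads `fac` times the coordinate equals 0. -/
theorem Singular.coord_one_node (hN : 2 < m + n) {x : D.VV} (hx : D.Singular x)
    (hxW : x ∈ D.Wa α) (hf : fac α (D.par 1) ≠ 0) {b : ℕ} (h : D.Node 1 b) :
    D.coord 1 b x = 0 := by
  have hb := h.bounds
  have h1 := h.coord_a_b (hx.1 _ _ h)
  rw [Wa_coord_swap hN hxW le_rfl hb.2.1 (by omega) (by omega)] at h1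
  have h2 : (sgn (D.par 1 * D.par b) : K) * ((sgn (D.par 1) : K) * (qh (sgn (D.par 1)) *
      (fac α (D.par 1) * D.coord 1 b x))) = 0 := by
    rw [← h1, fac]
    have e : qh (sgn (D.par 1)) * qh (-2 * sgn (D.par 1)) = qh (-sgn (D.par 1)) := by
      rw [← qh_add]; congr 1; ring
    rw [← e]
    rcases zmod_two_cases (D.par 1) with hp | hp <;>
      rcases zmod_two_cases (D.par b) with h' | h' <;>
      simp [hp, h', sgn_zero, sgn_one, zmod_one_add_one] <;> ring
  simpa [sgn_int_ne_zero, qh_ne_zero, hf] using h2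

/-- For j ≤ k, every coordinate of nonzero weight vanishes except one, at (1, 1) or (1, 2) according
to `fac`, and there the highest weight vector has coordinate 1. The swap rule gives the positions
with j > k, and the weight zero part is a multiple of w_3. -/
theorem Singular.eq_smul_add (hn : Even n) (hN : 2 < m + n)
    (hα : α = qh (-2) ∨ α = -qh 2) (hex : ¬ D.Exceptional α) {x : D.VV}
    (hx : D.Singular x) (hxW : x ∈ D.Wa α) :
    ∃ t : K, x = t • D.topVec α + D.coord 1 (D.bar 1) x • D.w₃ := by
  suffices ∃ t : K, ∀ j k, 1 ≤ j → j ≤ k → k ≤ m + n → j + k ≠ m + n + 1 →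
      D.coord j k x = t * D.coord j k (D.topVec α) by
    obtain ⟨t, ht⟩ := this
    refine ⟨t, ?_⟩
    have hy : x - t • D.topVec α ∈ D.Wa α := sub_mem hxW (Submodule.smul_mem _ _ (topVec_mem hN))
    have hy0 : D.pi0 (x - t • D.topVec α) = x - t • D.topVec α := by
      have key : ∀ j k, 1 ≤ j → j ≤ k → k ≤ m + n → j + k ≠ m + n + 1 →
          D.coord j k (x - t • D.topVec α) = 0 := by
        intro j k h1 h2 h3 h4
        rw [map_sub, map_smul, ht j k h1 h2 h3 h4, smul_eq_mul, sub_self]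
      refine D.ext_coord fun j k hj hk => ?_
      rw [coord_pi0]
      split_ifs with h
      · rfl
      · simp only [bar] at h
        rcases le_or_gt j k with hjk | hjk
        · rw [key j k hj.1 hjk hk.2 (by omega)]
        · rw [Wa_coord_swap hN hy hk.1 hjk hj.2 (by omega), key k j hk.1 hjk.le hj.2 (by omega),
            mul_zero]
    have htop : D.pi0 (D.topVec α) = 0 := by
      rw [topVec]
      have h2 : ∀ j k, 1 ≤ j → j ≤ 2 → 1 ≤ k → k ≤ 2 → j + k ≠ 4 → D.pi0 (D.T j k) = 0 := by
        intro j k h1 h2 h3 h4 h5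
        rw [pi0_T (by omega) (by omega), if_neg (by simp only [bar]; omega)]
      split_ifs with h
      · rw [uPair, map_add, map_smul, h2 1 2 (by omega) (by omega) (by omega) (by omega) (by omega),
          h2 2 1 (by omega) (by omega) (by omega) (by omega) (by omega), smul_zero, add_zero]
      · exact h2 1 1 (by omega) (by omega) (by omega) (by omega) (by omega)
    rw [map_sub, map_smul, htop, smul_zero, sub_zero, hx.pi0_eq hn hN] at hy0
    rw [hy0, add_sub_cancel]
  have hc : ∀ j k, 2 ≤ j → j ≤ k → k ≤ m + n → j + k ≠ m + n + 1 →
      D.coord j k x = 0 := fun j k h1 h2 h3 h4 => hx.coord_eq_zero hN h1 h2 h3 h4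
  have hct : ∀ j k, 2 ≤ j → j ≤ k → k ≤ m + n → j + k ≠ m + n + 1 →
      D.coord j k (D.topVec α) = 0 := fun j k h1 h2 h3 h4 =>
    (singular_topVec hN).coord_eq_zero hN h1 h2 h3 h4
  by_cases hf : fac α (D.par 1) = 0
  · refine ⟨D.coord 1 2 x, fun j k h1 h2 h3 h4 => ?_⟩
    rcases h1.eq_or_lt with rfl | h1
    · rcases h2.eq_or_lt with rfl | h2
      · rw [Wa_coord_diag hN hxW (by omega) hf, Wa_coord_diag hN (topVec_mem hN) (by omega) hf,
          mul_zero]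
      · by_cases hk : D.Node 1 k
        · rcases hk.eq_add with rfl | ⟨rfl, h5, h6⟩
          · rw [topVec, if_pos hf, uPair, map_add, map_smul, coord_T _ _ _ (by omega) (by omega),
              coord_T _ _ _ (by omega) (by omega)]
            simp
          -- A second node (1, 3) would allow another free coordinate; it needs N = 4, and these
          -- parities are exceptional.
          · exfalso
            apply hex
            refine ⟨by omega, ?_⟩
            rcases hα with rfl | rfl
            · rw [fac_eq_zero_iff_pos] at hf
              exact .inl ⟨by rw [hf, h6]; decide, rfl⟩
            · rw [fac_eq_zero_iff_neg] at hf
              exact .inr ⟨hf, h6, rfl⟩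
        · rw [hx.coord_one_eq_zero hN h2 (by omega) hk,
            (singular_topVec hN).coord_one_eq_zero hN h2 (by omega) hk, mul_zero]
    · rw [hc j k h1 h2 h3 h4, hct j k h1 h2 h3 h4, mul_zero]
  · refine ⟨D.coord 1 1 x, fun j k h1 h2 h3 h4 => ?_⟩
    rcases h1.eq_or_lt with rfl | h1
    · rcases h2.eq_or_lt with rfl | h2
      · rw [topVec, if_neg hf, coord_T _ _ _ (by omega) (by omega)]
        simp
      · by_cases hk : D.Node 1 k
        · rw [hx.coord_one_node hN hxW hf hk, (singular_topVec hN).coord_one_node hN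
            (topVec_mem hN) hf hk, mul_zero]
        · rw [hx.coord_one_eq_zero hN h2 (by omega) hk,
            (singular_topVec hN).coord_one_eq_zero hN h2 (by omega) hk, mul_zero]
    · rw [hc j k h1 h2 h3 h4, hct j k h1 h2 h3 h4, mul_zero]

/-- For `n ≠ m`, the singular vectors of `W` are the multiples of its highest weight vector. -/
theorem Singular.eq_smul (hn : Even n) (hN : 2 < m + n)
    (hα : α = qh (-2) ∨ α = -qh 2) (hex : ¬ D.Exceptional α) (hnm : n ≠ m) {x : D.VV}
    (hx : D.Singular x) (hxW : x ∈ D.Wa α) : ∃ t : K, x = t • D.topVec α := by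
  obtain ⟨t, ht⟩ := hx.eq_smul_add hn hN hα hex hxW
  have h := phi_eq_zero hn hN hα hxW
  rw [ht, map_add, map_smul, phi_eq_zero hn hN hα (topVec_mem hN), map_smul, smul_zero, zero_add,
    smul_eq_mul] at h
  have h0 := (mul_eq_zero.1 h).resolve_right (mt (phi_w₃_eq_zero_iff hn hN).1 hnm)
  exact ⟨t, by rw [ht]; rw [h0, zero_smul, add_zero]⟩

/-- A nonzero subspace stable under the raising operators contains a singular vector. -/
theorem IsRaisingStable.exists_singular (hN : 2 < m + n) {M : Submodule K D.VV}
    (hM : D.IsRaisingStable M) (hne : M ≠ ⊥) : ∃ x ∈ M, x ≠ 0 ∧ D.Singular x := by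
  classical
  -- Raising operators decrease the index sum, so a nonzero vector of M whose largest occurring sum
  -- is minimal must be killed by all of them.
  have hex : ∃ t : ℕ, ∃ x ∈ M, x ≠ 0 ∧ ∀ j k, 1 ≤ j ∧ j ≤ m + n → 1 ≤ k ∧ k ≤ m + n →
      t < j + k → D.coord j k x = 0 := by
    obtain ⟨x, hx, h0⟩ := M.ne_bot_iff.1 hne
    exact ⟨2 * (m + n), x, hx, h0, fun j k _ _ _ => by omega⟩
  obtain ⟨x, hx, h0, hc⟩ := Nat.find_spec hex
  have hmin : ∀ y ∈ M, (∀ j k, 1 ≤ j ∧ j ≤ m + n → 1 ≤ k ∧ k ≤ m + n →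
      Nat.find hex ≤ j + k → D.coord j k y = 0) → y = 0 := by
    intro y hy hcy
    by_contra hy0
    rcases Nat.eq_zero_or_pos (Nat.find hex) with h | h
    · exact hy0 (D.ext_coord fun j k hj hk => by rw [hcy j k hj hk (by omega), map_zero])
    · have := Nat.find_min' hex (m := Nat.find hex - 1) ⟨y, hy, hy0, fun j k hj hk hjk =>
        hcy j k hj hk (by omega)⟩
      omega
  refine ⟨x, hx, h0, fun a b h => hmin _ (hM.1 a b h x hx) fun j k hj hk hjk => ?_,
    fun a h => hmin _ (hM.2 a h x hx) fun j k hj hk hjk => ?_⟩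
  · have hb := h.bounds
    have hb1 : 1 ≤ b ∧ b ≤ m + n := by omega
    have ha2 := bar_range (D := D) (show 1 ≤ a ∧ a ≤ m + n by omega)
    have z1 : k = a → D.coord j b x = 0 := fun e => hc j b hj hb1 (by omega)
    have z2 : k = D.bar b → D.coord j (D.bar a) x = 0 := fun e =>
      hc j _ hj ha2 (by simp only [bar] at *; omega)
    have z3 : j = a → D.coord b k x = 0 := fun e => hc b k hb1 hk (by omega)
    have z4 : j = D.bar b → D.coord (D.bar a) k x = 0 := fun e =>
      hc _ k ha2 hk (by simp only [bar] at *; omega)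
    rw [coord_nodeE h]
    simp +contextual [z1, z2, z3, z4]
  · have ha := h.range hN
    have hb := h.1
    have z1 : k = a → D.coord j (D.bar a) x = 0 := fun e =>
      hc j _ hj ha.2 (by simp only [bar] at *; omega)
    have z2 : j = a → D.coord (D.bar a) k x = 0 := fun e =>
      hc _ k ha.2 hk (by simp only [bar] at *; omega)
    rw [coord_longE h hN]
    simp +contextual [z1, z2]

theorem isRaisingStable_iff (hn : Even n) (hN : 2 < m + n) (M : Submodule K D.VV) :
    D.IsRaisingStable M ↔ ∀ i, 1 ≤ i → i ≤ D.s → ∀ x ∈ M, D.eOp i x ∈ M :=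
  (exists_eOp_iff hn hN fun f => ∀ x ∈ M, f x ∈ M).symm

/-- `W` is generated by its highest weight vector under the lowering operators. -/
theorem Wa_le_of_topVec_mem (hn : Even n) (hN : 2 < m + n)
    (hα : α = qh (-2) ∨ α = -qh 2) (hex : ¬ D.Exceptional α) {M : Submodule K D.VV}
    (hM : ∀ i, 1 ≤ i → i ≤ D.s → ∀ x ∈ M, D.fOp i x ∈ M) (ht : D.topVec α ∈ M) :
    D.Wa α ≤ M := by
  -- The preimage of M under `psi` is stable under raising and contains the lowest weight vector, so
  -- the generation result for raising operators applies to it.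
  have h1 : D.Wa α ≤ M.comap D.psi := by
    have hs : D.IsRaisingStable (M.comap D.psi) := by
      rw [isRaisingStable_iff hn hN]
      intro i h1 h2 x hx
      obtain ⟨c, hc, h⟩ := exists_fOp_psi (D := D) hn hN h1 h2
      have := hM i h1 h2 _ hx
      rw [h] at this
      exact (Submodule.smul_mem_iff M hc).1 this
    have r1 : 1 ≤ 1 ∧ 1 ≤ m + n := by omega
    have r2 : 1 ≤ 2 ∧ 2 ≤ m + n := by omega
    refine hs.Wa_le hn hN hα hex (fun hf => ?_) (fun hf => ?_)
    · rw [topVec, if_neg hf] at ht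
      rw [Submodule.mem_comap, psi_T (bar_range r1) (bar_range r1), bar_bar r1.2]
      exact Submodule.smul_mem _ _ ht
    · rw [topVec, if_pos hf] at ht
      rw [Submodule.mem_comap, psi_uPair (bar_range r2) (bar_range r1), bar_bar r1.2, bar_bar r2.2]
      exact Submodule.smul_mem _ _ ht
  exact (le_map_psi hN).trans (Submodule.map_le_iff_le_comap.2 h1)

/-- For `n ≠ m`, the subspace `W` is irreducible. -/
theorem Wa_le_of_ne_bot (hn : Even n) (hN : 2 < m + n)
    (hα : α = qh (-2) ∨ α = -qh 2) (hex : ¬ D.Exceptional α) (hnm : n ≠ m)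
    {M : Submodule K D.VV} (hM : ∀ i, 1 ≤ i → i ≤ D.s → ∀ x ∈ M, D.eOp i x ∈ M)
    (hM' : ∀ i, 1 ≤ i → i ≤ D.s → ∀ x ∈ M, D.fOp i x ∈ M) (hle : M ≤ D.Wa α) (hne : M ≠ ⊥) :
    D.Wa α ≤ M := by
  obtain ⟨x, hx, h0, hs⟩ := ((isRaisingStable_iff hn hN M).2 hM).exists_singular hN hne
  obtain ⟨t, rfl⟩ := hs.eq_smul hn hN hα hex hnm (hle hx)
  refine Wa_le_of_topVec_mem hn hN hα hex hM' ((Submodule.smul_mem_iff _ ?_).1 hx)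
  rintro rfl
  simp at h0

theorem kOp_w₁ (i : ℕ) (c : ℤ) : D.kOp i c D.w₁ = qh (c * (D.h i 1 + D.h i 1)) • D.w₁ :=
  D.kOp_T i c 1 1

theorem kOp_w₂ (i : ℕ) (c : ℤ) : D.kOp i c D.w₂ = qh (c * (D.h i 1 + D.h i 2)) • D.w₂ := by
  have h1 := D.kOp_T i c 1 2
  have h2 := D.kOp_T i c 2 1
  rw [w₂, map_sub, map_smul]
  rw [T] at h1 h2
  rw [h1, h2, add_comm (D.h i 2)]
  module

theorem kOp_w₃ (hN : 2 < m + n) {i : ℕ} (h2 : i ≤ D.s) (c : ℤ) : D.kOp i c D.w₃ = D.w₃ := by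
  rw [w₃, map_sum]
  refine Finset.sum_congr rfl fun j hj => ?_
  rw [Finset.mem_Icc] at hj
  rw [map_smul]
  exact congrArg _ (kOp_T_bar hN h2 c hj.2)

theorem eOp_w₃ (hn : Even n) (hN : 2 < m + n) {i : ℕ} (h1 : 1 ≤ i) (h2 : i ≤ D.s) :
    D.eOp i D.w₃ = 0 := (singular_iff hn hN _).1 (singular_w₃ hn hN) i h1 h2

theorem fOp_w₃ (hn : Even n) (hN : 2 < m + n) {i : ℕ} (h1 : 1 ≤ i) (h2 : i ≤ D.s) :
    D.fOp i D.w₃ = 0 := by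
  obtain ⟨c, -, h⟩ := exists_fOp_psi (D := D) hn hN h1 h2
  have hpsi : D.psi D.w₃ = D.w₃ := by
    rw [w₃, map_sum]
    refine Finset.sum_congr rfl fun j hj => ?_
    rw [Finset.mem_Icc] at hj
    rw [map_smul]
    exact congrArg _ (psi_T_bar hj)
  rw [← hpsi, h, eOp_w₃ hn hN h1 h2, map_zero, smul_zero]

theorem w₁_ne_zero (hN : 2 < m + n) : D.w₁ ≠ 0 := by
  rw [← topVec_one]; exact topVec_ne_zero hN

theorem w₂_ne_zero (hN : 2 < m + n) : D.w₂ ≠ 0 := by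
  rw [← topVec_neg_one]; exact topVec_ne_zero hN

/-- The raising operators map `V ⊗ V` to the kernel of the invariant form. -/
theorem phi_eOp (hn : Even n) (hN : 2 < m + n) {i : ℕ} (h1 : 1 ≤ i) (h2 : i ≤ D.s) (x : D.VV) :
    D.phi (D.eOp i x) = 0 := by
  have hx : x ∈ D.Wa (qh (-2)) ⊔ D.Wa (-qh 2) ⊔ Submodule.span K {D.T 1 (D.bar 1)} := by
    rw [sup_Wa_sup_span hN]; trivial
  obtain ⟨y, hy, z, hz, rfl⟩ := Submodule.mem_sup.1 hx
  obtain ⟨t, rfl⟩ := Submodule.mem_span_singleton.1 hz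
  obtain ⟨y1, hy1, y2, hy2, rfl⟩ := Submodule.mem_sup.1 hy
  -- Off the sum of the two stable spaces only v_1 ⊗ v_{1'} is left, and its image has no coordinate
  -- of weight zero.
  have hT : D.phi (D.eOp i (D.T 1 (D.bar 1))) = 0 := by
    have hb1 : D.bar 1 = m + n := by simp only [bar]; omega
    rw [hb1]
    refine (exists_eOp_iff hn hN fun f => D.phi (f (D.T 1 (m + n))) = 0).2
      ⟨fun a b h => ?_, fun a h => ?_⟩ i h1 h2
    · have hb := h.bounds
      by_cases ha : a = 1
      · have hba : D.bar a = m + n := by rw [ha, hb1]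
        rw [← hba, h.nodeE_T_l_a' (by omega) (by omega) (by omega), map_smul,
          phi_T (by omega) (by simp only [bar]; omega), if_neg (by simp only [bar]; omega),
          smul_zero]
      · rw [nodeE_T_eq_zero (by omega) (by omega) (by omega) (by simp only [bar]; omega) (by omega)
          (by simp only [bar]; omega), map_zero]
    · have hb := h.1
      rw [Long.longE_T_eq_zero (by omega) (by omega) (by simp only [bar]; omega)
        (by simp only [bar]; omega), map_zero]
  rw [map_add, map_add, map_smul, map_add, map_add, map_smul, hT,
    phi_eq_zero hn hN (.inl rfl) (eOp_mem hn hN (.inl rfl) h1 h2 hy1),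
    phi_eq_zero hn hN (.inr rfl) (eOp_mem hn hN (.inr rfl) h1 h2 hy2)]
  simp

end Data

/-! ### Subrepresentations over the algebra of operators -/

namespace Data

variable {m n : ℕ} {D : Data m n} {α : K}

/-- A subspace stable under the generators, as a subrepresentation. -/
def subrep (p : Submodule K D.VV) (h : ∀ g ∈ D.generators, ∀ x ∈ p, g x ∈ p) :
    Submodule D.U D.VV where
  carrier := p
  add_mem' := p.add_mem
  zero_mem' := p.zero_mem
  smul_mem' := by
    rintro ⟨u, hu⟩ x hx
    change u x ∈ p
    change u ∈ Algebra.adjoin K D.generators at hu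
    induction hu using Algebra.adjoin_induction generalizing x with
    | mem g hg => exact h g hg x hx
    | algebraMap r => exact p.smul_mem r hx
    | add a b _ _ ha hb => exact p.add_mem (ha hx) (hb hx)
    | mul a b _ _ ha hb => exact ha (hb hx)

theorem mem_subrep {p : Submodule K D.VV} {h : ∀ g ∈ D.generators, ∀ x ∈ p, g x ∈ p} {x : D.VV} :
    x ∈ subrep p h ↔ x ∈ p := Iff.rfl

theorem generator_smul_mem (L : Submodule D.U D.VV) {g : Module.End K D.VV}
    (hg : g ∈ D.generators) {x : D.VV} (hx : x ∈ L) : g x ∈ L :=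
  L.smul_mem (⟨g, Algebra.subset_adjoin hg⟩ : D.U) hx

theorem eOp_smul_mem (L : Submodule D.U D.VV) {i : ℕ} (h1 : 1 ≤ i) (h2 : i ≤ D.s) {x : D.VV}
    (hx : x ∈ L) : D.eOp i x ∈ L := generator_smul_mem L ⟨i, h1, h2, .inl rfl⟩ hx

theorem fOp_smul_mem (L : Submodule D.U D.VV) {i : ℕ} (h1 : 1 ≤ i) (h2 : i ≤ D.s) {x : D.VV}
    (hx : x ∈ L) : D.fOp i x ∈ L := generator_smul_mem L ⟨i, h1, h2, .inr (.inl rfl)⟩ hx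

theorem Wa_stable (hn : Even n) (hN : 2 < m + n) (hα : α = qh (-2) ∨ α = -qh 2) :
    ∀ g ∈ D.generators, ∀ x ∈ D.Wa α, g x ∈ D.Wa α := by
  rintro g ⟨i, h1, h2, rfl | rfl | rfl | rfl⟩ x hx
  · exact eOp_mem hn hN hα h1 h2 hx
  · exact fOp_mem hn hN hα h1 h2 hx
  · exact kOp_mem hN h2 1 hx
  · exact kOp_mem hN h2 (-1) hx

theorem span_w₃_stable (hn : Even n) (hN : 2 < m + n) :
    ∀ g ∈ D.generators, ∀ x ∈ Submodule.span K {D.w₃}, g x ∈ Submodule.span K {D.w₃} := by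
  rintro g ⟨i, h1, h2, rfl | rfl | rfl | rfl⟩ x hx <;>
    obtain ⟨t, rfl⟩ := Submodule.mem_span_singleton.1 hx <;> rw [map_smul]
  · rw [eOp_w₃ hn hN h1 h2, smul_zero]; exact zero_mem _
  · rw [fOp_w₃ hn hN h1 h2, smul_zero]; exact zero_mem _
  · rw [kOp_w₃ hN h2]; exact hx
  · rw [kOp_w₃ hN h2]; exact hx

/-- `W` is the subrepresentation generated by its highest weight vector. -/
theorem span_topVec (hn : Even n) (hN : 2 < m + n) (hα : α = qh (-2) ∨ α = -qh 2)
    (hex : ¬ D.Exceptional α) :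
    Submodule.span D.U {D.topVec α} = subrep (D.Wa α) (Wa_stable hn hN hα) := by
  apply le_antisymm
  · rw [Submodule.span_singleton_le_iff_mem, mem_subrep]
    exact topVec_mem hN
  · intro x hx
    have h := Wa_le_of_topVec_mem hn hN hα hex
      (M := (Submodule.span D.U {D.topVec α}).restrictScalars K)
      (fun i h1 h2 x hx => fOp_smul_mem _ h1 h2 hx) (Submodule.mem_span_singleton_self _)
    exact h hx

theorem isSimpleModule_of_le {p : Submodule D.U D.VV} (hp : p ≠ ⊥)
    (h : ∀ L : Submodule D.U D.VV, L ≤ p → L ≠ ⊥ → p ≤ L) : IsSimpleModule D.U p := by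
  rw [isSimpleModule_iff_isAtom]
  refine ⟨hp, fun L hL => ?_⟩
  by_contra h0
  exact hL.not_ge (h L hL.le h0)

theorem isSimpleModule_Wa (hn : Even n) (hN : 2 < m + n) (hα : α = qh (-2) ∨ α = -qh 2)
    (hex : ¬ D.Exceptional α) (hnm : n ≠ m) :
    IsSimpleModule D.U (subrep (D.Wa α) (Wa_stable hn hN hα)) := by
  refine isSimpleModule_of_le (fun h => ?_) fun L hL h0 x hx => ?_
  · have := mem_subrep (h := Wa_stable hn hN hα).2 (topVec_mem (D := D) (α := α) hN)
    rw [h, Submodule.mem_bot] at this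
    exact topVec_ne_zero hN this
  · refine Wa_le_of_ne_bot hn hN hα hex hnm (M := L.restrictScalars K)
      (fun i h1 h2 x hx => eOp_smul_mem _ h1 h2 hx) (fun i h1 h2 x hx => fOp_smul_mem _ h1 h2 hx)
      hL (fun h => h0 ?_) hx
    rwa [Submodule.restrictScalars_eq_bot_iff] at h

theorem isSimpleModule_span_w₃ (hn : Even n) (hN : 2 < m + n) :
    IsSimpleModule D.U (subrep (Submodule.span K {D.w₃}) (span_w₃_stable hn hN)) := by
  refine isSimpleModule_of_le (fun h => ?_) fun L hL h0 x hx => ?_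
  · have := mem_subrep (h := span_w₃_stable hn hN).2 (Submodule.mem_span_singleton_self D.w₃)
    rw [h, Submodule.mem_bot] at this
    exact w₃_ne_zero hN this
  · obtain ⟨y, hy, hy0⟩ := L.ne_bot_iff.1 h0
    obtain ⟨t, rfl⟩ := Submodule.mem_span_singleton.1 (hL hy)
    have ht : t ≠ 0 := by rintro rfl; simp at hy0
    have h3 : D.w₃ ∈ L.restrictScalars K := (Submodule.smul_mem_iff _ ht).1 hy
    obtain ⟨r, rfl⟩ := Submodule.mem_span_singleton.1 hx
    exact (L.restrictScalars K).smul_mem r h3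

theorem span_w₃ (hn : Even n) (hN : 2 < m + n) :
    Submodule.span D.U {D.w₃} = subrep (Submodule.span K {D.w₃}) (span_w₃_stable hn hN) := by
  apply le_antisymm
  · rw [Submodule.span_singleton_le_iff_mem, mem_subrep]
    exact Submodule.mem_span_singleton_self _
  · intro x hx
    obtain ⟨r, rfl⟩ := Submodule.mem_span_singleton.1 hx
    exact ((Submodule.span D.U {D.w₃}).restrictScalars K).smul_mem r
      (Submodule.mem_span_singleton_self _)

theorem disjoint_subrep {p q : Submodule K D.VV} (h : Disjoint p q)
    (hp : ∀ g ∈ D.generators, ∀ x ∈ p, g x ∈ p) (hq : ∀ g ∈ D.generators, ∀ x ∈ q, g x ∈ q) :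
    Disjoint (subrep p hp) (subrep q hq) := by
  rw [Submodule.disjoint_def] at h ⊢
  exact h

theorem mem_sup_subrep {p q : Submodule K D.VV} {hp : ∀ g ∈ D.generators, ∀ x ∈ p, g x ∈ p}
    {hq : ∀ g ∈ D.generators, ∀ x ∈ q, g x ∈ q} {x : D.VV} :
    x ∈ subrep p hp ⊔ subrep q hq ↔ x ∈ p ⊔ q := by
  simp only [Submodule.mem_sup, mem_subrep]

theorem isInternal_of_disjoint {R M : Type*} [Ring R] [AddCommGroup M]
    [Module R M] {p q r : Submodule R M} (h1 : Disjoint p q) (h2 : Disjoint (p ⊔ q) r)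
    (h3 : p ⊔ q ⊔ r = ⊤) : DirectSum.IsInternal ![p, q, r] := by
  rw [DirectSum.isInternal_submodule_iff_iSupIndep_and_iSup_eq_top]
  constructor
  · rw [iSupIndep_def]
    intro i
    fin_cases i
    · refine (h1.disjoint_sup_right_of_disjoint_sup_left h2).mono_right ?_
      refine iSup₂_le fun j hj => ?_
      fin_cases j
      · exact absurd rfl hj
      · exact le_sup_left
      · exact le_sup_right
    · refine (h1.symm.disjoint_sup_right_of_disjoint_sup_left (by rwa [sup_comm])).mono_right ?_
      refine iSup₂_le fun j hj => ?_
      fin_cases j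
      · exact le_sup_left
      · exact absurd rfl hj
      · exact le_sup_right
    · refine h2.symm.mono_right ?_
      refine iSup₂_le fun j hj => ?_
      fin_cases j
      · exact le_sup_left
      · exact le_sup_right
      · exact absurd rfl hj
  · rw [eq_top_iff, ← h3]
    exact sup_le (sup_le (le_iSup ![p, q, r] 0) (le_iSup ![p, q, r] 1)) (le_iSup ![p, q, r] 2)

theorem alpha_cases' (σ : ℤˣ) : D.alpha σ = qh (-2) ∨ D.alpha σ = -qh 2 := by
  rcases alpha_cases (D := D) σ with h | h
  · exact .inl h.2
  · exact .inr h.2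

/-- The two subspaces are those for the two values of the parameter. -/
theorem alpha_pair : (D.par 1 = 0 ∧ D.alpha 1 = qh (-2) ∧ D.alpha (-1) = -qh 2) ∨
    (D.par 1 = 1 ∧ D.alpha 1 = -qh 2 ∧ D.alpha (-1) = qh (-2)) := by
  rcases zmod_two_cases (D.par 1) with h | h
  · left; simp [alpha, h, sgn_zero]
  · right; simp [alpha, h, sgn_one]

theorem ker_phi_eq (hn : Even n) (hN : 2 < m + n) :
    LinearMap.ker D.phi = D.Wa (D.alpha 1) ⊔ D.Wa (D.alpha (-1)) := by
  rcases alpha_pair (D := D) with ⟨-, h1, h2⟩ | ⟨-, h1, h2⟩ <;> rw [h1, h2, ker_phi hn hN]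
  rw [sup_comm]

theorem disjoint_Wa_alpha (hn : Even n) (hN : 2 < m + n) :
    Disjoint (D.Wa (D.alpha 1)) (D.Wa (D.alpha (-1))) := by
  rcases alpha_pair (D := D) with ⟨-, h1, h2⟩ | ⟨-, h1, h2⟩ <;> rw [h1, h2]
  exacts [disjoint_Wa hn hN, (disjoint_Wa hn hN).symm]

/-- For N = 4 the parities at 3 and 4 repeat those at 2 and 1; so the exceptional parities determine
(m, n). -/
theorem card_odd_eq (h4 : m + n = 4) :
    n = (if D.par 1 = 1 then 2 else 0) + if D.par 2 = 1 then 2 else 0 := by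
  have h := D.card_odd
  have e3 : D.par 3 = D.par 2 := by
    rw [← D.par_symm 2 (by omega) (by omega), h4]
  have e4 : D.par 4 = D.par 1 := by
    rw [← D.par_symm 1 (by omega) (by omega), h4]
  rw [h4, show Finset.Icc 1 4 = {1, 2, 3, 4} by rfl] at h
  rcases zmod_two_cases (D.par 1) with h1 | h1 <;> rcases zmod_two_cases (D.par 2) with h2 | h2 <;>
    simp [Finset.filter_insert, Finset.filter_singleton, e3, e4, h1, h2] at h ⊢ <;> omega

theorem not_exceptional_one (h : ¬ (m = 2 ∧ n = 2 ∧ D.par 2 = 1)) :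
    ¬ D.Exceptional (D.alpha 1) := by
  rintro ⟨h4, h'⟩
  have hc := card_odd_eq (D := D) h4
  have hne : qh (-2) ≠ -qh 2 := sub_ne_zero.1 alpha_sub_ne_zero
  rcases alpha_pair (D := D) with ⟨h0, h1, -⟩ | ⟨h0, h1, -⟩ <;> rw [h1] at h'
  · rcases h' with ⟨hp, -⟩ | ⟨-, -, h'⟩
    · have hp2 : D.par 2 = 1 :=
        (zmod_two_cases _).resolve_left fun h => hp (h0.trans h.symm)
      rw [h0, hp2, if_neg (by decide), if_pos rfl] at hc
      exact h ⟨by omega, by omega, hp2⟩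
    · exact hne h'
  · rcases h' with ⟨-, h'⟩ | ⟨h', -⟩
    · exact hne h'.symm
    · rw [h0] at h'; exact absurd h' (by decide)

theorem not_exceptional_neg_one (h : ¬ (m = 4 ∧ n = 0))
    (h2 : ¬ (m = 2 ∧ n = 2 ∧ D.par 2 = 0)) : ¬ D.Exceptional (D.alpha (-1)) := by
  rintro ⟨h4, h'⟩
  have hc := card_odd_eq (D := D) h4
  have hne : qh (-2) ≠ -qh 2 := sub_ne_zero.1 alpha_sub_ne_zero
  rcases alpha_pair (D := D) with ⟨h0, -, h1⟩ | ⟨h0, -, h1⟩ <;> rw [h1] at h'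
  · rcases h' with ⟨-, h'⟩ | ⟨-, hp2, -⟩
    · exact hne h'.symm
    · rw [h0, hp2, if_neg (by decide)] at hc
      exact h ⟨by omega, by omega⟩
  · rcases h' with ⟨hp, -⟩ | ⟨h', -⟩
    · have hp2 : D.par 2 = 0 :=
        (zmod_two_cases _).resolve_right fun h => hp (h0.trans h.symm)
      rw [h0, hp2, if_pos rfl, if_neg (by decide)] at hc
      exact h2 ⟨by omega, by omega, hp2⟩
    · rw [h0] at h'; exact absurd h' (by decide)

/-- For `n = m`, the kernel of the invariant form has no complementary subrepresentation. -/
theorem not_isSemisimpleModule (hn : Even n) (hN : 2 < m + n) (hnm : n = m) :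
    ¬ IsSemisimpleModule D.U D.VV := by
  intro hss
  obtain ⟨L, hL⟩ := exists_isCompl
    (subrep (D.Wa (qh (-2))) (Wa_stable hn hN (.inl rfl)) ⊔
      subrep (D.Wa (-qh 2)) (Wa_stable hn hN (.inr rfl)))
  have hmem : ∀ x, x ∈ subrep (D.Wa (qh (-2))) (Wa_stable hn hN (.inl rfl)) ⊔
      subrep (D.Wa (-qh 2)) (Wa_stable hn hN (.inr rfl)) ↔ D.phi x = 0 := by
    intro x
    rw [mem_sup_subrep, ← ker_phi hn hN, LinearMap.mem_ker]
  have ht : D.T 1 (D.bar 1) ∈ (⊤ : Submodule D.U D.VV) := trivial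
  rw [← hL.sup_eq_top] at ht
  obtain ⟨y, hy, l, hl, hyl⟩ := Submodule.mem_sup.1 ht
  -- Raising operators map into ker φ and preserve the complement L, so they kill L.
  have hs : D.Singular l := by
    rw [singular_iff hn hN]
    intro i h1 h2
    exact Submodule.disjoint_def.1 hL.disjoint _ ((hmem _).2 (phi_eOp hn hN h1 h2 l))
      (eOp_smul_mem L h1 h2 hl)
  -- φ sees only the weight zero part of l, a multiple of w_3, and φ(w_3) = 0 for n = m. But l has
  -- the same value of φ as v_1 ⊗ v_{1'}, which is ±1.
  have hphi : D.phi l = 0 := by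
    rw [← phi_pi0, hs.pi0_eq hn hN, map_smul, (phi_w₃_eq_zero_iff hn hN).2 hnm, smul_zero]
  have := congrArg D.phi hyl
  rw [map_add, (hmem y).1 hy, hphi, phi_T_one hN, add_zero] at this
  exact sgn_ne_zero _ this.symm

theorem phi_T_last (hn : Even n) (hN : 2 < m + n) :
    D.phi (D.T (D.bar 1) 1) = qh (2 * ((m : ℤ) - n - 1 - sgn (D.par 1))) := by
  have h1 : 1 ≤ 1 ∧ 1 ≤ m + n := by omega
  rw [phi_T (bar_range h1) h1, bar_bar h1.2, if_pos rfl, par_bar h1, c_last hn hN, ← mul_assoc,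
    ← Int.cast_mul, sgn_mul_self, Int.cast_one, one_mul]

end Data

end Osp

end

/-! ### Assembly of the theorem -/

open Osp Osp.Data in
theorem mainTheorem6 (m n : ℕ) (hn : Even n) (hN : 2 < m + n) (D : Osp.Data m n) :
    -- the three vectors are highest weight vectors of weights `2ε_1`, `ε_1 + ε_2`, `0`
    D.IsHighestWeight D.w₁ (fun i => D.h i 1 + D.h i 1) ∧
    D.IsHighestWeight D.w₂ (fun i => D.h i 1 + D.h i 2) ∧
    D.IsHighestWeight D.w₃ (fun _ => 0) ∧
    -- the three explicit subspaces are subrepresentations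
    ∃ Wp Wm W3 : Submodule D.U D.VV,
      Wp.restrictScalars Osp.K = D.W 1 ∧
      Wm.restrictScalars Osp.K = D.W (-1) ∧
      W3.restrictScalars Osp.K = Submodule.span Osp.K {D.w₃} ∧
      -- the sum `W^+ + W^-` is direct
      Disjoint Wp Wm ∧
      -- the case `n ≠ m`
      (n ≠ m → DirectSum.IsInternal ![Wp, Wm, W3]) ∧
      -- the case `n = m`
      (n = m →
        (D.par 1 = 0 → W3 ≤ Wp) ∧ (D.par 1 = 1 → W3 ≤ Wm) ∧
        Module.finrank Osp.K (D.VV ⧸ (D.W 1 ⊔ D.W (-1))) = 1 ∧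
        ¬ IsSemisimpleModule D.U D.VV) ∧
      -- membership in `W^+ ⊕ W^-`
      D.tmul (D.v 1) (D.v (D.bar 1)) ∉ Wp ⊔ Wm ∧
      D.tmul (D.v (D.bar 1)) (D.v 1) ∉ Wp ⊔ Wm ∧
      D.tmul (D.v 1) (D.v (D.bar 1)) -
        ((Osp.sgn (D.par 1) : Osp.K) * Osp.qh (2 * Osp.sgn (D.par 1)) *
          Osp.qh (2 * ((n : ℤ) - (m : ℤ) + 1))) •
          (D.tmul (D.v (D.bar 1)) (D.v 1)) ∈ Wp ⊔ Wm ∧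
      -- generation by the highest weight vectors
      (¬ (m = 2 ∧ n = 2 ∧ D.par 2 = 1) → Submodule.span D.U {D.w₁} = Wp) ∧
      (¬ (m = 4 ∧ n = 0) → ¬ (m = 2 ∧ n = 2 ∧ D.par 2 = 0) →
        Submodule.span D.U {D.w₂} = Wm) ∧
      Submodule.span D.U {D.w₃} = W3 ∧
      -- irreducibility
      (n ≠ m →
        IsSimpleModule D.U Wp ∧ (¬ (m = 4 ∧ n = 0) → IsSimpleModule D.U Wm) ∧
        IsSimpleModule D.U W3) := by
  have r1 : 1 ≤ 1 ∧ 1 ≤ m + n := by omega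
  have e1 := alpha_cases' (D := D) 1
  have e2 := alpha_cases' (D := D) (-1)
  have hsup : ∀ x, x ∈ subrep (D.Wa (D.alpha 1)) (Wa_stable hn hN e1) ⊔
      subrep (D.Wa (D.alpha (-1))) (Wa_stable hn hN e2) ↔ D.phi x = 0 := by
    intro x
    rw [mem_sup_subrep, ← ker_phi_eq hn hN, LinearMap.mem_ker]
  refine ⟨⟨w₁_ne_zero hN, fun i h1 h2 => ⟨(singular_iff hn hN _).1 (singular_w₁ hN) i h1 h2, ?_⟩⟩,
    ⟨w₂_ne_zero hN, fun i h1 h2 => ⟨(singular_iff hn hN _).1 (singular_w₂ hN) i h1 h2, ?_⟩⟩,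
    ⟨w₃_ne_zero hN, fun i h1 h2 => ⟨eOp_w₃ hn hN h1 h2, ?_⟩⟩,
    subrep (D.Wa (D.alpha 1)) (Wa_stable hn hN e1),
    subrep (D.Wa (D.alpha (-1))) (Wa_stable hn hN e2),
    subrep (Submodule.span K {D.w₃}) (span_w₃_stable hn hN), (W_eq hn hN 1).symm,
    (W_eq hn hN (-1)).symm, rfl, disjoint_subrep (disjoint_Wa_alpha hn hN) _ _,
    fun hnm => ?_, fun hnm => ⟨fun hp => ?_, fun hp => ?_, ?_, not_isSemisimpleModule hn hN hnm⟩,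
    ?_, ?_, ?_, fun h => ?_, fun h h' => ?_, span_w₃ hn hN, fun hnm =>
    -- The exceptional cases with m = n = 2 cannot occur for n ≠ m, so only (4, 0) remains to be
    -- excluded.
    ⟨isSimpleModule_Wa hn hN e1 (not_exceptional_one fun h => hnm (h.2.1.trans h.1.symm)) hnm,
      fun h => isSimpleModule_Wa hn hN e2 (not_exceptional_neg_one h fun h =>
        hnm (h.2.1.trans h.1.symm)) hnm, isSimpleModule_span_w₃ hn hN⟩⟩
  · rw [kOp_w₁, one_mul]
  · rw [kOp_w₂, one_mul]
  · rw [kOp_w₃ hN h2, qh_zero, one_smul]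
  · have hne : D.phi D.w₃ ≠ 0 := mt (phi_w₃_eq_zero_iff hn hN).1 hnm
    refine isInternal_of_disjoint (disjoint_subrep (disjoint_Wa_alpha hn hN) _ _) ?_ ?_
    · rw [Submodule.disjoint_def]
      intro x hx hx3
      obtain ⟨t, rfl⟩ := Submodule.mem_span_singleton.1 hx3
      rw [hsup, map_smul, smul_eq_mul] at hx
      rw [(mul_eq_zero.1 hx).resolve_right hne, zero_smul]
    · rw [eq_top_iff]
      intro x _
      -- The projection along ker φ onto the line of w_3, available because φ(w_3) ≠ 0.
      refine Submodule.mem_sup.2 ⟨x - (D.phi x / D.phi D.w₃) • D.w₃, (hsup _).2 ?_,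
        (D.phi x / D.phi D.w₃) • D.w₃, ?_, sub_add_cancel _ _⟩
      · rw [map_sub, map_smul, smul_eq_mul, div_mul_cancel₀ _ hne, sub_self]
      · exact Submodule.smul_mem _ _ (Submodule.mem_span_singleton_self D.w₃)
  · intro x hx
    obtain ⟨t, rfl⟩ := Submodule.mem_span_singleton.1 hx
    refine Submodule.smul_mem (D.Wa (D.alpha 1)) t ?_
    rcases alpha_pair (D := D) with ⟨-, h, -⟩ | ⟨h, -⟩
    · rw [h]; exact w₃_mem hn hN hnm
    · rw [hp] at h; exact absurd h (by decide)
  · intro x hx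
    obtain ⟨t, rfl⟩ := Submodule.mem_span_singleton.1 hx
    refine Submodule.smul_mem (D.Wa (D.alpha (-1))) t ?_
    rcases alpha_pair (D := D) with ⟨h, -⟩ | ⟨-, -, h⟩
    · rw [hp] at h; exact absurd h (by decide)
    · rw [h]; exact w₃_mem hn hN hnm
  · rw [W_eq hn hN, W_eq hn hN, ← ker_phi_eq hn hN, ker_phi hn hN]
    exact finrank_quotient hn hN
  · rw [hsup]
    exact (phi_T_one hN).trans_ne (sgn_ne_zero _)
  · rw [hsup]
    exact (phi_T_last hn hN).trans_ne (qh_ne_zero _)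
  · rw [hsup, map_sub, map_smul]
    change D.phi (D.T 1 (D.bar 1)) - _ • D.phi (D.T (D.bar 1) 1) = 0
    -- The coefficient is the ratio of the values of φ at v_1 ⊗ v_{1'} and v_{1'} ⊗ v_1, so the
    -- exponents of q cancel.
    rw [phi_T_one hN, phi_T_last hn hN, smul_eq_mul, mul_assoc, mul_assoc, ← qh_add, ← qh_add,
      show 2 * sgn (D.par 1) + (2 * ((n : ℤ) - m + 1) + 2 * ((m : ℤ) - n - 1 - sgn (D.par 1))) = 0
        by ring, qh_zero, mul_one, sub_self]
  · rw [← topVec_one]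
    exact span_topVec hn hN e1 (not_exceptional_one h)
  · rw [← topVec_neg_one]
    exact span_topVec hn hN e2 (not_exceptional_neg_one h h')
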